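/- **Theorem 1.1.** Let $G$ be a second-countable locally compact (Hausdorff) abelian group, written additively, with Haar measure $m$. For measurable $A\subseteq G$ with $0<m(A)<\infty$ write $\mathbb{E}_{n\in A}\,u(n)=\frac1{m(A)}\int_A u\,dm$. Let $(\Phi_N)$ be a Følner sequence in $G$, that is, a sequence of measurable sets with $0<m(\Phi_N)<\infty$ and $m(\Phi_N\,\triangle\,(g+\Phi_N))/m(\Phi_N)\to 0$ for every $g\in G$. Let $(X,\mu,(T_g)_{g\in G})$ be an ergodic measure-preserving $G$-system: $(X,\mu)$ is a standard Borel probability space, $(g,x)\mapsto T_gx$ is a measurable action by $\mu$-preserving maps, and the only a.e. invariant functions are the a.e. constant ones. Write $T_gf=f\circ T_g$ and $e(t)=e^{2\pi i t}$ for $t\in\mathbb{T}=\mathbb{R}/\mathbb{Z}$. Let $\mathrm{Spec}$ be the set of homomorphisms $\alpha:G\to\mathbb{T}$ for which there is a non-zero $f\in L^2(\mu)$ with $T_gf=e(\alpha(g))f$ for all $g\in G$, and let $\mathcal{E}$ be the set of $f\in L^\infty(\mu)$ with $|f|=1$ such that, for some homomorphism $\alpha:G\to\mathbb{T}$, $T_gf=e(\alpha(g))f$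 for all $g\in G$. For $f\in L^\infty(\mu)$ put $\Delta_nf=f\cdot T_n\overline f$ and define the Gowers–Host–Kra seminorms by $$|||f|||_0=\int_X f\,d\mu,\qquad |||f|||_{s+1}^{2^{s+1}}=\lim_{N\to\infty}\mathbb{E}_{n\in\Phi_N}|||\Delta_nf|||_s^{2^s}\quad(s\ge 0)$$ (the limit exists and is a non-negative real number, and $|||f|||_{s+1}$ is its non-negative root). Let $a_1,\dots,a_\ell:G\to G$ be measurable maps such that: 1. (*good for seminorm estimates*) there is an integer $s\ge1$ such that, whenever $f_1,\dots,f_\ell\in L^\infty(\mu)$ and $l\in\{1,\dots,\ell\}$ satisfy $|||f_l|||_s=0$ and $f_{l+1},\dots,f_\ell\in\mathcal{E}$, one has $\lim_{N\to\infty}\mathbb{E}_{n\in\Phi_N}T_{a_1(n)}f_1\cdots T_{a_\ell(n)}f_\ell=0$ in $L^2(\mu)$; 2. (*good for equidistribution*) for all $\alpha_1,\dots,\alpha_\ell\in\mathrm{Spec}$, not all trivial, $\lim_{N\to\infty}\mathbb{E}_{n\in\Phi_N}e\big(\alpha_1(a_1(n))+\dots+\alpha_\ell(a_\ell(n))\big)=0$.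 Then $a_1,\dots,a_\ell$ are jointly ergodic for the system along $(\Phi_N)$: for all $f_1,\dots,f_\ell\in L^\infty(\mu)$, $$\lim_{N\to\infty}\mathbb{E}_{n\in\Phi_N}T_{a_1(n)}f_1\cdots T_{a_\ell(n)}f_\ell=\prod_{j=1}^{\ell}\int_X f_j\,d\mu\quad\text{in }L^2(\mu).$$ -/

import Mathlib

open MeasureTheory Filter Topology

noncomputable section

namespace LCAJoint

/-- `(Φ N)` is a Følner sequence in the additive group `G` with Haar measure `m`: the sets `Φ N` are
measurable, of positive and finite measure, and asymptotically invariant under each translation. -/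
structure IsFolnerSeq {G : Type*} [AddCommGroup G] [MeasurableSpace G]
    (m : Measure G) (Φ : ℕ → Set G) : Prop where
  nullMeasurableSet : ∀ N, NullMeasurableSet (Φ N) m
  measure_pos : ∀ N, 0 < m (Φ N)
  measure_lt_top : ∀ N, m (Φ N) < ⊤
  tendsto_symmDiff : ∀ g : G,
    Tendsto (fun N => m (symmDiff (Φ N) ((fun x => g + x) '' Φ N)) / m (Φ N)) atTop (𝓝 0)

/-- The function `T_g f = f ∘ T_g`, where `T_g x = g +ᵥ x` is the action. -/
def koopman {G X : Type*} [VAdd G X] (g : G) (f : X → ℂ) : X → ℂ :=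
  fun x => f (g +ᵥ x)

/-- The multiplicative derivative `Δ_n f = f · T_n (conj f)`. -/
def multDeriv {G X : Type*} [VAdd G X] (n : G) (f : X → ℂ) : X → ℂ :=
  fun x => f x * koopman n (fun y => starRingEnd ℂ (f y)) x

/-- The Gowers–Host–Kra seminorms of a bounded function:
`|||f|||_0 = ∫ f` and `|||f|||_{s+1} ^ 2^(s+1) = lim_N E_{n ∈ Φ N} |||Δ_n f|||_s ^ 2^s`.
The value is complex because `|||f|||_0` is; for `s ≥ 1` the limit is a nonnegative real number and
the complex power is its nonnegative root. -/
def ghkSeminorm {G X : Type*} [MeasurableSpace G] [MeasurableSpace X] [VAdd G X]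
    (m : Measure G) (Φ : ℕ → Set G) (μ : Measure X) : ℕ → (X → ℂ) → ℂ
  | 0, f => ∫ x, f x ∂μ
  | s + 1, f =>
      (limUnder atTop fun N => ⨍ n in Φ N, ghkSeminorm m Φ μ s (multDeriv n f) ^ 2 ^ s ∂m) ^
        ((1 : ℂ) / 2 ^ (s + 1))

/-- `e(t) = exp(2πit)` for `t` in `𝕋 = ℝ/ℤ`. -/
def expCircle (t : UnitAddCircle) : ℂ := (AddCircle.toCircle t : ℂ)

/-- `T_g f = e(α(g)) f` almost everywhere, for every `g`. -/
def HasEigenvalue {G X : Type*} [AddCommGroup G] [MeasurableSpace X] [VAdd G X]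
    (μ : Measure X) (α : G →+ UnitAddCircle) (f : X → ℂ) : Prop :=
  ∀ g : G, koopman g f =ᵐ[μ] fun x => expCircle (α g) * f x

/-- The spectrum: the homomorphisms `α : G → 𝕋` that have a non-zero eigenfunction in `L²(μ)`. -/
def spec (G : Type*) {X : Type*} [AddCommGroup G] [MeasurableSpace X] [VAdd G X]
    (μ : Measure X) : Set (G →+ UnitAddCircle) :=
  {α | ∃ f : X → ℂ, MemLp f 2 μ ∧ ¬ f =ᵐ[μ] 0 ∧ HasEigenvalue μ α f}

/-- The eigenfunctions of modulus one. -/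
def unimodularEigenfunctions (G : Type*) {X : Type*} [AddCommGroup G] [MeasurableSpace X]
    [VAdd G X] (μ : Measure X) : Set (X → ℂ) :=
  {f | MemLp f ⊤ μ ∧ (∀ᵐ x ∂μ, ‖f x‖ = 1) ∧ ∃ α : G →+ UnitAddCircle, HasEigenvalue μ α f}

/-- The average `E_{n ∈ A} T_{a_1(n)} f_1 ⋯ T_{a_ℓ(n)} f_ℓ`, a function on `X`. -/
def multipleAverage {G X : Type*} [MeasurableSpace G] [VAdd G X] {ℓ : ℕ}
    (m : Measure G) (A : Set G) (a : Fin ℓ → G → G) (f : Fin ℓ → X → ℂ) : X → ℂ :=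
  fun x => ⨍ n in A, ∏ j, koopman (a j n) (f j) x ∂m

/-- Convergence in `L²(μ)`. -/
def TendstoInL2 {X : Type*} [MeasurableSpace X] (μ : Measure X) (F : ℕ → X → ℂ) (L : X → ℂ) :
    Prop :=
  Tendsto (fun N => eLpNorm (fun x => F N x - L x) 2 μ) atTop (𝓝 0)

/-- `a_1, …, a_ℓ` are good for seminorm estimates for the system, along `Φ`. -/
def GoodForSeminormEstimates {G X : Type*} [AddCommGroup G] [MeasurableSpace G]
    [MeasurableSpace X] [VAdd G X] {ℓ : ℕ}
    (m : Measure G) (Φ : ℕ → Set G) (μ : Measure X) (a : Fin ℓ → G → G) : Prop :=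
  ∃ s : ℕ, 1 ≤ s ∧ ∀ f : Fin ℓ → X → ℂ, (∀ j, MemLp (f j) ⊤ μ) →
    ∀ l : Fin ℓ, ghkSeminorm m Φ μ s (f l) = 0 →
      (∀ j, l < j → f j ∈ unimodularEigenfunctions G μ) →
      TendstoInL2 μ (fun N => multipleAverage m (Φ N) a f) (fun _ => 0)

/-- `a_1, …, a_ℓ` are good for equidistribution for the system, along `Φ`. -/
def GoodForEquidistribution {G X : Type*} [AddCommGroup G] [MeasurableSpace G]
    [MeasurableSpace X] [VAdd G X] {ℓ : ℕ}
    (m : Measure G) (Φ : ℕ → Set G) (μ : Measure X) (a : Fin ℓ → G → G) : Prop :=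
  ∀ α : Fin ℓ → (G →+ UnitAddCircle), (∀ j, α j ∈ spec G μ) → (∃ j, α j ≠ 0) →
    Tendsto (fun N => ⨍ n in Φ N, expCircle (∑ j, α j (a j n)) ∂m) atTop (𝓝 0)

/-- `a_1, …, a_ℓ` are jointly ergodic for the system, along `Φ`. -/
def JointlyErgodic {G X : Type*} [MeasurableSpace G] [MeasurableSpace X] [VAdd G X] {ℓ : ℕ}
    (m : Measure G) (Φ : ℕ → Set G) (μ : Measure X) (a : Fin ℓ → G → G) : Prop :=
  ∀ f : Fin ℓ → X → ℂ, (∀ j, MemLp (f j) ⊤ μ) →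
    TendstoInL2 μ (fun N => multipleAverage m (Φ N) a f) (fun _ => ∏ j, ∫ y, f j y ∂μ)

end LCAJoint

end

open scoped ComplexConjugate

noncomputable section

namespace LCAJoint

universe u v

/-! Fix a finitely additive invariant mean `M` on the discrete group `G`. By the mean ergodic
theorem every limit along `Φ` in the definition of the seminorms equals the corresponding mean, so
`|||f|||_s ^ 2^s` is an `s`-fold iterated mean of the integrals of `Δ_{p_1} ⋯ Δ_{p_s} f`
(`ghkSeminorm_pow`). Means are defined on all bounded functions, so eigenfunctions and phases may be
chosen without regard to measurability.

The theorem is proved by induction on `l`, the functions of index at least `l` being unimodular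
eigenfunctions and the others arbitrary (`ErgodicFrom`). For `l = 0` this is equidistribution. For
the step, suppose that the averages `A_N` with arbitrary `f_l` do not tend to zero. Pairing them
with `g_N = conj A_N` along an ultrafilter yields a dual function `F`: the integral of `w F` is the
limiting correlation of `g_N` with the averages in which `w` replaces `f_l`, and `∫ f_l F ≠ 0`. The
seminorm estimate, applied with `conj F` in place of `f_l`, gives `|||F|||_s ≠ 0`. The seminorm
order is then lowered to one (`gowers_descent`), so `|∫ F| = |||F|||_1 > 0`. But the induction
hypothesis evaluates `∫ F` as `lim ∫ g_N` times the product of the `∫ f_j`, `j ≠ l`. Hence the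
averages tend to zero when some `f_j`, `j ≠ l`, has mean zero, or when they themselves have mean
zero; splitting off constants reduces the general case to these.

For the descent, `|||F|||_{t+2} > 0` says that the derivatives `Δ_p F`, `p ∈ G^t`, have positive
second seminorm on average. So they correlate with eigenfunctions `χ_p` of eigenvalue `α_p`
(`exists_eigenfunction_of_gowers_two`). Write `Δ_p F = F · y_p`, where `y_p` is a product of factors
that each, up to a translation, omit one variable. Duality rewrites the correlations in terms of the
averages, Cauchy–Schwarz removes `y_p` (`IsState.norm_iter_pow_le_doubled`), and the induction
hypothesis annihilates every configuration of eigenfunctions in position `l` with non-trivial total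
eigenvalue. Therefore `p ↦ α_p` agrees, on a set of positive mean, with a sum of functions of fewer
variables (`IsState.exists_lowRank_of_doubled`). A second Cauchy–Schwarz argument removes such
phases at the cost of the seminorm of order `t + 1` only (`IsState.norm_iter_phase_pow_le`).

Both Cauchy–Schwarz arguments take place for an abstract invariant positive definite function
(`StarAction.IsState`), since they are needed for the integral and for the limiting correlations
`jointState` alike. -/

/-- A complex-valued function is bounded. -/
def Bdd {α : Type*} (u : α → ℂ) : Prop := ∃ C : ℝ, ∀ n, ‖u n‖ ≤ C

/-- `M` is a mean on the bounded functions on `α`. -/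
structure IsMean {α : Type*} (M : (α → ℂ) → ℂ) : Prop where
  add : ∀ {u v : α → ℂ}, Bdd u → Bdd v → M (fun n => u n + v n) = M u + M v
  smul : ∀ (c : ℂ) {u : α → ℂ}, Bdd u → M (fun n => c * u n) = c * M u
  map_conj : ∀ {u : α → ℂ}, Bdd u → M (fun n => conj (u n)) = conj (M u)
  re_nonneg : ∀ {u : α → ℂ}, Bdd u → (∀ n, 0 ≤ (u n).re) → 0 ≤ (M u).re
  const : ∀ c : ℂ, M (fun _ => c) = c
  norm_le : ∀ {u : α → ℂ} {C : ℝ}, (∀ n, ‖u n‖ ≤ C) → ‖M u‖ ≤ C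

/-- `M` is a translation invariant mean on the bounded functions on `G`. -/
structure IsInvMean {G : Type*} [Add G] (M : (G → ℂ) → ℂ) : Prop extends IsMean M where
  shift : ∀ (k : G) {u : G → ℂ}, Bdd u → M (fun n => u (n + k)) = M u

/-! ### Bounded functions and means -/

section Bdd

variable {α : Type*} {u v : α → ℂ}

lemma bdd_const (c : ℂ) : Bdd (fun _ : α => c) := ⟨‖c‖, fun _ => le_rfl⟩

lemma Bdd.add (hu : Bdd u) (hv : Bdd v) : Bdd (fun n => u n + v n) := by
  obtain ⟨C, hC⟩ := hu
  obtain ⟨D, hD⟩ := hv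
  exact ⟨C + D, fun n => (norm_add_le _ _).trans (add_le_add (hC n) (hD n))⟩

lemma Bdd.mul (hu : Bdd u) (hv : Bdd v) : Bdd (fun n => u n * v n) := by
  obtain ⟨C, hC⟩ := hu
  obtain ⟨D, hD⟩ := hv
  refine ⟨C * D, fun n => ?_⟩
  rw [norm_mul]
  exact mul_le_mul (hC n) (hD n) (norm_nonneg _) ((norm_nonneg _).trans (hC n))

lemma Bdd.smul (c : ℂ) (hu : Bdd u) : Bdd (fun n => c * u n) := (bdd_const c).mul hu

lemma Bdd.neg (hu : Bdd u) : Bdd (fun n => -u n) := by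
  obtain ⟨C, hC⟩ := hu
  exact ⟨C, fun n => by simpa using hC n⟩

lemma Bdd.sub (hu : Bdd u) (hv : Bdd v) : Bdd (fun n => u n - v n) := by
  simpa [sub_eq_add_neg] using hu.add hv.neg

lemma Bdd.conj (hu : Bdd u) : Bdd (fun n => conj (u n)) := by
  obtain ⟨C, hC⟩ := hu
  exact ⟨C, fun n => by simpa using hC n⟩

lemma Bdd.comp {β : Type*} (hu : Bdd u) (f : β → α) : Bdd (fun n => u (f n)) := by
  obtain ⟨C, hC⟩ := hu
  exact ⟨C, fun n => hC _⟩

lemma Bdd.norm (hu : Bdd u) : Bdd (fun n => (‖u n‖ : ℂ)) := by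
  obtain ⟨C, hC⟩ := hu
  exact ⟨C, fun n => by simpa using hC n⟩

lemma Bdd.sum {ι : Type*} (s : Finset ι) {w : ι → α → ℂ} (h : ∀ i ∈ s, Bdd (w i)) :
    Bdd (fun n => ∑ i ∈ s, w i n) := by
  classical
  induction s using Finset.induction_on with
  | empty => simpa using bdd_const 0
  | insert i s his ih =>
    simp only [Finset.sum_insert his]
    exact (h i (by simp)).add (ih fun j hj => h j (by simp [hj]))

end Bdd

namespace IsMean

variable {α : Type*} {M : (α → ℂ) → ℂ} {u v : α → ℂ}

lemma sub (hM : IsMean M) (hu : Bdd u) (hv : Bdd v) :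
    M (fun n => u n - v n) = M u - M v := by
  have h := hM.smul (-1) hv
  have := hM.add hu (Bdd.smul (-1) hv)
  simp only [h] at this
  simpa [sub_eq_add_neg] using this

lemma sum (hM : IsMean M) {ι : Type*} (s : Finset ι) {w : ι → α → ℂ} (h : ∀ i ∈ s, Bdd (w i)) :
    M (fun n => ∑ i ∈ s, w i n) = ∑ i ∈ s, M (w i) := by
  classical
  induction s using Finset.induction_on with
  | empty => simpa using hM.const 0
  | insert i s his ih =>
    simp only [Finset.sum_insert his]
    rw [hM.add (h i (by simp)) (Bdd.sum s fun j hj => h j (by simp [hj])),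
      ih fun j hj => h j (by simp [hj])]

lemma re_mono (hM : IsMean M) (hu : Bdd u) (hv : Bdd v) (h : ∀ n, (u n).re ≤ (v n).re) :
    (M u).re ≤ (M v).re := by
  have := hM.re_nonneg (hv.sub hu) (fun n => by simpa using h n)
  rw [hM.sub hv hu] at this
  simpa using this

/-- Multiplying by the unimodular constant that makes `M u` real and nonnegative reduces this to
monotonicity of real parts. -/
lemma norm_le_re (hM : IsMean M) (hu : Bdd u) : ‖M u‖ ≤ (M (fun n => (‖u n‖ : ℂ))).re := by
  obtain ⟨c, hc, hcu⟩ : ∃ c : ℂ, ‖c‖ = 1 ∧ c * M u = ‖M u‖ := by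
    rcases eq_or_ne (M u) 0 with h | h
    · exact ⟨1, by simp, by simp [h]⟩
    · refine ⟨‖M u‖ / M u, ?_, ?_⟩
      · simp [h]
      · field_simp
  have h1 := hM.re_mono (Bdd.smul c hu) hu.norm (fun n => by
    refine (Complex.re_le_norm _).trans ?_
    simp [hc])
  rw [hM.smul c hu, hcu] at h1
  simpa using h1

lemma im_eq_zero (hM : IsMean M) (hu : Bdd u) (h : ∀ n, (u n).im = 0) : (M u).im = 0 := by
  have h1 := hM.map_conj hu
  have h2 : (fun n => conj (u n)) = u := by
    funext n
    exact Complex.conj_eq_iff_im.2 (h n)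
  rw [h2] at h1
  exact Complex.conj_eq_iff_im.1 h1.symm

end IsMean

/-! ### Ultralimits -/

section UltraLimit

variable {ι : Type*}

/-- The limit of a bounded function along an ultrafilter. -/
def ulim (U : Ultrafilter ι) (u : ι → ℂ) : ℂ := limUnder (U : Filter ι) u

lemma tendsto_ulim (U : Ultrafilter ι) {u : ι → ℂ} (hu : Bdd u) :
    Tendsto u U (𝓝 (ulim U u)) := by
  obtain ⟨C, hC⟩ := hu
  have hc : IsCompact (Metric.closedBall (0 : ℂ) C) := isCompact_closedBall _ _
  obtain ⟨a, -, ha⟩ := hc.ultrafilter_le_nhds (U.map u)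
    (by
      rw [le_principal_iff]
      exact mem_map.2 (Filter.univ_mem' fun n => by simpa using hC n))
  exact tendsto_nhds_limUnder ⟨a, ha⟩

lemma ulim_eq (U : Ultrafilter ι) {u : ι → ℂ} {a : ℂ} (h : Tendsto u U (𝓝 a)) : ulim U u = a :=
  h.limUnder_eq

lemma isMean_ulim (U : Ultrafilter ι) : IsMean (ulim U) where
  add hu hv := ulim_eq U ((tendsto_ulim U hu).add (tendsto_ulim U hv))
  smul _ _ hu := ulim_eq U ((tendsto_ulim U hu).const_mul _)
  map_conj hu := ulim_eq U ((Complex.continuous_conj.tendsto _).comp (tendsto_ulim U hu))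
  re_nonneg hu h := ge_of_tendsto' ((Complex.continuous_re.tendsto _).comp (tendsto_ulim U hu)) h
  const _ := ulim_eq U tendsto_const_nhds
  norm_le h := le_of_tendsto' (tendsto_ulim U ⟨_, h⟩).norm h

/-- The ultralimit of a family of means is a mean. -/
lemma isMean_ulim_comp (U : Ultrafilter ι) {α : Type*} {M : ι → (α → ℂ) → ℂ}
    (hM : ∀ i, IsMean (M i)) : IsMean (fun u => ulim U fun i => M i u) := by
  have hb : ∀ {u : α → ℂ}, Bdd u → Bdd (fun i => M i u) := fun ⟨C, hC⟩ =>
    ⟨C, fun i => (hM i).norm_le hC⟩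
  have hU := isMean_ulim U
  refine ⟨fun hu hv => ?_, fun c _ hu => ?_, fun hu => ?_, fun hu h => ?_, fun c => ?_,
    fun h => ?_⟩
  · simp only [(hM _).add hu hv]
    exact hU.add (hb hu) (hb hv)
  · simp only [(hM _).smul c hu]
    exact hU.smul c (hb hu)
  · simp only [(hM _).map_conj hu]
    exact hU.map_conj (hb hu)
  · exact hU.re_nonneg (hb hu) fun i => (hM i).re_nonneg hu h
  · simp only [(hM _).const c]
    exact hU.const c
  · exact hU.norm_le fun i => (hM i).norm_le h

end UltraLimit

/-! ### Amenability of discrete abelian groups -/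

section Existence

variable {G : Type*} [AddCommGroup G]

/-- The average of a mean over the first `N + 1` multiples of `g`. -/
def avgMean (M : (G → ℂ) → ℂ) (g : G) (N : ℕ) (u : G → ℂ) : ℂ :=
  M (fun n => (N + 1 : ℂ)⁻¹ * ∑ i ∈ Finset.range (N + 1), u (n + i • g))

lemma bdd_avg {u : G → ℂ} (hu : Bdd u) (g : G) (N : ℕ) :
    Bdd (fun n => ∑ i ∈ Finset.range (N + 1), u (n + i • g)) :=
  Bdd.sum _ fun _ _ => hu.comp _

lemma avgMean_eq {M : (G → ℂ) → ℂ} (hM : IsMean M) (g : G) (N : ℕ) {u : G → ℂ} (hu : Bdd u) :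
    avgMean M g N u = (N + 1 : ℂ)⁻¹ * ∑ i ∈ Finset.range (N + 1), M (fun n => u (n + i • g)) := by
  rw [avgMean, hM.smul _ (bdd_avg hu g N), hM.sum _ fun _ _ => hu.comp _]

lemma isMean_avgMean {M : (G → ℂ) → ℂ} (hM : IsMean M) (g : G) (N : ℕ) :
    IsMean (avgMean M g N) := by
  have hN : (N + 1 : ℂ) ≠ 0 := by exact_mod_cast N.succ_ne_zero
  refine ⟨fun hu hv => ?_, fun c u hu => ?_, fun {u} hu => ?_, fun {u} hu h => ?_, fun c => ?_,
    fun {u C} h => ?_⟩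
  · rw [avgMean_eq hM g N (hu.add hv), avgMean_eq hM g N hu, avgMean_eq hM g N hv, ← mul_add,
      ← Finset.sum_add_distrib]
    congr 1
    exact Finset.sum_congr rfl fun i _ => hM.add (hu.comp _) (hv.comp _)
  · rw [avgMean_eq hM g N (hu.smul c), avgMean_eq hM g N hu, mul_left_comm]
    congr 1
    rw [Finset.mul_sum]
    exact Finset.sum_congr rfl fun i _ => hM.smul c (hu.comp _)
  · rw [avgMean_eq hM g N hu.conj, avgMean_eq hM g N hu, map_mul, map_sum]
    congr 1
    · simp
    · exact Finset.sum_congr rfl fun i _ => hM.map_conj (hu.comp (fun n => n + i • g))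
  · refine hM.re_nonneg ((bdd_avg hu g N).smul _) fun n => ?_
    have : ((N : ℂ) + 1)⁻¹ = (((N : ℝ) + 1)⁻¹ : ℝ) := by push_cast; rfl
    rw [this, Complex.re_ofReal_mul, Complex.re_sum]
    exact mul_nonneg (by positivity) (Finset.sum_nonneg fun i _ => h _)
  · rw [avgMean_eq hM g N (bdd_const c)]
    simp only [hM.const, Finset.sum_const, Finset.card_range, nsmul_eq_mul]
    push_cast
    field_simp
  · refine hM.norm_le fun n => ?_
    rw [norm_mul, norm_inv]
    have h1 : ‖(N + 1 : ℂ)‖ = N + 1 := by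
      exact_mod_cast Complex.norm_natCast (N + 1)
    rw [h1, inv_mul_le_iff₀ (by positivity)]
    refine (norm_sum_le _ _).trans ((Finset.sum_le_sum fun i _ => h _).trans ?_)
    simp

/-- Average over `n, n + g, …, n + N g` and take an ultralimit in `N`. A shift by `g` changes the
average by two boundary terms divided by `N + 1`; invariance under `S` survives because `G` is
commutative. -/
lemma exists_mean_shift_insert {M : (G → ℂ) → ℂ} (hM : IsMean M) (S : Set G)
    (hS : ∀ k ∈ S, ∀ u : G → ℂ, Bdd u → M (fun n => u (n + k)) = M u) (g : G) :
    ∃ M' : (G → ℂ) → ℂ, IsMean M' ∧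
      ∀ k ∈ insert g S, ∀ u : G → ℂ, Bdd u → M' (fun n => u (n + k)) = M' u := by
  let U : Ultrafilter ℕ := hyperfilter ℕ
  refine ⟨fun u => ulim U fun N => avgMean M g N u,
    isMean_ulim_comp U fun N => isMean_avgMean hM g N, fun k hk u hu => ?_⟩
  have hb : Bdd (fun N => avgMean M g N u) := by
    obtain ⟨C, hC⟩ := hu
    exact ⟨C, fun N => (isMean_avgMean hM g N).norm_le hC⟩
  rcases hk with rfl | hk
  · refine ulim_eq U ?_
    have h1 : ∀ N, avgMean M k N (fun n => u (n + k)) = avgMean M k N u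
        + (N + 1 : ℂ)⁻¹ * (M (fun n => u (n + (N + 1) • k)) - M u) := by
      intro N
      rw [avgMean_eq hM k N (hu.comp _), avgMean_eq hM k N hu, ← mul_add]
      congr 1
      have h2 := Finset.sum_range_succ (fun i => M (fun n => u (n + i • k))) (N + 1)
      rw [Finset.sum_range_succ'] at h2
      simp only [zero_smul, add_zero] at h2
      have h3 : ∑ i ∈ Finset.range (N + 1), M (fun n => u (n + i • k + k))
          = ∑ i ∈ Finset.range (N + 1), M (fun n => u (n + (i + 1) • k)) := by
        refine Finset.sum_congr rfl fun i _ => ?_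
        simp only [add_smul, one_smul, add_assoc]
      rw [h3]
      linear_combination h2
    simp only [h1]
    obtain ⟨C, hC⟩ := hu
    have h4 : Tendsto (fun N : ℕ => (N + 1 : ℂ)⁻¹ * (M (fun n => u (n + (N + 1) • k)) - M u)) atTop
        (𝓝 0) := by
      have h5 : Tendsto (fun N : ℕ => ((N : ℝ) + 1)⁻¹ * (C + C)) atTop (𝓝 0) := by
        have := (tendsto_one_div_add_atTop_nhds_zero_nat (𝕜 := ℝ)).mul_const (C + C)
        simpa using this
      refine squeeze_zero_norm (fun N => ?_) h5
      rw [norm_mul, norm_inv]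
      have h6 : ‖(N + 1 : ℂ)‖ = N + 1 := by
        exact_mod_cast Complex.norm_natCast (N + 1)
      rw [h6]
      gcongr
      exact (norm_sub_le _ _).trans (add_le_add (hM.norm_le fun n => hC _) (hM.norm_le hC))
    have h7 := (tendsto_ulim U hb).add (h4.mono_left (Nat.hyperfilter_le_atTop))
    simpa using h7
  · refine congrArg (ulim U) (funext fun N => ?_)
    rw [avgMean_eq hM g N (hu.comp _), avgMean_eq hM g N hu]
    congr 1
    refine Finset.sum_congr rfl fun i _ => ?_
    rw [← hS k hk _ (hu.comp (fun n => n + i • g))]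
    congr 1
    funext n
    rw [add_right_comm]

variable (G) in
/-- Discrete abelian groups are amenable. -/
theorem exists_isInvMean : ∃ M : (G → ℂ) → ℂ, IsInvMean M := by
  classical
  have h1 : ∀ S : Finset G, ∃ M : (G → ℂ) → ℂ, IsMean M ∧
      ∀ k ∈ (S : Set G), ∀ u : G → ℂ, Bdd u → M (fun n => u (n + k)) = M u := by
    intro S
    induction S using Finset.induction_on with
    | empty =>
      refine ⟨fun u => u 0, ⟨fun _ _ => rfl, fun _ _ _ => rfl, fun _ => rfl, fun _ h => h 0,
        fun _ => rfl, fun h => h 0⟩, by simp⟩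
    | insert g S _ ih =>
      obtain ⟨M, hM, hS⟩ := ih
      simpa using exists_mean_shift_insert hM (S : Set G) hS g
  choose M hM hS using h1
  -- Every `k` belongs to `U`-almost every finite set `S`, so the ultralimit is invariant under all
  -- of `G`.
  let U : Ultrafilter (Finset G) := Ultrafilter.of atTop
  refine ⟨fun u => ulim U fun S => M S u, isMean_ulim_comp U hM, fun k u hu => ?_⟩
  refine ulim_eq U ?_
  have hb : Bdd (fun S => M S u) := by
    obtain ⟨C, hC⟩ := hu
    exact ⟨C, fun S => (hM S).norm_le hC⟩
  refine (tendsto_ulim U hb).congr' ?_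
  have : ∀ᶠ S : Finset G in (U : Filter (Finset G)), k ∈ S :=
    (Ultrafilter.of_le atTop) (by
      filter_upwards [eventually_ge_atTop {k}] with S hS
      exact hS (by simp))
  filter_upwards [this] with S hk
  exact (hS S k (by simpa using hk) u hu).symm

end Existence

/-! ### Positive semidefinite kernels and Cauchy–Schwarz for means -/

/-- Positive semidefinite kernels. -/
structure IsPSD {ι : Type*} (K : ι → ι → ℂ) : Prop where
  conj_symm : ∀ i j, conj (K i j) = K j i
  re_sum_nonneg : ∀ {n : ℕ} (x : Fin n → ι) (c : Fin n → ℂ),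
    0 ≤ (∑ i, ∑ j, conj (c i) * c j * K (x i) (x j)).re

namespace IsPSD

variable {ι κ α : Type*} {K : ι → ι → ℂ}

lemma comp (hK : IsPSD K) (f : κ → ι) : IsPSD fun i j => K (f i) (f j) :=
  ⟨fun _ _ => hK.conj_symm _ _, fun x c => hK.re_sum_nonneg (fun i => f (x i)) c⟩

lemma mul_conj (hK : IsPSD K) (d : ι → ℂ) : IsPSD fun i j => conj (d i) * d j * K i j := by
  refine ⟨fun i j => ?_, fun x c => ?_⟩
  · simp only [map_mul, Complex.conj_conj, hK.conj_symm]
    ring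
  · refine (hK.re_sum_nonneg x (fun i => c i * d (x i))).trans_eq (congrArg Complex.re ?_)
    refine Finset.sum_congr rfl fun i _ => Finset.sum_congr rfl fun j _ => ?_
    simp only [map_mul]
    ring

lemma mean {M : (α → ℂ) → ℂ} (hM : IsMean M) {K : α → ι → ι → ℂ} (hK : ∀ a, IsPSD (K a))
    (hb : ∀ i j, Bdd fun a => K a i j) : IsPSD fun i j => M fun a => K a i j := by
  refine ⟨fun i j => ?_, fun x c => ?_⟩
  · rw [← hM.map_conj (hb i j)]
    simp only [(hK _).conj_symm]
  · have h : ∑ i, ∑ j, conj (c i) * c j * M (fun a => K a (x i) (x j))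
        = M fun a => ∑ i, ∑ j, conj (c i) * c j * K a (x i) (x j) := by
      rw [hM.sum _ fun i _ => Bdd.sum _ fun j _ => (hb _ _).smul _]
      refine Finset.sum_congr rfl fun i _ => ?_
      rw [hM.sum _ fun j _ => (hb _ _).smul _]
      exact Finset.sum_congr rfl fun j _ => (hM.smul _ (hb _ _)).symm
    rw [h]
    exact hM.re_nonneg (Bdd.sum _ fun i _ => Bdd.sum _ fun j _ => (hb _ _).smul _)
      fun a => (hK a).re_sum_nonneg x c

open scoped ComplexOrder in
/-- A positive semidefinite kernel is the Gram kernel of vectors in a Hilbert space. -/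
theorem exists_hilbert {ι : Type u} {K : ι → ι → ℂ} (hK : IsPSD K) :
    ∃ (H : Type u) (_ : NormedAddCommGroup H) (_ : InnerProductSpace ℂ H) (_ : CompleteSpace H)
      (ψ : ι → H), ∀ i j, inner ℂ (ψ i) (ψ j) = K i j := by
  -- The scalar kernel is viewed as a kernel of operators on `ℂ`; its reproducing kernel Hilbert
  -- space is `H`, and `ψ i` is the kernel function at `i` applied to `1`.
  let L : Matrix ι ι (ℂ →L[ℂ] ℂ) := .of fun i j => K i j • ContinuousLinearMap.id ℂ ℂ
  have hL : L.PosSemidef := by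
    have htfae := (RKHS.posSemidef_tfae (K := L)).out 0 2
    refine htfae.mpr ⟨?_, fun c => ?_⟩
    · ext i j
      have h1 : star (ContinuousLinearMap.id ℂ ℂ) = ContinuousLinearMap.id ℂ ℂ := star_one _
      simp [L, Matrix.conjTranspose_apply, hK.conj_symm, h1]
    · classical
      let e := c.support.equivFin
      have h := hK.re_sum_nonneg (fun i => (e.symm i : ι)) (fun i => c (e.symm i))
      refine h.trans_eq ?_
      have h2 : ∀ f : ι → ℂ, ∑ i, f (e.symm i) = ∑ i ∈ c.support, f i := fun f => by
        rw [Equiv.sum_comp e.symm (fun i => f i), Finset.sum_coe_sort]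
      rw [Finsupp.sum, Finset.sum_comm]
      rw [← h2 (fun i => c.sum fun x' w' => inner ℂ (L x' i (c i)) w')]
      simp only [Finsupp.sum]
      rw [Finset.sum_comm]
      change Complex.re _ = Complex.re _
      congr 1
      refine Finset.sum_congr rfl fun i _ => ?_
      rw [← h2]
      refine Finset.sum_congr rfl fun j _ => ?_
      simp [L, hK.conj_symm]
      ring
  have : Fact L.PosSemidef := ⟨hL⟩
  refine ⟨RKHS.OfKernel L, inferInstance, inferInstance, inferInstance,
    fun i => RKHS.kerFun (RKHS.OfKernel L) i 1, fun i j => ?_⟩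
  rw [← RKHS.kernel_inner, RKHS.OfKernel.kernel_ofKernel]
  simp [L, hK.conj_symm]

end IsPSD

section MeanVector

variable {α H : Type*} [NormedAddCommGroup H] [InnerProductSpace ℂ H]

lemma bdd_inner {v w : α → H} {C D : ℝ} (hv : ∀ n, ‖v n‖ ≤ C) (hw : ∀ n, ‖w n‖ ≤ D) :
    Bdd fun n => inner ℂ (v n) (w n) :=
  ⟨C * D, fun n => (norm_inner_le_norm _ _).trans
    (mul_le_mul (hv n) (hw n) (norm_nonneg _) ((norm_nonneg _).trans (hv n)))⟩

variable [CompleteSpace H]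

/-- The weak mean of a bounded family of vectors. -/
lemma exists_mean_vector {M : (α → ℂ) → ℂ} (hM : IsMean M) {v : α → H} {C : ℝ}
    (hC : ∀ n, ‖v n‖ ≤ C) : ∃ V : H, (∀ y, inner ℂ V y = M fun n => inner ℂ (v n) y) ∧
      ∀ y, inner ℂ y V = M fun n => inner ℂ y (v n) := by
  have hb : ∀ y, Bdd fun n => inner ℂ (v n) y := fun y =>
    bdd_inner (w := fun _ => y) hC fun _ => le_rfl
  let f : H →ₗ[ℂ] ℂ :=
    { toFun := fun y => M fun n => inner ℂ (v n) y
      map_add' := fun x y => by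
        simp only [inner_add_right]
        exact hM.add (hb x) (hb y)
      map_smul' := fun c y => by
        simp only [inner_smul_right]
        exact hM.smul c (hb y) }
  let F : H →L[ℂ] ℂ := f.mkContinuous C fun y => hM.norm_le fun n =>
    (norm_inner_le_norm _ _).trans (mul_le_mul_of_nonneg_right (hC n) (norm_nonneg _))
  have h1 : ∀ y, inner ℂ ((InnerProductSpace.toDual ℂ H).symm F) y
      = M fun n => inner ℂ (v n) y := fun y => InnerProductSpace.toDual_symm_apply
  refine ⟨(InnerProductSpace.toDual ℂ H).symm F, h1, fun y => ?_⟩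
  rw [← inner_conj_symm, h1, ← hM.map_conj (hb y)]
  simp only [inner_conj_symm]

end MeanVector

namespace IsPSD

variable {ι α : Type*} {K : ι → ι → ℂ} {M : (α → ℂ) → ℂ}

/-- The Cauchy–Schwarz inequality for means of positive semidefinite kernels. -/
theorem mean_cauchySchwarz (hK : IsPSD K) (hM : IsMean M) {C : ℝ} (hC : ∀ i, ‖K i i‖ ≤ C)
    (b : ι) (v : α → ι) :
    ‖M fun n => K b (v n)‖ ^ 2 ≤ (K b b).re * (M fun n => M fun n' => K (v n) (v n')).re := by
  obtain ⟨H, _, _, _, ψ, hψ⟩ := hK.exists_hilbert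
  have hn : ∀ i, ‖ψ i‖ ≤ √C := fun i => by
    refine Real.le_sqrt_of_sq_le ?_
    have := hC i
    rwa [← hψ, inner_self_eq_norm_sq_to_K, norm_pow, RCLike.norm_ofReal, abs_norm] at this
  -- With `V` the weak mean of the vectors `ψ (v n)`, the left side is `|⟪ψ b, V⟫|²` and the double
  -- mean is `‖V‖²`. Only Cauchy–Schwarz for two vectors remains, and no means are interchanged.
  obtain ⟨V, hV1, hV2⟩ := exists_mean_vector hM fun n => hn (v n)
  simp only [← hψ, ← hV2, ← hV1]
  have h : ∀ x : H, (inner ℂ x x).re = ‖x‖ ^ 2 := fun x => (norm_sq_eq_re_inner (𝕜 := ℂ) x).symm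
  rw [h, h, ← mul_pow]
  gcongr
  exact norm_inner_le_norm _ _

/-- The double mean is `‖V‖²` for the weak mean `V` of the vectors representing the kernel. -/
theorem mean_mean_nonneg (hK : IsPSD K) (hM : IsMean M) {C : ℝ} (hC : ∀ i, ‖K i i‖ ≤ C)
    (v : α → ι) : 0 ≤ (M fun n => M fun n' => K (v n) (v n')).re ∧
      (M fun n => M fun n' => K (v n) (v n')).im = 0 := by
  obtain ⟨H, _, _, _, ψ, hψ⟩ := hK.exists_hilbert
  have hn : ∀ i, ‖ψ i‖ ≤ √C := fun i => by
    refine Real.le_sqrt_of_sq_le ?_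
    have := hC i
    rwa [← hψ, inner_self_eq_norm_sq_to_K, norm_pow, RCLike.norm_ofReal, abs_norm] at this
  obtain ⟨V, hV1, hV2⟩ := exists_mean_vector hM fun n => hn (v n)
  simp only [← hψ, ← hV2, ← hV1]
  exact ⟨inner_self_nonneg (𝕜 := ℂ), inner_self_im (𝕜 := ℂ) V⟩

end IsPSD

/-! ### Følner averages and the mean ergodic theorem -/

section Folner

variable {G : Type*} [AddCommGroup G] [MeasurableSpace G] [MeasurableAdd G] {m : Measure G}
  [m.IsAddLeftInvariant] {Φ : ℕ → Set G}

lemma norm_setIntegral_sub_le {Ω : Type*} [MeasurableSpace Ω] {ν : Measure Ω} {A B : Set Ω}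
    (hA : NullMeasurableSet A ν) (hB : NullMeasurableSet B ν) (hA' : ν A < ⊤) (hB' : ν B < ⊤)
    {φ : Ω → ℂ} (hφ : Measurable φ) {C : ℝ} (hC : ∀ n, ‖φ n‖ ≤ C) :
    ‖(∫ n in A, φ n ∂ν) - ∫ n in B, φ n ∂ν‖ ≤ 2 * C * ν.real (symmDiff A B) := by
  have hi : ∀ S : Set Ω, ν S < ⊤ → IntegrableOn φ S ν := fun S hS =>
    Measure.integrableOn_of_bounded hS.ne hφ.aestronglyMeasurable (M := C)
      (Eventually.of_forall hC)
  have hfin : ν (symmDiff A B) < ⊤ := by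
    refine (measure_mono ?_).trans_lt (measure_union_lt_top hA' hB')
    exact symmDiff_le_sup
  have h1 := integral_inter_add_sdiff₀ (s := A) hB (hi A hA')
  have h2 := integral_inter_add_sdiff₀ (s := B) hA (hi B hB')
  rw [Set.inter_comm] at h2
  have h3 : (∫ n in A, φ n ∂ν) - ∫ n in B, φ n ∂ν
      = (∫ n in A \ B, φ n ∂ν) - ∫ n in B \ A, φ n ∂ν := by
    rw [← h1, ← h2]
    ring
  have h4 : ∀ S : Set Ω, S ⊆ symmDiff A B → ‖∫ n in S, φ n ∂ν‖ ≤ C * ν.real (symmDiff A B) := by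
    intro S hS
    rcases isEmpty_or_nonempty Ω with hΩ | ⟨⟨x⟩⟩
    · have : S = ∅ := Set.eq_empty_of_isEmpty S
      have : symmDiff A B = ∅ := Set.eq_empty_of_isEmpty _
      simp [*]
    have hC0 : 0 ≤ C := (norm_nonneg _).trans (hC x)
    refine (norm_setIntegral_le_of_norm_le_const ((measure_mono hS).trans_lt hfin)
      fun n _ => hC n).trans ?_
    exact mul_le_mul_of_nonneg_left (measureReal_mono hS hfin.ne) hC0
  rw [h3]
  refine (norm_sub_le _ _).trans ?_
  have h5 := h4 (A \ B) (fun x hx => Or.inl hx)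
  have h6 := h4 (B \ A) (fun x hx => Or.inr hx)
  linarith

/-- Shifting the integrand amounts to translating the domain, which changes a Følner set by a
negligible proportion of its measure. -/
lemma IsFolnerSeq.tendsto_average_shift (hΦ : IsFolnerSeq m Φ) {φ : G → ℂ} (hφ : Measurable φ)
    (hb : Bdd φ) (k : G) :
    Tendsto (fun N => (⨍ n in Φ N, φ n ∂m) - ⨍ n in Φ N, φ (n + k) ∂m) atTop (𝓝 0) := by
  obtain ⟨C, hC⟩ := hb
  have hmp : MeasurePreserving (fun x => k + x) m m := measurePreserving_add_left m k
  have hemb : MeasurableEmbedding (fun x : G => k + x) := measurableEmbedding_addLeft k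
  have h0 := (ENNReal.tendsto_toReal ENNReal.zero_ne_top).comp (hΦ.tendsto_symmDiff k)
  have h1 := h0.const_mul (2 * C)
  simp only [ENNReal.toReal_zero, mul_zero] at h1
  refine squeeze_zero_norm (fun N => ?_) h1
  have h2 : ∫ n in Φ N, φ (n + k) ∂m = ∫ n in (fun x => k + x) '' Φ N, φ n ∂m := by
    rw [hmp.setIntegral_image_emb hemb]
    simp only [add_comm k]
  have hm : m ((fun x => k + x) '' Φ N) = m (Φ N) := by
    have := hmp.measure_preimage_emb hemb ((fun x => k + x) '' Φ N)
    rw [Set.preimage_image_eq _ hemb.injective] at this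
    exact this.symm
  have hnull : NullMeasurableSet ((fun x => k + x) '' Φ N) m := by
    have hpre : (fun x => k + x) '' Φ N = (fun x => -k + x) ⁻¹' Φ N := by
      ext x
      simp only [Set.mem_image, Set.mem_preimage]
      constructor
      · rintro ⟨y, hy, rfl⟩
        simpa using hy
      · intro hx
        exact ⟨_, hx, by simp⟩
    rw [hpre]
    exact (hΦ.nullMeasurableSet N).preimage
      (measurePreserving_add_left m (-k)).quasiMeasurePreserving
  rw [setAverage_eq, setAverage_eq, h2, ← smul_sub, norm_smul]
  have h3 := norm_setIntegral_sub_le (hΦ.nullMeasurableSet N) hnull (hΦ.measure_lt_top N)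
    (hm ▸ hΦ.measure_lt_top N) hφ hC
  have h4 : 0 < m.real (Φ N) :=
    ENNReal.toReal_pos (hΦ.measure_pos N).ne' (hΦ.measure_lt_top N).ne
  rw [norm_inv, Real.norm_of_nonneg h4.le]
  refine (mul_le_mul_of_nonneg_left h3 (by positivity)).trans_eq ?_
  simp only [Function.comp_apply, ENNReal.toReal_div, Measure.real]
  ring

/-- The mean ergodic theorem for correlations of a stationary family of vectors. -/
theorem IsFolnerSeq.tendsto_average_inner (hΦ : IsFolnerSeq m Φ) {M : (G → ℂ) → ℂ}
    (hM : IsInvMean M) {H : Type*} [NormedAddCommGroup H] [InnerProductSpace ℂ H] [CompleteSpace H]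
    {v : G → H} {C : ℝ} (hC : ∀ n, ‖v n‖ ≤ C)
    (hv : ∀ p q k, inner ℂ (v (p + k)) (v (q + k)) = inner ℂ (v p) (v q))
    (hmeas : Measurable fun n => inner ℂ (v 0) (v n)) :
    Tendsto (fun N => ⨍ n in Φ N, inner ℂ (v 0) (v n) ∂m) atTop
      (𝓝 (M fun n => inner ℂ (v 0) (v n))) := by
  obtain ⟨V, hV1, hV2⟩ := exists_mean_vector hM.toIsMean hC
  set φ : G → ℂ := fun n => inner ℂ (v 0) (v n) with hφ
  have hφb : Bdd φ := bdd_inner (v := fun _ => v 0) (fun _ => hC 0) hC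
  -- By stationarity `k ↦ ⟪v n, v k⟫` is a translate of `φ`, so `V` has the same inner product with
  -- all `v n`. This value is then also `‖V‖²`, hence real.
  have hconst : ∀ n, inner ℂ (v n) V = M φ := by
    intro n
    rw [hV2, ← hM.shift n (bdd_inner (v := fun _ => v n) (fun _ => hC n) hC)]
    congr 1
    funext k
    rw [hφ]
    have := hv 0 k n
    rwa [zero_add] at this
  have hVV : inner ℂ V V = M φ := by
    rw [hV1]
    simp only [hconst]
    exact hM.const _
  have hconst' : ∀ n, inner ℂ V (v n) = M φ := by
    intro n
    rw [← inner_conj_symm, hconst, ← hVV, inner_conj_symm]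
  -- A closed half-space that contains every `v n` contains their weak mean; apply Hahn–Banach.
  have hmem : V ∈ closure (convexHull ℝ (Set.range v)) := by
    by_contra hnot
    obtain ⟨f, u, hf1, hf2⟩ := RCLike.geometric_hahn_banach_closed_point (𝕜 := ℂ)
      (convex_convexHull ℝ (Set.range v)).closure isClosed_closure hnot
    have hfw : ∀ y, f y = inner ℂ ((InnerProductSpace.toDual ℂ H).symm f) y := fun y =>
      InnerProductSpace.toDual_symm_apply.symm
    have h1 : (f V).re ≤ u := by
      rw [hfw, hV2]
      refine (hM.re_mono (v := fun _ => (u : ℂ)) (bdd_inner (v := fun _ => _) (fun _ => le_rfl) hC)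
        (bdd_const _) fun n => ?_).trans_eq ?_
      · rw [← hfw]
        exact (hf1 _ (subset_closure (subset_convexHull ℝ _ ⟨n, rfl⟩))).le
      · rw [hM.const]
        simp
    exact absurd hf2 (not_lt.2 h1)
  rw [Metric.tendsto_atTop]
  intro ε hε
  have hC0 : 0 ≤ C := (norm_nonneg _).trans (hC 0)
  -- For a convex combination `∑ c_i v(k_i)` close to `V`, the correlation with `v n` is `∑ c_i φ(n
  -- - k_i)`. Its Følner averages are asymptotically those of `φ`, while `⟪V, v n⟫` is constantly `M
  -- φ`. Only `φ` has to be measurable, not `v`.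
  obtain ⟨w, hw, hwV⟩ := Metric.mem_closure_iff.1 hmem (ε / (2 * (C + 1))) (by positivity)
  rw [convexHull_eq] at hw
  obtain ⟨ι, t, c, z, hc0, hc1, hz, rfl⟩ := hw
  rw [Finset.centerMass_eq_of_sum_1 _ _ hc1] at hwV
  choose! k hk using hz
  have hlim : Tendsto (fun N => ∑ i ∈ t, (c i : ℂ) * ((⨍ n in Φ N, φ n ∂m)
      - ⨍ n in Φ N, φ (n + -k i) ∂m)) atTop (𝓝 0) := by
    have : (0 : ℂ) = ∑ i ∈ t, (c i : ℂ) * 0 := by simp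
    rw [this]
    exact tendsto_finsetSum _ fun i _ =>
      (hΦ.tendsto_average_shift hmeas hφb (-k i)).const_mul (c i : ℂ)
  obtain ⟨N₀, hN₀⟩ := Metric.tendsto_atTop.1 hlim (ε / 2) (by positivity)
  refine ⟨N₀, fun N hN => ?_⟩
  have h4 := hN₀ N hN
  have : IsFiniteMeasure (m.restrict (Φ N)) := ⟨by simpa using hΦ.measure_lt_top N⟩
  have : NeZero (m.restrict (Φ N)) := ⟨by
    rw [Ne, Measure.restrict_eq_zero]
    exact (hΦ.measure_pos N).ne'⟩
  have hc1' : ∑ i ∈ t, (c i : ℂ) = 1 := by exact_mod_cast hc1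
  have hint : ∀ i, Integrable (fun n => φ (n + -k i)) (m.restrict (Φ N)) := fun i => by
    obtain ⟨D, hD⟩ := hφb
    exact Integrable.of_bound (hmeas.comp (measurable_add_const _)).aestronglyMeasurable D
      (Eventually.of_forall fun n => hD _)
  have h5 : ∑ i ∈ t, (c i : ℂ) * ((⨍ n in Φ N, φ n ∂m) - ⨍ n in Φ N, φ (n + -k i) ∂m)
      = (⨍ n in Φ N, φ n ∂m) - M φ
        - ⨍ n in Φ N, ((∑ i ∈ t, (c i : ℂ) * φ (n + -k i)) - M φ) ∂m := by
    have h6 : ⨍ n in Φ N, ((∑ i ∈ t, (c i : ℂ) * φ (n + -k i)) - M φ) ∂m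
        = (∑ i ∈ t, (c i : ℂ) * ⨍ n in Φ N, φ (n + -k i) ∂m) - M φ := by
      simp only [average_eq]
      rw [integral_sub (integrable_finsetSum _ fun i _ => (hint i).const_mul _)
        (integrable_const _), integral_finsetSum _ fun i _ => (hint i).const_mul _, smul_sub,
        integral_const]
      congr 1
      · rw [Finset.smul_sum]
        refine Finset.sum_congr rfl fun i _ => ?_
        rw [integral_const_mul, mul_smul_comm]
      · have : (m.restrict (Φ N)).real Set.univ ≠ 0 :=
          (measureReal_ne_zero_iff (by finiteness)).2 (NeZero.ne _ ∘ Measure.measure_univ_eq_zero.1)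
        rw [smul_smul, inv_mul_cancel₀ this, one_smul]
    rw [h6]
    simp only [mul_sub, Finset.sum_sub_distrib]
    rw [← Finset.sum_mul, hc1']
    ring
  have h7 : ‖⨍ n in Φ N, ((∑ i ∈ t, (c i : ℂ) * φ (n + -k i)) - M φ) ∂m‖ ≤ ε / 2 := by
    have h8 : ∀ n, ‖(∑ i ∈ t, (c i : ℂ) * φ (n + -k i)) - M φ‖ ≤ ε / 2 := by
      intro n
      have h9 : (∑ i ∈ t, (c i : ℂ) * φ (n + -k i)) - M φ
          = inner ℂ ((∑ i ∈ t, c i • z i) - V) (v n) := by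
        rw [inner_sub_left, hconst', sum_inner]
        congr 1
        refine Finset.sum_congr rfl fun i hi => ?_
        rw [← hk i hi, hφ]
        have h10 := hv 0 (n + -k i) (k i)
        rw [zero_add, neg_add_cancel_right] at h10
        rw [← Complex.coe_smul, inner_smul_left, h10, Complex.conj_ofReal]
      rw [h9]
      refine (norm_inner_le_norm _ _).trans ?_
      rw [dist_comm, dist_eq_norm] at hwV
      calc _ ≤ ε / (2 * (C + 1)) * (C + 1) :=
            mul_le_mul hwV.le ((hC n).trans (by linarith)) (norm_nonneg _) (by positivity)
        _ = ε / 2 := by field_simp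
    rw [average_eq, norm_smul, norm_inv]
    have h11 : 0 < (m.restrict (Φ N)).real Set.univ := by
      refine (measureReal_nonneg).lt_of_ne' ?_
      exact (measureReal_ne_zero_iff (by finiteness)).2 (NeZero.ne _ ∘ Measure.measure_univ_eq_zero.1)
    rw [Real.norm_of_nonneg h11.le, inv_mul_le_iff₀ h11]
    refine (norm_integral_le_of_norm_le_const (Eventually.of_forall h8)).trans_eq ?_
    ring
  rw [h5, dist_zero_right] at h4
  rw [dist_eq_norm]
  calc _ = ‖((⨍ n in Φ N, φ n ∂m) - M φ
        - ⨍ n in Φ N, ((∑ i ∈ t, (c i : ℂ) * φ (n + -k i)) - M φ) ∂m)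
        + ⨍ n in Φ N, ((∑ i ∈ t, (c i : ℂ) * φ (n + -k i)) - M φ) ∂m‖ := by
        rw [sub_add_cancel]
    _ ≤ _ := norm_add_le _ _
    _ < ε / 2 + ε / 2 := add_lt_add_of_lt_of_le h4 h7
    _ = ε := by ring

end Folner

/-! ### Jensen's inequality and iterated means -/

section RealMean

variable {α : Type*} {M : (α → ℂ) → ℂ}

/-- The restriction of a mean to real-valued functions. -/
def rmean (M : (α → ℂ) → ℂ) (u : α → ℝ) : ℝ := (M fun n => (u n : ℂ)).re

lemma bdd_ofReal {u : α → ℝ} {C : ℝ} (h : ∀ n, |u n| ≤ C) : Bdd fun n => (u n : ℂ) :=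
  ⟨C, fun n => by simpa using h n⟩

lemma IsMean.rmean_mono (hM : IsMean M) {u v : α → ℝ} {C D : ℝ} (hu : ∀ n, |u n| ≤ C)
    (hv : ∀ n, |v n| ≤ D) (h : ∀ n, u n ≤ v n) : rmean M u ≤ rmean M v :=
  hM.re_mono (bdd_ofReal hu) (bdd_ofReal hv) fun n => by simpa using h n

lemma IsMean.rmean_const (hM : IsMean M) (c : ℝ) : rmean M (fun _ => c) = c := by
  simp [rmean, hM.const]

lemma IsMean.abs_rmean_le (hM : IsMean M) {u : α → ℝ} {C : ℝ} (hu : ∀ n, |u n| ≤ C) :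
    |rmean M u| ≤ C :=
  (Complex.abs_re_le_norm _).trans (hM.norm_le fun n => by simpa using hu n)

lemma IsMean.rmean_nonneg (hM : IsMean M) {u : α → ℝ} {C : ℝ} (hu : ∀ n, |u n| ≤ C)
    (h : ∀ n, 0 ≤ u n) : 0 ≤ rmean M u :=
  hM.re_nonneg (bdd_ofReal hu) fun n => by simpa using h n

lemma IsMean.rmean_add (hM : IsMean M) {u v : α → ℝ} {C D : ℝ} (hu : ∀ n, |u n| ≤ C)
    (hv : ∀ n, |v n| ≤ D) : rmean M (fun n => u n + v n) = rmean M u + rmean M v := by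
  simp only [rmean, Complex.ofReal_add]
  rw [hM.add (bdd_ofReal hu) (bdd_ofReal hv), Complex.add_re]

lemma IsMean.rmean_const_mul (hM : IsMean M) {u : α → ℝ} {C : ℝ} (hu : ∀ n, |u n| ≤ C) (c : ℝ) :
    rmean M (fun n => c * u n) = c * rmean M u := by
  simp only [rmean, Complex.ofReal_mul]
  rw [hM.smul _ (bdd_ofReal hu), Complex.re_ofReal_mul]

lemma IsMean.re_le_rmean_norm (hM : IsMean M) {u : α → ℂ} (hu : Bdd u) :
    ‖M u‖ ≤ rmean M fun n => ‖u n‖ := hM.norm_le_re hu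

lemma IsMean.re_eq_rmean (hM : IsMean M) {u : α → ℂ} (hu : Bdd u) :
    (M u).re = rmean M fun n => (u n).re := by
  obtain ⟨C, hC⟩ := hu
  have hb : Bdd fun n => ((u n).re : ℂ) :=
    bdd_ofReal (C := C) fun n => (Complex.abs_re_le_norm _).trans (hC n)
  exact le_antisymm (hM.re_mono ⟨C, hC⟩ hb fun n => by simp)
    (hM.re_mono hb ⟨C, hC⟩ fun n => by simp)

/-- The mean of `(u - a)²` is nonnegative, where `a` is the mean of `u`. -/
lemma IsMean.sq_rmean_le (hM : IsMean M) {u : α → ℝ} {C : ℝ} (hu : ∀ n, |u n| ≤ C) :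
    rmean M u ^ 2 ≤ rmean M fun n => u n ^ 2 := by
  set a := rmean M u with ha
  have hsq : ∀ n, |u n ^ 2| ≤ C ^ 2 := fun n => by
    rw [abs_pow]
    exact pow_le_pow_left₀ (abs_nonneg _) (hu n) 2
  have hl : ∀ n, |(-(2 * a)) * u n| ≤ |2 * a| * C := fun n => by
    rw [abs_mul, abs_neg]
    exact mul_le_mul_of_nonneg_left (hu n) (abs_nonneg _)
  have hadd : ∀ n, |u n ^ 2 + (-(2 * a)) * u n| ≤ C ^ 2 + |2 * a| * C := fun n =>
    (abs_add_le _ _).trans (add_le_add (hsq n) (hl n))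
  have h := hM.rmean_mono (u := fun _ => -(a ^ 2)) (v := fun n => u n ^ 2 + (-(2 * a)) * u n)
    (C := |-(a ^ 2)|) (fun _ => le_rfl) hadd fun n => by nlinarith [sq_nonneg (u n - a)]
  rw [hM.rmean_const, hM.rmean_add hsq hl, hM.rmean_const_mul hu, ← ha] at h
  nlinarith

lemma IsMean.pow_rmean_le (hM : IsMean M) {u : α → ℝ} {C : ℝ} (hu : ∀ n, |u n| ≤ C) (t : ℕ) :
    |rmean M u| ^ 2 ^ t ≤ rmean M fun n => |u n| ^ 2 ^ t := by
  induction t with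
  | zero =>
    have hC : ∀ n, |(|u n|)| ≤ C := fun n => by simpa using hu n
    have hneg : ∀ n, |(-1) * u n| ≤ C := fun n => by simpa using hu n
    simp only [pow_zero, pow_one]
    refine abs_le'.2 ⟨hM.rmean_mono hu hC fun n => le_abs_self _, ?_⟩
    have h := hM.rmean_mono hneg hC fun n => by simpa using neg_le_abs (u n)
    rwa [hM.rmean_const_mul hu, neg_one_mul] at h
  | succ t ih =>
    have hC : ∀ n, |(|u n| ^ 2 ^ t)| ≤ C ^ 2 ^ t := fun n => by
      rw [abs_pow, abs_abs]
      exact pow_le_pow_left₀ (abs_nonneg _) (hu n) _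
    simp only [pow_succ 2 t, pow_mul]
    exact (pow_le_pow_left₀ (by positivity) ih 2).trans (hM.sq_rmean_le hC)

end RealMean

section Iterates

variable {G ι : Type*} {M : (G → ℂ) → ℂ}

/-- The `t`-fold iterated mean, the first variable being the outermost one. -/
def iter (M : (G → ℂ) → ℂ) : ℕ → (List G → ℂ) → ℂ
  | 0, u => u []
  | t + 1, u => M fun p => iter M t fun l => u (p :: l)

/-- The `t`-fold iterated mean of a real-valued function. -/
def riter (M : (G → ℂ) → ℂ) : ℕ → (List G → ℝ) → ℝ
  | 0, u => u []
  | t + 1, u => rmean M fun p => riter M t fun l => u (p :: l)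

lemma IsMean.norm_iter_le (hM : IsMean M) (t : ℕ) {u : List G → ℂ} {C : ℝ}
    (hu : ∀ l, ‖u l‖ ≤ C) : ‖iter M t u‖ ≤ C := by
  induction t generalizing u with
  | zero => exact hu _
  | succ t ih => exact hM.norm_le fun p => ih fun l => hu _

lemma IsMean.abs_riter_le (hM : IsMean M) (t : ℕ) {u : List G → ℝ} {C : ℝ}
    (hu : ∀ l, |u l| ≤ C) : |riter M t u| ≤ C := by
  induction t generalizing u with
  | zero => exact hu _
  | succ t ih => exact hM.abs_rmean_le fun p => ih fun l => hu _

lemma IsMean.riter_mono (hM : IsMean M) (t : ℕ) {u v : List G → ℝ} {C D : ℝ}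
    (hu : ∀ l, |u l| ≤ C) (hv : ∀ l, |v l| ≤ D) (h : ∀ l, u l ≤ v l) :
    riter M t u ≤ riter M t v := by
  induction t generalizing u v with
  | zero => exact h _
  | succ t ih =>
    exact hM.rmean_mono (fun p => hM.abs_riter_le t fun l => hu _)
      (fun p => hM.abs_riter_le t fun l => hv _)
      fun p => ih (fun l => hu _) (fun l => hv _) fun l => h _

lemma IsMean.sq_riter_le (hM : IsMean M) (t : ℕ) {u : List G → ℝ} {C : ℝ}
    (hu : ∀ l, |u l| ≤ C) : riter M t u ^ 2 ≤ riter M t fun l => u l ^ 2 := by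
  have hsq : ∀ l, |u l ^ 2| ≤ C ^ 2 := fun l => by
    rw [abs_pow]
    exact pow_le_pow_left₀ (abs_nonneg _) (hu l) 2
  induction t generalizing u with
  | zero => exact le_rfl
  | succ t ih =>
    refine (hM.sq_rmean_le fun p => hM.abs_riter_le t fun l => hu _).trans ?_
    refine hM.rmean_mono (C := C ^ 2) (fun p => ?_)
      (fun p => hM.abs_riter_le t fun l => hsq (p :: l)) fun p => ih (fun l => hu _) fun l => hsq _
    rw [abs_pow]
    exact pow_le_pow_left₀ (abs_nonneg _) (hM.abs_riter_le t fun l => hu _) 2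

lemma IsMean.re_iter_eq (hM : IsMean M) (t : ℕ) {u : List G → ℂ} {C : ℝ} (hu : ∀ l, ‖u l‖ ≤ C) :
    (iter M t u).re = riter M t fun l => (u l).re := by
  induction t generalizing u with
  | zero => rfl
  | succ t ih =>
    rw [iter, hM.re_eq_rmean ⟨C, fun p => hM.norm_iter_le t fun l => hu _⟩]
    simp only [riter]
    congr 1
    funext p
    exact ih fun l => hu _

lemma IsPSD.iter (hM : IsMean M) (t : ℕ) {K : List G → ι → ι → ℂ} (hK : ∀ l, IsPSD (K l))
    (hb : ∀ l i j, ‖K l i j‖ ≤ 1) : IsPSD fun i j => iter M t fun l => K l i j := by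
  induction t generalizing K with
  | zero => exact hK _
  | succ t ih =>
    exact IsPSD.mean hM (fun p => ih (fun l => hK (p :: l)) fun l => hb (p :: l))
      fun i j => ⟨1, fun p => hM.norm_iter_le t fun l => hb _ _ _⟩

end Iterates

/-! ### Seminorms of abstract states -/

/-- An action of `G` on a commutative `*`-monoid `B`. -/
structure StarAction (G B : Type*) [AddCommGroup G] [CommMonoid B] [StarMul B] where
  T : G → B →* B
  map_zero : ∀ a, T 0 a = a
  map_add : ∀ g h a, T (g + h) a = T g (T h a)
  map_star : ∀ g a, T g (star a) = star (T g a)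

namespace StarAction

variable {G B : Type*} [AddCommGroup G] [CommMonoid B] [StarMul B] (A : StarAction G B)

/-- Invariant positive definite functions on `B`, bounded by one. -/
structure IsState (J : B → ℂ) : Prop where
  psd : IsPSD fun a b => J (star a * b)
  inv : ∀ g a, J (A.T g a) = J a
  norm_le : ∀ a, ‖J a‖ ≤ 1

/-- The multiplicative derivative `a · T_p (a^*)`. -/
def diff (p : G) (a : B) : B := a * A.T p (star a)

/-- Iterated multiplicative derivatives. -/
def diffs : List G → B → B
  | [], a => a
  | p :: l, a => diffs l (A.diff p a)

lemma diff_mul (p : G) (a b : B) : A.diff p (a * b) = A.diff p a * A.diff p b := by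
  simp only [diff, star_mul, map_mul]
  rw [mul_comm (A.T p (star b)), mul_mul_mul_comm]

lemma diff_star (p : G) (a : B) : A.diff p (star a) = star (A.diff p a) := by
  simp only [diff, star_mul, star_star, A.map_star]
  rw [mul_comm]

lemma T_comm (g h : G) (a : B) : A.T g (A.T h a) = A.T h (A.T g a) := by
  rw [← A.map_add, add_comm, A.map_add]

lemma diff_T (p g : G) (a : B) : A.diff p (A.T g a) = A.T g (A.diff p a) := by
  simp only [diff, map_mul, ← A.map_star]
  rw [A.T_comm]

lemma diffs_mul (l : List G) (a b : B) : A.diffs l (a * b) = A.diffs l a * A.diffs l b := by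
  induction l generalizing a b with
  | nil => rfl
  | cons p l ih => rw [diffs, diff_mul, ih, diffs, diffs]

lemma diffs_star (l : List G) (a : B) : A.diffs l (star a) = star (A.diffs l a) := by
  induction l generalizing a with
  | nil => rfl
  | cons p l ih => rw [diffs, diff_star, ih, diffs]

lemma diffs_T (l : List G) (g : G) (a : B) : A.diffs l (A.T g a) = A.T g (A.diffs l a) := by
  induction l generalizing a with
  | nil => rfl
  | cons p l ih => rw [diffs, diff_T, ih, diffs]

/-- The `2^t`-th powers of the Gowers–Host–Kra seminorms. -/
def gowers (M : (G → ℂ) → ℂ) (J : B → ℂ) : ℕ → B → ℂ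
  | 0, a => J a
  | t + 1, a => M fun p => gowers M J t (A.diff p a)

variable {A} {M : (G → ℂ) → ℂ} {J : B → ℂ}

namespace IsState

lemma apply_star (hJ : A.IsState J) (a : B) : J (star a) = conj (J a) := by
  have := hJ.psd.conj_symm 1 a
  simpa using this.symm

lemma bdd {α : Type*} (hJ : A.IsState J) (a : α → B) : Bdd fun p => J (a p) :=
  ⟨1, fun _ => hJ.norm_le _⟩

lemma mean (hJ : A.IsState J) (hM : IsMean M) : A.IsState fun a => M fun p => J (A.diff p a) := by
  refine ⟨?_, fun g a => ?_, fun a => hM.norm_le fun p => hJ.norm_le _⟩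
  · simp only [diff_mul, diff_star]
    exact IsPSD.mean hM (fun p => hJ.psd.comp (A.diff p)) fun i j => hJ.bdd _
  · simp only [diff_T, hJ.inv]

lemma gowers (hJ : A.IsState J) (hM : IsMean M) (t : ℕ) : A.IsState (A.gowers M J t) := by
  induction t with
  | zero => exact hJ
  | succ t ih => exact ih.mean hM

lemma apply_T_mul_T (hJ : A.IsState J) (p q : G) (a b : B) :
    J (A.T p a * A.T q b) = J (a * A.T (q - p) b) := by
  rw [← hJ.inv p (a * _), map_mul, ← A.map_add, add_sub_cancel]

/-- Invariance of `J` leaves a function of `q - p`, and invariance of `M` then removes `p`. -/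
lemma mean_mean_eq (hJ : A.IsState J) (hM : IsInvMean M) (a : B) :
    (M fun p => M fun q => J (A.T p a * A.T q (star a))) = M fun p => J (A.diff p a) := by
  have h : ∀ p, (M fun q => J (A.T p a * A.T q (star a))) = M fun p => J (A.diff p a) := by
    intro p
    simp only [hJ.apply_T_mul_T, sub_eq_add_neg]
    exact hM.shift (-p) (hJ.bdd fun n => A.diff n a)
  simp only [h]
  exact hM.const _

lemma norm_self_le (hJ : A.IsState J) (a : B) : ‖J (star a * a)‖ ≤ 1 := hJ.norm_le _

/-- Rewritten as a double mean of a positive semidefinite kernel, this is a squared norm. It is the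
reason why seminorm powers of order at least one are nonnegative reals. -/
lemma mean_diff_nonneg (hJ : A.IsState J) (hM : IsInvMean M) (a : B) :
    0 ≤ (M fun p => J (A.diff p a)).re ∧ (M fun p => J (A.diff p a)).im = 0 := by
  have := hJ.psd.mean_mean_nonneg hM.toIsMean hJ.norm_self_le fun p => A.T p (star a)
  simp only [← A.map_star, star_star] at this
  rwa [hJ.mean_mean_eq hM] at this

lemma gowers_succ_nonneg (hJ : A.IsState J) (hM : IsInvMean M) (t : ℕ) (a : B) :
    0 ≤ (A.gowers M J (t + 1) a).re ∧ (A.gowers M J (t + 1) a).im = 0 :=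
  (hJ.gowers hM.toIsMean t).mean_diff_nonneg hM a

end IsState

lemma gowers_eq_iter (t : ℕ) (a : B) :
    A.gowers M J t a = iter M t fun l => J (A.diffs l a) := by
  induction t generalizing a with
  | zero => rfl
  | succ t ih => simp only [gowers, iter, ih, diffs]

/-- The recursion peels off the outermost mean; here the innermost one is absorbed into the state.
Used twice, it exposes second seminorms of iterated derivatives. -/
lemma gowers_succ_eq (t : ℕ) (a : B) :
    A.gowers M J (t + 1) a = A.gowers M (fun a => M fun p => J (A.diff p a)) t a := by
  induction t generalizing a with
  | zero => rfl
  | succ t ih =>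
    rw [gowers, gowers]
    simp only [ih]

lemma gowers_star (hJ : A.IsState J) (hM : IsMean M) (t : ℕ) (a : B) :
    A.gowers M J t (star a) = conj (A.gowers M J t a) := (hJ.gowers hM t).apply_star a

/-- The mean ergodic theorem for the derivatives of an element along a Følner sequence. -/
lemma IsState.tendsto_average_diff [MeasurableSpace G] [MeasurableAdd G] {m : Measure G}
    [m.IsAddLeftInvariant] {Φ : ℕ → Set G} (hΦ : IsFolnerSeq m Φ) (hJ : A.IsState J)
    (hM : IsInvMean M) (a : B) (hmeas : Measurable fun n => J (A.diff n a)) :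
    Tendsto (fun N => ⨍ n in Φ N, J (A.diff n a) ∂m) atTop (𝓝 (M fun n => J (A.diff n a))) := by
  obtain ⟨H, _, _, _, ψ, hψ⟩ := hJ.psd.exists_hilbert
  have hn : ∀ b, ‖ψ b‖ ≤ 1 := fun b => by
    have := hJ.norm_self_le b
    rw [← hψ, inner_self_eq_norm_sq_to_K, norm_pow, RCLike.norm_ofReal, abs_norm] at this
    exact (sq_le_one_iff₀ (norm_nonneg _)).1 this
  have h0 : ∀ n, inner ℂ (ψ (A.T 0 (star a))) (ψ (A.T n (star a)))
      = J (A.diff n a) := fun n => by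
    rw [hψ, A.map_zero, star_star, diff]
  have := hΦ.tendsto_average_inner hM (v := fun n => ψ (A.T n (star a))) (fun n => hn _)
    (fun p q k => ?_) (by simpa only [h0] using hmeas)
  · simpa only [h0] using this
  · simp only [hψ]
    rw [← A.map_star, ← A.map_star, hJ.apply_T_mul_T, hJ.apply_T_mul_T, add_sub_add_right_eq_sub]

end StarAction

/-! ### Phases and functions of fewer variables -/

section Circle

lemma expCircle_add (s t : UnitAddCircle) : expCircle (s + t) = expCircle s * expCircle t := by
  simp [expCircle, AddCircle.toCircle_add]

lemma expCircle_zero : expCircle 0 = 1 := by simp [expCircle]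

lemma norm_expCircle (t : UnitAddCircle) : ‖expCircle t‖ = 1 := Circle.norm_coe _

lemma expCircle_neg (t : UnitAddCircle) : expCircle (-t) = conj (expCircle t) := by
  rw [expCircle, AddCircle.toCircle_neg, Circle.coe_inv_eq_conj, expCircle]

lemma expCircle_injective : Function.Injective expCircle := fun _ _ h =>
  AddCircle.injective_toCircle one_ne_zero (Subtype.ext h)

end Circle

/-- Functions of `t` variables that are sums of functions of `t - 1` variables. -/
def LowRank {G E : Type*} [AddCommGroup E] : ℕ → (List G → E) → Prop
  | 0, β => β [] = 0
  | t + 1, β => ∃ (γ : List G → E) (β' : G → List G → E), (∀ p, LowRank t (β' p)) ∧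
      ∀ p l, β (p :: l) = γ l + β' p l

lemma LowRank.sub {G E : Type*} [AddCommGroup E] (t : ℕ) {β₁ β₂ : List G → E}
    (h₁ : LowRank t β₁) (h₂ : LowRank t β₂) : LowRank t fun l => β₁ l - β₂ l := by
  induction t generalizing β₁ β₂ with
  | zero => simp_all [LowRank]
  | succ t ih =>
    obtain ⟨γ₁, δ₁, hδ₁, e₁⟩ := h₁
    obtain ⟨γ₂, δ₂, hδ₂, e₂⟩ := h₂
    refine ⟨fun l => γ₁ l - γ₂ l, fun p l => δ₁ p l - δ₂ p l, fun p => ih (hδ₁ p) (hδ₂ p),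
      fun p l => ?_⟩
    beta_reduce
    rw [e₁, e₂]
    abel

/-! ### Elimination of low-complexity factors by doubling variables -/

namespace StarAction

variable {G B : Type*} [AddCommGroup G] [CommMonoid B] [StarMul B] {A : StarAction G B}
  {M : (G → ℂ) → ℂ} {J : B → ℂ}

/-- Functions `l ↦ T_{p_1} b_1 ⋯ T_{p_t} b_t` such that `b_i` does not depend on `p_i`. -/
def LowMul (A : StarAction G B) : ℕ → (List G → B) → Prop
  | 0, y => y [] = 1
  | t + 1, y => ∃ (b : List G → B) (y' : G → List G → B), (∀ p, LowMul A t (y' p)) ∧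
      ∀ p l, y (p :: l) = A.T p (b l) * y' p l

lemma LowMul.mul (t : ℕ) {x y : List G → B} (hx : A.LowMul t x) (hy : A.LowMul t y) :
    A.LowMul t fun l => x l * y l := by
  induction t generalizing x y with
  | zero => simp_all [LowMul]
  | succ t ih =>
    obtain ⟨b, x', hx', ex⟩ := hx
    obtain ⟨c, y', hy', ey⟩ := hy
    refine ⟨fun l => b l * c l, fun p l => x' p l * y' p l, fun p => ih (hx' p) (hy' p),
      fun p l => ?_⟩
    beta_reduce
    rw [ex, ey, map_mul, mul_mul_mul_comm]

lemma LowMul.map_star (t : ℕ) {x : List G → B} (hx : A.LowMul t x) :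
    A.LowMul t fun l => star (x l) := by
  induction t generalizing x with
  | zero => simp_all [LowMul]
  | succ t ih =>
    obtain ⟨b, x', hx', ex⟩ := hx
    refine ⟨fun l => star (b l), fun p l => star (x' p l), fun p => ih (hx' p),
      fun p l => ?_⟩
    beta_reduce
    rw [ex, star_mul, A.map_star, mul_comm]

lemma LowMul.translate (t : ℕ) {x : List G → B} (hx : A.LowMul t x) (g : G) :
    A.LowMul t fun l => A.T g (x l) := by
  induction t generalizing x with
  | zero => simp_all [LowMul]
  | succ t ih =>
    obtain ⟨b, x', hx', ex⟩ := hx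
    refine ⟨fun l => A.T g (b l), fun p l => A.T g (x' p l), fun p => ih (hx' p), fun p l => ?_⟩
    beta_reduce
    rw [ex, map_mul, A.T_comm]

/-- In `diffs (p :: l) a = diffs l a * T_p (star (diffs l a))` everything that involves `p` is `T_p`
of an element independent of `p`; the other factor is treated inductively. -/
lemma exists_lowMul_diffs (t : ℕ) (a : B) :
    ∃ y, A.LowMul t y ∧ ∀ l : List G, l.length = t → A.diffs l a = a * y l := by
  induction t with
  | zero =>
    refine ⟨fun _ => 1, rfl, fun l hl => ?_⟩
    rw [List.length_eq_zero_iff.1 hl, mul_one, diffs]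
  | succ t ih =>
    obtain ⟨y, hy, hya⟩ := ih
    refine ⟨fun l => A.T (l.headD 0) (star (A.diffs l.tail a)) * y l.tail,
      ⟨fun l => star (A.diffs l a), fun _ => y, fun _ => hy, fun p l => rfl⟩, fun l hl => ?_⟩
    match l, hl with
    | p :: l, hl =>
      rw [diffs, diff, diffs_mul, diffs_T, diffs_star, hya l (by simpa using hl)]
      simp only [List.headD_cons, List.tail_cons]
      rw [hya l (by simpa using hl)]
      rw [mul_assoc, mul_comm (y l)]

/-- The quantity obtained from `J (x l)` by doubling each of the `t` variables. -/
def doubled (A : StarAction G B) (M : (G → ℂ) → ℂ) (J : B → ℂ) : ℕ → (List G → B) → ℝ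
  | 0, x => ‖J (x [])‖
  | t + 1, x => rmean M fun p => rmean M fun q => doubled A M J t fun l =>
      star (A.T (-p) (x (p :: l))) * A.T (-q) (x (q :: l))

lemma IsState.abs_doubled_le (hJ : A.IsState J) (hM : IsMean M) (t : ℕ) (x : List G → B) :
    |A.doubled M J t x| ≤ 1 := by
  induction t generalizing x with
  | zero => simpa [doubled] using hJ.norm_le _
  | succ t ih => exact hM.abs_rmean_le fun p => hM.abs_rmean_le fun q => ih _

lemma IsState.psd_iter (hJ : A.IsState J) (hM : IsMean M) {ι : Type*} (t : ℕ)
    (a : ι → List G → B) : IsPSD fun i j => iter M t fun l => J (star (a i l) * a j l) :=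
  IsPSD.iter hM t (K := fun l i j => J (star (a i l) * a j l))
    (fun l => hJ.psd.comp fun i => a i l) fun _ _ _ => hJ.norm_le _

-- One step of a repeated Cauchy–Schwarz argument: `|z|²` is bounded by a double mean of `K`, and
-- Jensen's inequality raises this to the power `2 ^ t` at which the inductive bounds `r` apply.
omit [AddCommGroup G] in
lemma pow_two_pow_succ_le {M : (G → ℂ) → ℂ} (hM : IsMean M) {z : ℂ} {K : G → G → ℂ} {t : ℕ}
    {r : G → G → ℝ} (hK : ∀ p q, ‖K p q‖ ≤ 1) (hr : ∀ p q, |r p q| ≤ 1)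
    (hz : ‖z‖ ^ 2 ≤ (M fun p => M fun q => K p q).re) (h : ∀ p q, ‖K p q‖ ^ 2 ^ t ≤ r p q) :
    ‖z‖ ^ 2 ^ (t + 1) ≤ rmean M fun p => rmean M fun q => r p q := by
  have hb : ∀ p q, |‖K p q‖| ≤ 1 := fun p q => by simpa using hK p q
  have hb2 : ∀ p, |rmean M fun q => ‖K p q‖| ≤ 1 := fun p => hM.abs_rmean_le (hb p)
  have hpow : ∀ p q, |‖K p q‖ ^ 2 ^ t| ≤ 1 := fun p q => by
    rw [abs_pow]
    exact pow_le_one₀ (abs_nonneg _) (hb p q)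
  have h1 : ‖z‖ ^ 2 ≤ rmean M fun p => rmean M fun q => ‖K p q‖ := by
    refine hz.trans ((Complex.re_le_norm _).trans ?_)
    refine (hM.re_le_rmean_norm ⟨1, fun p => hM.norm_le (hK p)⟩).trans ?_
    refine hM.rmean_mono (C := 1) (fun p => ?_) hb2 fun p => hM.re_le_rmean_norm ⟨1, hK p⟩
    simpa using hM.norm_le (hK p)
  have h0 : 0 ≤ rmean M fun p => rmean M fun q => ‖K p q‖ :=
    hM.rmean_nonneg hb2 fun p => hM.rmean_nonneg (hb p) fun q => norm_nonneg _
  rw [pow_succ' 2 t, pow_mul]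
  refine (pow_le_pow_left₀ (by positivity) h1 _).trans ?_
  rw [← abs_of_nonneg h0]
  refine (hM.pow_rmean_le hb2 t).trans ?_
  have hr2 : ∀ p, |rmean M fun q => r p q| ≤ 1 := fun p => hM.abs_rmean_le (hr p)
  refine hM.rmean_mono (C := 1) (fun p => ?_) hr2 fun p => ?_
  · rw [abs_pow, abs_abs]
    exact pow_le_one₀ (abs_nonneg _) (hb2 p)
  · refine (hM.pow_rmean_le (hb p) t).trans ?_
    simp only [abs_norm]
    exact hM.rmean_mono (hpow p) (hr p) (h p)

/-- Factors that do not depend on one of the variables are removed by doubling the variables. -/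
theorem IsState.norm_iter_pow_le_doubled (hJ : A.IsState J) (hM : IsMean M) (t : ℕ)
    {x y : List G → B} (hy : A.LowMul t y) :
    ‖iter M t fun l => J (y l * x l)‖ ^ 2 ^ t ≤ A.doubled M J t x := by
  induction t generalizing x y with
  | zero =>
    have : y [] = 1 := hy
    simp [iter, doubled, this]
  | succ t ih =>
    obtain ⟨b, y', hy', ey⟩ := hy
    -- Translating by `-p` turns the factor `T_p (b l)` of `y` into `b l`, which does not depend on
    -- `p`. It becomes the vector at `none`, and Cauchy–Schwarz against the vectors at `some p`
    -- discards it; what is left of `y` has low complexity in the other `t` variables.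
    let a : Option G → List G → B := fun o l =>
      o.elim (star (b l)) fun p => A.T (-p) (y' p l * x (p :: l))
    have hpsd := hJ.psd_iter hM t a
    have hbd : ∀ i j, ‖iter M t fun l => J (star (a i l) * a j l)‖ ≤ 1 := fun i j =>
      hM.norm_iter_le t fun l => hJ.norm_le _
    have hcs := hpsd.mean_cauchySchwarz hM (fun i => hbd i i) none some
    have hz : ∀ p l, J (star (a none l) * a (some p) l) = J (y (p :: l) * x (p :: l)) := by
      intro p l
      rw [← hJ.inv p, map_mul]
      simp only [a, Option.elim, star_star]
      rw [← A.map_add, add_neg_cancel, A.map_zero, ey, mul_assoc]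
    simp only [hz] at hcs
    refine pow_two_pow_succ_le hM
      (K := fun p q => iter M t fun l => J (star (a (some p) l) * a (some q) l))
      (fun p q => hbd _ _) (fun p q => hJ.abs_doubled_le hM t _) ?_ fun p q => ?_
    · refine hcs.trans ?_
      have h1 : (iter M t fun l => J (star (a none l) * a none l)).re ≤ 1 :=
        (Complex.re_le_norm _).trans (hbd _ _)
      exact mul_le_of_le_one_left
        (hpsd.mean_mean_nonneg hM (fun i => hbd i i) fun p => some p).1 h1
    · have h2 : ∀ l, star (a (some p) l) * a (some q) l
          = (star (A.T (-p) (y' p l)) * A.T (-q) (y' q l))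
            * (star (A.T (-p) (x (p :: l))) * A.T (-q) (x (q :: l))) := fun l => by
        simp only [a, Option.elim, map_mul, star_mul]
        rw [mul_comm (star (A.T (-p) (x (p :: l))))]
        exact mul_mul_mul_comm _ _ _ _
      simp only [h2]
      exact ih ((((hy' p).translate t (-p)).map_star t).mul t ((hy' q).translate t (-q)))

/-- If `J` only detects the elements of phase zero, then the doubled quantity is controlled by the
agreement of the phases with a sum of functions of fewer variables. -/
theorem IsState.exists_lowRank_of_doubled (hJ : A.IsState J) (hM : IsMean M) {E : Type*}
    [AddCommGroup E] [DecidableEq E] {R : B → ℝ → E → Prop}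
    (hR : ∀ d r α, R d r α → ‖J d‖ ≤ if α = 0 then r else 0)
    (hRT : ∀ g d r α, R d r α → R (A.T g d) r α)
    (hRm : ∀ d r α d' r' α', R d r α → R d' r' α' → R (star d * d') (r * r') (α' - α))
    (t : ℕ) {x : List G → B} {θ : List G → ℝ} {α : List G → E}
    (hθ : ∀ l, 0 ≤ θ l ∧ θ l ≤ 1) (hx : ∀ l, l.length = t → R (x l) (θ l) (α l)) {ε : ℝ}
    (hε : 0 < ε) :
    ∃ β, LowRank t β ∧
      A.doubled M J t x ≤ (riter M t fun l => if α l = β l then θ l else 0) + ε := by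
  induction t generalizing x θ α ε with
  | zero =>
    refine ⟨fun _ => 0, rfl, ?_⟩
    have := hR _ _ _ (hx [] rfl)
    simp only [doubled, riter]
    linarith
  | succ t ih =>
    let w : G → G → List G → B := fun p q l => star (A.T (-p) (x (p :: l))) * A.T (-q) (x (q :: l))
    have hb : ∀ p q, |A.doubled M J t (w p q)| ≤ 1 := fun p q => hJ.abs_doubled_le hM t _
    have hb2 : ∀ p, |rmean M fun q => A.doubled M J t (w p q)| ≤ 1 := fun p =>
      hM.abs_rmean_le (hb p)
    -- Freeze one of the two copies of the first variable at a value that is at least the mean up to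
    -- `ε / 2`; the induction hypothesis uses the other half.
    obtain ⟨p, hp⟩ : ∃ p, A.doubled M J (t + 1) x
        ≤ (rmean M fun q => A.doubled M J t (w p q)) + ε / 2 := by
      by_contra! hcon
      have h1 := hM.rmean_mono (v := fun _ => A.doubled M J (t + 1) x - ε / 2)
        hb2 (fun _ => le_rfl) fun p => by linarith [hcon p]
      rw [hM.rmean_const] at h1
      have h2 : (rmean M fun p => rmean M fun q => A.doubled M J t (w p q))
        = A.doubled M J (t + 1) x := rfl
      linarith
    have hq : ∀ q, ∃ β, LowRank t β ∧ A.doubled M J t (w p q)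
        ≤ (riter M t fun l => if α (q :: l) - α (p :: l) = β l then θ (p :: l) * θ (q :: l) else 0)
          + ε / 2 := fun q =>
      ih (θ := fun l => θ (p :: l) * θ (q :: l)) (α := fun l => α (q :: l) - α (p :: l))
        (fun l => ⟨mul_nonneg (hθ _).1 (hθ _).1, mul_le_one₀ (hθ _).2 (hθ _).1 (hθ _).2⟩)
        (fun l hl => hRm _ _ _ _ _ _ (hRT _ _ _ _ (hx _ (by simpa using hl)))
          (hRT _ _ _ _ (hx _ (by simpa using hl)))) (by positivity)
    choose β hβ hβ2 using hq
    -- The phase difference `α (q :: l) - α (p :: l)` agrees with `β q l`. As `p` is frozen, `α (p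
    -- :: l)` is a function of `l` alone, which is the shape required by `LowRank`. The value on the
    -- empty list plays no role.
    refine ⟨fun l => α (p :: l.tail) + β (l.headD 0) l.tail,
      ⟨fun l => α (p :: l), β, hβ, fun q l => by simp⟩, ?_⟩
    have hite : ∀ l, |if α l = α (p :: l.tail) + β (l.headD 0) l.tail then θ l else 0| ≤ 1 := by
      intro l
      split_ifs
      · rw [abs_of_nonneg (hθ l).1]
        exact (hθ l).2
      · simp
    have hr : ∀ q, |riter M t fun l => if α (q :: l) = α (p :: l) + β q l then θ (q :: l) else 0|
        ≤ 1 := fun q => hM.abs_riter_le t fun l => by simpa using hite (q :: l)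
    have h3 : (rmean M fun q => A.doubled M J t (w p q)) ≤ rmean M fun q =>
        (riter M t fun l => if α (q :: l) = α (p :: l) + β q l then θ (q :: l) else 0)
          + ε / 2 := by
      refine hM.rmean_mono (D := 1 + |ε / 2|) (hb p) (fun q => ?_) fun q => (hβ2 q).trans ?_
      · exact (abs_add_le _ _).trans (add_le_add_left (hr q) _)
      · refine add_le_add_left (hM.riter_mono t (C := 1) (D := 1) (fun l => ?_)
          (fun l => by simpa using hite (q :: l)) fun l => ?_) _
        · split_ifs
          · rw [abs_of_nonneg (mul_nonneg (hθ _).1 (hθ _).1)]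
            exact mul_le_one₀ (hθ _).2 (hθ _).1 (hθ _).2
          · simp
        · simp only [sub_eq_iff_eq_add']
          split_ifs
          · exact mul_le_of_le_one_left (hθ _).1 (hθ _).2
          · exact le_rfl
    rw [hM.rmean_add hr (fun _ => le_rfl), hM.rmean_const] at h3
    change _ ≤ (rmean M fun q => riter M t fun l =>
      if α (q :: l) = α (p :: l) + β q l then θ (q :: l) else 0) + ε
    linarith

/-! ### Elimination of low-rank phases -/

section Phases

variable (β : List G → G →+ UnitAddCircle)

lemma bdd_phase (hJ : A.IsState J) (χ : G →+ UnitAddCircle) (a : G → B) :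
    Bdd fun k => expCircle (-χ k) * J (a k) :=
  ⟨1, fun k => by simpa [norm_expCircle] using hJ.norm_le _⟩

lemma norm_mean_phase_le (hJ : A.IsState J) (hM : IsMean M) (χ : G →+ UnitAddCircle) (a : G → B) :
    ‖M fun k => expCircle (-χ k) * J (a k)‖ ≤ 1 :=
  hM.norm_le fun k => by simpa [norm_expCircle] using hJ.norm_le _

/-- Averages of derivatives, twisted by phases that are sums of functions of fewer variables, are
controlled by the seminorms. -/
theorem IsState.norm_iter_phase_pow_le (hJ : A.IsState J) (hM : IsInvMean M) (t : ℕ)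
    {β : List G → G →+ UnitAddCircle} (hβ : LowRank t β) (a : B) :
    ‖iter M t fun l => M fun k => expCircle (-β l k) * J (A.diff k (A.diffs l a))‖ ^ 2 ^ t
      ≤ (A.gowers M J (t + 1) a).re := by
  induction t generalizing a β with
  | zero =>
    have h0 : β [] = 0 := hβ
    have h1 := hJ.mean_diff_nonneg hM a
    simp only [iter, h0, AddMonoidHom.zero_apply, neg_zero, expCircle_zero, one_mul, diffs,
      pow_zero, pow_one]
    have h2 : (M fun k => J (A.diff k a)) = ((M fun k => J (A.diff k a)).re : ℂ) :=
      Complex.ext rfl (by simpa using h1.2)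
    rw [h2, Complex.norm_real, Real.norm_of_nonneg h1.1]
    rfl
  | succ t ih =>
    obtain ⟨γ, β', hβ', eβ⟩ := hβ
    let D : List G → G → B := fun l k => A.diff k (A.diffs l a)
    -- The derivative along `p :: l` factors as `D l k` times `T_p` of its adjoint, and the phase as
    -- a part `γ` free of `p` and a part `β' p`. The factors free of `p` form the vector at `none`
    -- and are discarded by Cauchy–Schwarz.
    let b : Option G → List G → G → B := fun o l k =>
      o.elim (star (D l k)) fun p => A.T p (star (D l k))
    let c : Option G → List G → G → ℂ := fun o l k =>
      o.elim (expCircle (γ l k)) fun p => expCircle (-β' p l k)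
    have hc : ∀ o l k, ‖c o l k‖ = 1 := fun o l k => by
      cases o <;> simp [c, norm_expCircle]
    let K : Option G → Option G → ℂ := fun i j => iter M t fun l => M fun k =>
      conj (c i l k) * c j l k * J (star (b i l k) * b j l k)
    have hbd0 : ∀ i j l k, ‖conj (c i l k) * c j l k * J (star (b i l k) * b j l k)‖ ≤ 1 :=
      fun i j l k => by
        rw [norm_mul, norm_mul, RCLike.norm_conj, hc, hc, one_mul, one_mul]
        exact hJ.norm_le _
    have hbd : ∀ i j, ‖K i j‖ ≤ 1 := fun i j =>
      hM.norm_iter_le t fun l => hM.norm_le (hbd0 i j l)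
    have hpsd : IsPSD K := IsPSD.iter hM.toIsMean t
      (fun l => IsPSD.mean hM.toIsMean
        (fun k => (hJ.psd.comp fun i => b i l k).mul_conj fun i => c i l k)
        fun i j => ⟨1, hbd0 i j l⟩)
      fun l i j => hM.norm_le (hbd0 i j l)
    have hcs := hpsd.mean_cauchySchwarz hM.toIsMean (fun i => hbd i i) none some
    have hz : ∀ p, K none (some p) = iter M t fun l => M fun k =>
        expCircle (-β (p :: l) k) * J (A.diff k (A.diffs (p :: l) a)) := by
      intro p
      refine congrArg (iter M t) (funext fun l => congrArg M (funext fun k => ?_))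
      congr 1
      · simp only [c, Option.elim, eβ, AddMonoidHom.add_apply, neg_add, expCircle_add,
          ← expCircle_neg]
      · simp only [b, Option.elim, star_star, D, diffs]
        conv_rhs => rw [show A.diff p a = a * A.T p (star a) from rfl, diffs_mul, diffs_T,
          diffs_star, diff_mul, diff_T, diff_star]
    simp only [hz] at hcs
    have hg : ∀ p q, |(A.gowers M J (t + 1) (A.T p (A.diff (q + -p) a))).re| ≤ 1 := fun p q =>
      (Complex.abs_re_le_norm _).trans ((hJ.gowers hM.toIsMean (t + 1)).norm_le _)
    have hmain := pow_two_pow_succ_le hM.toIsMean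
      (z := iter M (t + 1) fun l => M fun k => expCircle (-β l k) * J (A.diff k (A.diffs l a)))
      (t := t) (K := fun p q => K (some p) (some q))
      (fun p q => hbd _ _) hg ?_ fun p q => ?_
    · refine hmain.trans_eq ?_
      have hb1 : ∀ p, |(A.gowers M J (t + 1) (A.diff p a)).re| ≤ 1 := fun p =>
        (Complex.abs_re_le_norm _).trans ((hJ.gowers hM.toIsMean (t + 1)).norm_le _)
      -- The pair `(p, q)` contributes the seminorm of `T_p Δ_{q-p} a`. Invariance of the state and
      -- of the mean collapses the double mean to one further derivative, which raises the order to
      -- `t + 2`.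
      have h5 : ∀ p, (rmean M fun q => (A.gowers M J (t + 1) (A.T p (A.diff (q + -p) a))).re)
          = (A.gowers M J (t + 2) a).re := by
        intro p
        simp only [(hJ.gowers hM.toIsMean (t + 1)).inv, rmean]
        rw [hM.shift (-p) (bdd_ofReal hb1)]
        rw [StarAction.gowers, hM.re_eq_rmean ((hJ.gowers hM.toIsMean (t + 1)).bdd _)]
        rfl
      simp only [h5]
      exact hM.rmean_const _
    · refine hcs.trans ?_
      exact mul_le_of_le_one_left
        (hpsd.mean_mean_nonneg hM.toIsMean (fun i => hbd i i) fun p => some p).1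
        ((Complex.re_le_norm _).trans (hbd _ _))
    -- The remaining phase `β' q - β' p` is of low rank in `t` variables, so the induction
    -- hypothesis applies to `T_p Δ_{q-p} a`.
    · have h6 : K (some p) (some q) = iter M t fun l => M fun k =>
          expCircle (-(β' q l - β' p l) k)
            * J (A.diff k (A.diffs l (A.T p (A.diff (q + -p) a)))) := by
        refine congrArg (iter M t) (funext fun l => congrArg M (funext fun k => ?_))
        congr 1
        · simp only [c, Option.elim, ← expCircle_neg, ← expCircle_add]
          congr 1
          simp only [AddMonoidHom.sub_apply]
          abel
        · simp only [b, Option.elim, D]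
          have h7 : A.T p (A.diff (q + -p) a) = A.T p a * A.T q (star a) := by
            rw [diff, map_mul, ← A.map_add, add_neg_cancel_comm_assoc]
          rw [h7, diffs_mul, diffs_T, diffs_T, diffs_star, diff_mul, diff_T, diff_T, diff_star,
            A.map_star, star_star]
      have := ih (LowRank.sub t (hβ' q) (hβ' p)) (A.T p (A.diff (q + -p) a))
      rw [← h6] at this
      exact this

end Phases

end StarAction

/-! ### Eigenvectors from correlations -/

/-- Commuting operators on a nontrivial finite-dimensional complex space have a common
eigenvector. -/
theorem exists_common_eigenvector {G H : Type*} [AddCommGroup H] [Module ℂ H]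
    (f : G → Module.End ℂ H) (hf : ∀ g h x, f g (f h x) = f h (f g x)) (n : ℕ) :
    ∀ W : Submodule ℂ H, FiniteDimensional ℂ W → Module.finrank ℂ W = n → W ≠ ⊥ →
      (∀ g, ∀ x ∈ W, f g x ∈ W) → ∃ e ∈ W, e ≠ 0 ∧ ∃ c : G → ℂ, ∀ g, f g e = c g • e := by
  induction n using Nat.strong_induction_on with
  | _ n ih =>
    intro W hfd hn hW hinv
    -- If all operators are scalar on `W`, any nonzero vector will do. Otherwise some `f g` has a
    -- nonzero proper eigenspace in `W`, which the commuting operators preserve.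
    by_cases hs : ∀ g, ∃ c : ℂ, ∀ x ∈ W, f g x = c • x
    · choose c hc using hs
      obtain ⟨e, heW, he⟩ := (Submodule.ne_bot_iff W).1 hW
      exact ⟨e, heW, he, c, fun g => hc g e heW⟩
    · push Not at hs
      obtain ⟨g, hg⟩ := hs
      have : Nontrivial W := Submodule.nontrivial_iff_ne_bot.2 hW
      obtain ⟨c, hc⟩ := Module.End.exists_eigenvalue ((f g).restrict (hinv g))
      obtain ⟨w, hw⟩ := hc.exists_hasEigenvector
      have hw1 : f g w = c • (w : H) := congrArg Subtype.val hw.apply_eq_smul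
      let W' : Submodule ℂ H := W ⊓ Module.End.eigenspace (f g) c
      have hlt : W' < W := by
        refine lt_of_le_of_ne inf_le_left fun h => ?_
        obtain ⟨x, hx, hxc⟩ := hg c
        rw [← h] at hx
        exact hxc (Module.End.mem_eigenspace_iff.1 hx.2)
      have hfd' : FiniteDimensional ℂ W' := Submodule.finiteDimensional_of_le inf_le_left
      obtain ⟨e, he, he0, hec⟩ := ih (Module.finrank ℂ W')
        (hn ▸ Submodule.finrank_lt_finrank_of_lt hlt) W' hfd' rfl
        ((Submodule.ne_bot_iff W').2 ⟨w, ⟨w.2, Module.End.mem_eigenspace_iff.2 hw1⟩, by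
          simpa using hw.2⟩)
        fun h x hx => ⟨hinv h x hx.1, Module.End.mem_eigenspace_iff.2 (by
          rw [hf, Module.End.mem_eigenspace_iff.1 hx.2, map_smul])⟩
      exact ⟨e, he.1, he0, hec⟩

section Correlation

variable {G H : Type*} [NormedAddCommGroup H] [InnerProductSpace ℂ H] [CompleteSpace H]
  {M : (G → ℂ) → ℂ}

/-- The mean of the rank one operators `x ↦ ⟪v n, x⟫ v n`. -/
lemma exists_mean_rankOne (hM : IsMean M) {v : G → H} (hv : ∀ n, ‖v n‖ ≤ 1) :
    ∃ A : H →L[ℂ] H, ∀ x y, inner ℂ y (A x) = M fun n => inner ℂ (v n) x * inner ℂ y (v n) := by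
  have hb : ∀ x y, Bdd fun n => inner ℂ (v n) x * inner ℂ y (v n) := fun x y =>
    (bdd_inner (w := fun _ => x) hv fun _ => le_rfl).mul
      (bdd_inner (v := fun _ => y) (fun _ => le_rfl) hv)
  have hbd : ∀ x n, ‖(inner ℂ (v n) x : ℂ) • v n‖ ≤ ‖x‖ := fun x n => by
    rw [norm_smul]
    calc _ ≤ (‖v n‖ * ‖x‖) * ‖v n‖ := by gcongr; exact norm_inner_le_norm _ _
      _ ≤ (1 * ‖x‖) * 1 := by gcongr <;> exact hv n
      _ = ‖x‖ := by ring
  choose A hA1 hA2 using fun x => exists_mean_vector hM (hbd x)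
  simp only [inner_smul_right] at hA2
  let A' : H →ₗ[ℂ] H :=
    { toFun := A
      map_add' := fun x y => by
        refine ext_inner_left ℂ fun z => ?_
        rw [inner_add_right]
        simp only [hA2, inner_add_right, add_mul]
        exact hM.add (hb x z) (hb y z)
      map_smul' := fun c x => by
        refine ext_inner_left ℂ fun z => ?_
        simp only [RingHom.id_apply, inner_smul_right, hA2, mul_assoc]
        exact hM.smul c (hb x z) }
  refine ⟨A'.mkContinuous 1 fun x => ?_, fun x y => hA2 x y⟩
  rw [one_mul]
  have h1 : ‖A x‖ ^ 2 ≤ ‖x‖ * ‖A x‖ := by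
    have h2 : (inner ℂ (A x) (A x) : ℂ).re = ‖A x‖ ^ 2 := (norm_sq_eq_re_inner (𝕜 := ℂ) _).symm
    rw [← h2, hA1]
    refine (Complex.re_le_norm _).trans (hM.norm_le fun n => ?_)
    exact (norm_inner_le_norm _ _).trans (mul_le_mul_of_nonneg_right (hbd x n) (norm_nonneg _))
  rcases (norm_nonneg (A x)).eq_or_lt with h | h
  · change ‖A x‖ ≤ ‖x‖
    rw [← h]
    positivity
  · change ‖A x‖ ≤ ‖x‖
    nlinarith

omit [CompleteSpace H] in
lemma norm_sub_starProjection_le (S : Submodule ℂ H) [S.HasOrthogonalProjection] (x : H) :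
    ‖x - S.starProjection x‖ ≤ ‖x‖ := by
  rw [← Submodule.starProjection_orthogonal_val]
  exact Submodule.norm_starProjection_apply_le _ _

/-- A positive operator with bounded trace that satisfies `‖A x‖² ≤ ⟪x, A x⟫` is compact. -/
lemma isCompactOperator_of_trace_le {A : H →L[ℂ] H}
    (htr : ∀ (k : ℕ) (e : Fin k → H), Orthonormal ℂ e →
      ∑ i, (inner ℂ (e i) (A (e i)) : ℂ).re ≤ 1)
    (hA : ∀ x, ‖A x‖ ^ 2 ≤ (inner ℂ x (A x) : ℂ).re) : IsCompactOperator A := by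
  have key : ∀ ε : ℝ, 0 < ε → ∃ S : Submodule ℂ H, FiniteDimensional ℂ S ∧
      ∀ x ∈ Sᗮ, (inner ℂ x (A x) : ℂ).re ≤ ε * ‖x‖ ^ 2 := by
    intro ε hε
    -- The trace bound allows at most `1 / ε` orthonormal vectors on which the form exceeds `ε`. On
    -- the orthogonal complement of a largest such family the form is at most `ε ‖x‖²`: a violating
    -- vector, normalized, would enlarge the family.
    let P : ℕ → Prop := fun k => ∃ e : Fin k → H, Orthonormal ℂ e ∧
      ∀ i, ε < (inner ℂ (e i) (A (e i)) : ℂ).re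
    have hP0 : P 0 := ⟨Fin.elim0, by simp [Orthonormal], fun i => i.elim0⟩
    obtain ⟨N, hN⟩ := exists_nat_gt (1 / ε)
    have hPN : ∀ k, P k → k ≤ N := by
      rintro k ⟨e, he, hei⟩
      have h1 := htr k e he
      have h2 : ∑ _i : Fin k, ε ≤ ∑ i, (inner ℂ (e i) (A (e i)) : ℂ).re :=
        Finset.sum_le_sum fun i _ => (hei i).le
      simp only [Finset.sum_const, Finset.card_univ, Fintype.card_fin, nsmul_eq_mul] at h2
      have h3 : (k : ℝ) ≤ 1 / ε := by
        rw [le_div_iff₀ hε]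
        exact h2.trans h1
      exact_mod_cast (h3.trans hN.le)
    classical
    have hmax := Nat.findGreatest_spec (P := P) (n := N) (Nat.zero_le _) hP0
    set k := Nat.findGreatest P N with hk
    obtain ⟨e, he, hei⟩ := hmax
    refine ⟨Submodule.span ℂ (Set.range e), FiniteDimensional.span_of_finite ℂ (Set.finite_range e),
      fun x hx => ?_⟩
    by_contra! hcon
    have hx0 : x ≠ 0 := by
      rintro rfl
      simp at hcon
    have hxn : 0 < ‖x‖ := norm_pos_iff.2 hx0
    have horth : ∀ i, inner ℂ (e i) x = 0 := fun i =>
      Submodule.inner_right_of_mem_orthogonal (Submodule.subset_span (Set.mem_range_self i)) hx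
    let y : H := ((‖x‖⁻¹ : ℝ) : ℂ) • x
    have hye : ∀ i, inner ℂ (e i) y = 0 := fun i => by
      rw [inner_smul_right, horth, mul_zero]
    have hP : P (k + 1) := by
      refine ⟨Fin.cons y e, ?_, ?_⟩
      · rw [orthonormal_iff_ite]
        intro i j
        have he' := orthonormal_iff_ite.1 he
        refine Fin.cases ?_ (fun i => ?_) i <;> refine Fin.cases ?_ (fun j => ?_) j
        · simp only [Fin.cons_zero, if_true]
          rw [inner_self_eq_norm_sq_to_K]
          simp [y, norm_smul, hxn.ne']
        · simp only [Fin.cons_zero, Fin.cons_succ]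
          rw [if_neg (Fin.succ_ne_zero j).symm, ← inner_conj_symm, hye, map_zero]
        · simp only [Fin.cons_zero, Fin.cons_succ]
          rw [if_neg (Fin.succ_ne_zero i), hye]
        · simp only [Fin.cons_succ, he', Fin.succ_inj]
      · refine Fin.cases ?_ fun i => ?_
        · simp only [Fin.cons_zero, y, map_smul, inner_smul_left, inner_smul_right,
            Complex.conj_ofReal, Complex.re_ofReal_mul]
          rw [← mul_assoc, ← mul_inv, ← sq, inv_mul_eq_div, lt_div_iff₀ (by positivity)]
          exact hcon
        · simpa using hei i
    have := Nat.le_findGreatest (hPN _ hP) hP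
    omega
  have hcl : A ∈ closure {T : H →L[ℂ] H | IsCompactOperator T} := by
    rw [Metric.mem_closure_iff]
    intro ε hε
    -- The hypothesis `‖A x‖² ≤ ⟪x, A x⟫` turns the form bound `(ε / 2)²` into the norm bound `ε /
    -- 2` on `Sᗮ`, so `A` is within `ε / 2` of the finite-rank operator `A ∘ S.starProjection`.
    obtain ⟨S, hS, hSx⟩ := key ((ε / 2) ^ 2) (by positivity)
    refine ⟨A ∘L S.starProjection, ?_, ?_⟩
    · have : ProperSpace S := FiniteDimensional.proper ℂ S
      have : IsCompactOperator (A ∘L S.subtypeL) :=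
        isCompactOperator_of_locallyCompactSpace_rng (A ∘L S.subtypeL)
      exact this.comp_clm S.orthogonalProjectionOnto
    · rw [dist_eq_norm]
      refine lt_of_le_of_lt (ContinuousLinearMap.opNorm_le_bound _ (half_pos hε).le fun x => ?_)
        (half_lt_self hε)
      have h1 : (A - A ∘L S.starProjection) x = A (x - S.starProjection x) := by simp
      have h2 : x - S.starProjection x ∈ Sᗮ := Submodule.sub_starProjection_mem_orthogonal x
      have h3 := (hA _).trans (hSx _ h2)
      rw [← mul_pow] at h3
      rw [h1]
      refine ((sq_le_sq₀ (norm_nonneg _) (by positivity)).1 h3).trans ?_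
      exact mul_le_mul_of_nonneg_left (norm_sub_starProjection_le S x) (by positivity)
  rwa [IsClosed.closure_eq (isClosed_setOfPred_isCompactOperator)] at hcl

/-- If the correlations `⟪F, U_n F⟫` do not vanish on average, then `F` correlates with a common
eigenvector of the operators `U_n`. -/
theorem exists_eigenvector_of_correlation [AddCommGroup G] (hM : IsInvMean M)
    (U : G → H →ₗᵢ[ℂ] H) (hU0 : ∀ x, U 0 x = x) (hUadd : ∀ g h x, U (g + h) x = U g (U h x))
    {F : H} (hF : ‖F‖ ≤ 1) (hpos : 0 < rmean M fun n => ‖inner ℂ F (U n F)‖ ^ 2) :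
    ∃ e : H, ‖e‖ = 1 ∧ (∃ c : G → ℂ, ∀ g, U g e = c g • e) ∧
      (rmean M fun n => ‖inner ℂ F (U n F)‖ ^ 2) ≤ ‖inner ℂ e F‖ ^ 2 := by
  have hv : ∀ n, ‖U n F‖ ≤ 1 := fun n => by rwa [(U n).norm_map]
  -- The averaged rank one operator `A` is positive, commutes with all `U g` because `M` is
  -- invariant, and is compact because its trace is at most one. Its form at `F` is the mean to be
  -- bounded.
  obtain ⟨A, hA⟩ := exists_mean_rankOne hM.toIsMean hv
  have hbi : ∀ x n, |‖inner ℂ (U n F) x‖| ≤ ‖x‖ := fun x n => by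
    rw [abs_norm]
    exact (norm_inner_le_norm _ _).trans (mul_le_of_le_one_left (norm_nonneg _) (hv n))
  have hbi2 : ∀ x n, |‖inner ℂ (U n F) x‖ ^ 2| ≤ ‖x‖ ^ 2 := fun x n => by
    rw [abs_pow]
    exact pow_le_pow_left₀ (abs_nonneg _) (hbi x n) 2
  have hquad : ∀ x, inner ℂ x (A x) = ((rmean M fun n => ‖inner ℂ (U n F) x‖ ^ 2 : ℝ) : ℂ) := by
    intro x
    have h1 : ∀ n, inner ℂ (U n F) x * inner ℂ x (U n F)
        = ((‖inner ℂ (U n F) x‖ ^ 2 : ℝ) : ℂ) := fun n => by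
      rw [← inner_conj_symm x, Complex.mul_conj']
      push_cast
      rfl
    rw [hA]
    simp only [h1]
    exact Complex.ext rfl (by
      rw [Complex.ofReal_im]
      exact hM.toIsMean.im_eq_zero (bdd_ofReal (hbi2 x)) fun n => Complex.ofReal_im _)
  have hsymm : A.IsSymmetric := by
    intro x y
    change inner ℂ (A x) y = inner ℂ x (A y)
    rw [← inner_conj_symm, hA, hA, ← hM.map_conj]
    · simp only [map_mul, inner_conj_symm]
      congr 1
      funext n
      ring
    · exact (bdd_inner (w := fun _ => x) hv fun _ => le_rfl).mul
        (bdd_inner (v := fun _ => y) (fun _ => le_rfl) hv)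
  have hcomm : ∀ g x, A (U g x) = U g (A x) := by
    intro g x
    refine ext_inner_left ℂ fun y => ?_
    have h1 : ∀ n, U (n + g) F = U g (U n F) := fun n => by rw [add_comm, hUadd]
    have h2 : ∀ z, inner ℂ y (U g z) = inner ℂ (U (-g) y) z := fun z => by
      rw [← (U g).inner_map_map (U (-g) y), ← hUadd, add_neg_cancel, hU0]
    rw [h2, hA, hA, ← hM.shift g]
    · simp only [h1, (U g).inner_map_map, h2]
    · exact (bdd_inner (w := fun _ => U g x) hv fun _ => le_rfl).mul
        (bdd_inner (v := fun _ => y) (fun _ => le_rfl) hv)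
  have hAsq : ∀ x, ‖A x‖ ^ 2 ≤ (inner ℂ x (A x) : ℂ).re := by
    intro x
    rw [hquad, Complex.ofReal_re]
    have h1 : ‖A x‖ ≤ rmean M fun n => ‖inner ℂ (U n F) x‖ := by
      rcases (norm_nonneg (A x)).eq_or_lt with h | h
      · rw [← h]
        exact hM.rmean_nonneg (hbi x) fun n => norm_nonneg _
      · have h2 : ‖A x‖ ^ 2 ≤ ‖A x‖ * rmean M fun n => ‖inner ℂ (U n F) x‖ := by
          have h3 : (inner ℂ (A x) (A x) : ℂ).re = ‖A x‖ ^ 2 :=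
            (norm_sq_eq_re_inner (𝕜 := ℂ) _).symm
          rw [← h3, hA, ← hM.rmean_const_mul (hbi x)]
          have hbb : ∀ n, ‖inner ℂ (U n F) x * inner ℂ (A x) (U n F)‖
              ≤ ‖A x‖ * ‖inner ℂ (U n F) x‖ := fun n => by
            rw [norm_mul, mul_comm]
            exact mul_le_mul_of_nonneg_right ((norm_inner_le_norm _ _).trans
              (mul_le_of_le_one_right (norm_nonneg _) (hv n))) (norm_nonneg _)
          have hbc : ∀ n, |‖A x‖ * ‖inner ℂ (U n F) x‖| ≤ ‖A x‖ * ‖x‖ := fun n => by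
            rw [abs_mul, abs_norm]
            exact mul_le_mul_of_nonneg_left (hbi x n) (norm_nonneg _)
          have hbd : ∀ n, ‖inner ℂ (U n F) x * inner ℂ (A x) (U n F)‖ ≤ ‖A x‖ * ‖x‖ := fun n =>
            (hbb n).trans ((le_abs_self _).trans (hbc n))
          refine (Complex.re_le_norm _).trans ((hM.re_le_rmean_norm ⟨_, hbd⟩).trans ?_)
          exact hM.rmean_mono (fun n => by simpa using hbd n) hbc hbb
        nlinarith
    exact (pow_le_pow_left₀ (norm_nonneg _) h1 2).trans (hM.sq_rmean_le (hbi x))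
  have htr : ∀ (k : ℕ) (e : Fin k → H), Orthonormal ℂ e →
      ∑ i, (inner ℂ (e i) (A (e i)) : ℂ).re ≤ 1 := by
    intro k e he
    simp only [hquad, Complex.ofReal_re]
    have h1 : ∑ i, (rmean M fun n => ‖inner ℂ (U n F) (e i)‖ ^ 2)
        = (M fun n => ∑ i, ((‖inner ℂ (U n F) (e i)‖ ^ 2 : ℝ) : ℂ)).re := by
      rw [hM.sum _ fun i _ => bdd_ofReal (hbi2 (e i)), Complex.re_sum]
      rfl
    rw [h1]
    refine (hM.re_mono (v := fun _ => 1) (Bdd.sum _ fun i _ => bdd_ofReal (hbi2 (e i)))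
      (bdd_const 1) fun n => ?_).trans_eq (by rw [hM.const]; rfl)
    rw [← Complex.ofReal_sum, Complex.ofReal_re, Complex.one_re]
    have h2 := he.sum_inner_products_le (U n F) (s := Finset.univ)
    simp only [norm_inner_symm (U n F)]
    exact h2.trans (pow_le_one₀ (norm_nonneg _) (hv n))
  have hcpt := isCompactOperator_of_trace_le htr hAsq
  have hFF : (inner ℂ F (A F) : ℂ).re = rmean M fun n => ‖inner ℂ F (U n F)‖ ^ 2 := by
    rw [hquad, Complex.ofReal_re]
    simp only [norm_inner_symm F]
  have hFA : (inner ℂ F (A F) : ℂ).re ≤ ‖A‖ := by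
    refine (Complex.re_le_norm _).trans ((norm_inner_le_norm _ _).trans ?_)
    calc ‖F‖ * ‖A F‖ ≤ 1 * (‖A‖ * 1) := by
          gcongr
          exact (A.le_opNorm F).trans (by gcongr)
      _ = ‖A‖ := by ring
  have hAn : 0 < ‖A‖ := by linarith
  have hnt : Nontrivial H := by
    refine ⟨⟨F, 0, fun h => ?_⟩⟩
    rw [h] at hFF
    simp at hFF
    simp [h] at hpos
    linarith
  -- Self-adjointness gives a spectral value of modulus `‖A‖`; compactness makes it an eigenvalue
  -- with finite-dimensional eigenspace, in which the commuting `U g` have a common eigenvector.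
  obtain ⟨lam, hlam, hlamn⟩ := spectrum.exists_nnnorm_eq_spectralRadius A
  rw [A.spectralRadius_eq_nnnorm hsymm.isSelfAdjoint, ENNReal.coe_inj] at hlamn
  have hlamn' : ‖lam‖ = ‖A‖ := congrArg NNReal.toReal hlamn
  have hlam0 : lam ≠ 0 := by
    rw [← norm_pos_iff, hlamn']
    exact hAn
  have hev := (hcpt.hasEigenvalue_iff_mem_spectrum hlam0).2 hlam
  obtain ⟨e₀, he₀, he₀0, c, hc⟩ := exists_common_eigenvector (G := G)
    (fun g => (U g).toLinearMap) (fun g h x => by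
      change U g (U h x) = U h (U g x)
      rw [← hUadd, add_comm, hUadd]) _
    (Module.End.eigenspace (A : H →ₗ[ℂ] H) lam)
    (ContinuousLinearMap.finite_dimensional_eigenspace hcpt lam hlam0) rfl
    hev (fun g x hx => by
      rw [Module.End.mem_eigenspace_iff] at hx ⊢
      change A (U g x) = lam • U g x
      rw [hcomm, show A x = lam • x from hx, map_smul])
  have he₀n : 0 < ‖e₀‖ := norm_pos_iff.2 he₀0
  set e : H := ((‖e₀‖⁻¹ : ℝ) : ℂ) • e₀ with he
  have hen : ‖e‖ = 1 := by
    rw [he, norm_smul, Complex.norm_real, Real.norm_of_nonneg (by positivity),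
      inv_mul_cancel₀ he₀n.ne']
  have hUe : ∀ g, U g e = c g • e := fun g => by
    rw [he, map_smul, show U g e₀ = c g • e₀ from hc g, smul_comm]
  refine ⟨e, hen, ⟨c, hUe⟩, ?_⟩
  have hAe : A e = lam • e := by
    rw [he, map_smul, show A e₀ = lam • e₀ from Module.End.mem_eigenspace_iff.1 he₀, smul_comm]
  have hcn : ∀ g, ‖c g‖ = 1 := fun g => by
    have := (U g).norm_map e
    rwa [hUe, norm_smul, hen, mul_one] at this
  -- The modulus `|⟪U n F, e⟫|` is constant in `n` for a common eigenvector, so the eigenvalue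
  -- equals `|⟪e, F⟫|²`. Its modulus `‖A‖` dominates the form of `A` at `F`.
  have h3 : ∀ n, ‖inner ℂ (U n F) e‖ = ‖inner ℂ e F‖ := fun n => by
    have h4 : inner ℂ (U n F) (U n e) = c n * inner ℂ (U n F) e := by
      rw [hUe, inner_smul_right]
    rw [(U n).inner_map_map] at h4
    rw [norm_inner_symm e, h4, norm_mul, hcn, one_mul]
  have h5 := hquad e
  simp only [h3, hM.rmean_const] at h5
  rw [hAe, inner_smul_right, inner_self_eq_norm_sq_to_K, hen] at h5
  simp only [RCLike.ofReal_one, one_pow, mul_one] at h5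
  rw [← hFF]
  refine hFA.trans ?_
  rw [← hlamn', h5, Complex.norm_real, Real.norm_of_nonneg (by positivity)]

end Correlation

/-! ### The unit ball of bounded functions -/

/-- The integral of products of bounded functions is a positive semidefinite kernel. -/
lemma isPSD_integral {ι Ω : Type*} [MeasurableSpace Ω] (ν : Measure Ω) [IsFiniteMeasure ν]
    {e : ι → Ω → ℂ} (he : ∀ i, Measurable (e i)) (hb : ∀ i ω, ‖e i ω‖ ≤ 1) :
    IsPSD fun i j => ∫ ω, conj (e i ω) * e j ω ∂ν := by
  have hint : ∀ i j, Integrable (fun ω => conj (e i ω) * e j ω) ν := fun i j => by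
    refine Integrable.of_bound
      ((Complex.continuous_conj.measurable.comp (he i)).mul (he j)).aestronglyMeasurable 1
      (Eventually.of_forall fun ω => ?_)
    rw [norm_mul, RCLike.norm_conj]
    exact mul_le_one₀ (hb i ω) (norm_nonneg _) (hb j ω)
  refine ⟨fun i j => ?_, fun x c => ?_⟩
  · rw [← integral_conj]
    simp only [map_mul, Complex.conj_conj, mul_comm]
  -- The quadratic form is the integral of `|∑ c_i e_{x_i}|²`.
  · have h : ∑ i, ∑ j, conj (c i) * c j * ∫ ω, conj (e (x i) ω) * e (x j) ω ∂ν
        = ∫ ω, ((‖∑ i, c i * e (x i) ω‖ ^ 2 : ℝ) : ℂ) ∂ν := by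
      have h1 : ∀ ω, ((‖∑ i, c i * e (x i) ω‖ ^ 2 : ℝ) : ℂ)
          = ∑ i, ∑ j, conj (c i) * c j * (conj (e (x i) ω) * e (x j) ω) := fun ω => by
        push_cast
        rw [← Complex.conj_mul', map_sum, Finset.sum_mul_sum]
        refine Finset.sum_congr rfl fun i _ => Finset.sum_congr rfl fun j _ => ?_
        rw [map_mul]
        ring
      simp only [h1]
      rw [integral_finsetSum _ fun i _ => integrable_finsetSum _ fun j _ => (hint _ _).const_mul _]
      refine Finset.sum_congr rfl fun i _ => ?_
      rw [integral_finsetSum _ fun j _ => (hint _ _).const_mul _]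
      exact Finset.sum_congr rfl fun j _ => (integral_const_mul _ _).symm
    have h2 := integral_ofReal (𝕜 := ℂ) (μ := ν) (f := fun ω => ‖∑ i, c i * e (x i) ω‖ ^ 2)
    rw [h]
    refine le_of_le_of_eq ?_ (congrArg Complex.re h2).symm
    rw [RCLike.ofReal_eq_complex_ofReal, Complex.ofReal_re]
    exact integral_nonneg fun ω => by positivity

section UnitBall

variable (X : Type*) [MeasurableSpace X]

/-- The monoid of measurable functions bounded by one. -/
def unitBall : Submonoid (X → ℂ) where
  carrier := {f | Measurable f ∧ ∀ x, ‖f x‖ ≤ 1}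
  mul_mem' := fun ha hb => ⟨ha.1.mul hb.1, fun x => by
    rw [Pi.mul_apply, norm_mul]
    exact mul_le_one₀ (ha.2 x) (norm_nonneg _) (hb.2 x)⟩
  one_mem' := ⟨measurable_one, fun x => by simp⟩

variable {X}

instance : StarMul (unitBall X) where
  star f := ⟨fun x => conj (f.1 x), Complex.continuous_conj.measurable.comp f.2.1, fun x => by
    rw [RCLike.norm_conj]
    exact f.2.2 x⟩
  star_involutive f := Subtype.ext (funext fun x => Complex.conj_conj _)
  star_mul f g := Subtype.ext (funext fun x => by
    change conj (f.1 x * g.1 x) = conj (g.1 x) * conj (f.1 x)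
    rw [map_mul, mul_comm])

lemma unitBall.memLp (f : unitBall X) (p : ENNReal) (μ : Measure X) [IsFiniteMeasure μ] :
    MemLp f.1 p μ :=
  MemLp.of_bound f.2.1.aestronglyMeasurable 1 (Eventually.of_forall f.2.2)

lemma unitBall.integrable (f : unitBall X) (μ : Measure X) [IsFiniteMeasure μ] :
    Integrable f.1 μ := memLp_one_iff_integrable.1 (unitBall.memLp f 1 μ)

lemma unitBall.mul_apply (f g : unitBall X) (x : X) : (f * g).1 x = f.1 x * g.1 x := rfl

lemma unitBall.star_apply (f : unitBall X) (x : X) : (star f).1 x = conj (f.1 x) := rfl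

/-- The constant functions in the unit ball. -/
def unitBall.const (c : ℂ) (hc : ‖c‖ ≤ 1) : unitBall X :=
  ⟨fun _ => c, measurable_const, fun _ => hc⟩

end UnitBall

/-! ### The seminorms as iterated means -/

section Dynamics

variable {G : Type u} {X : Type v} [AddCommGroup G] [MeasurableSpace G] [MeasurableSpace X]
  [AddAction G X] [MeasurableVAdd₂ G X]

variable (G X) in
/-- The Koopman action on the unit ball. -/
def koopmanAction : StarAction G (unitBall X) where
  T g :=
    { toFun := fun f => ⟨fun x => f.1 (g +ᵥ x), f.2.1.comp (measurable_const_vadd g),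
        fun x => f.2.2 _⟩
      map_one' := rfl
      map_mul' := fun _ _ => rfl }
  map_zero f := Subtype.ext (funext fun x => congrArg f.1 (zero_vadd G x))
  map_add g h f := Subtype.ext (funext fun x => congrArg f.1 (by rw [add_comm, add_vadd]))
  map_star _ _ := rfl

lemma coe_diff (g : G) (f : unitBall X) :
    ((koopmanAction G X).diff g f).1 = multDeriv g f.1 := rfl

variable (μ : Measure X) [IsProbabilityMeasure μ]

/-- The integral as a state on the unit ball. -/
def integralState (f : unitBall X) : ℂ := ∫ x, f.1 x ∂μ

lemma isState_integralState [VAddInvariantMeasure G X μ] :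
    (koopmanAction G X).IsState (integralState μ) where
  psd := isPSD_integral μ (e := fun f : unitBall X => f.1) (fun f => f.2.1)
    fun f => f.2.2
  inv g f := (measurePreserving_vadd g μ).integral_comp
    (measurableEmbedding_const_vadd g) f.1
  norm_le f := by
    refine (norm_integral_le_of_norm_le_const (Eventually.of_forall f.2.2)).trans ?_
    simp

/-- Joint measurability of a family of functions in the unit ball. -/
def MeasurableFamily {Ω : Type*} [MeasurableSpace Ω] (w : Ω → unitBall X) : Prop :=
  Measurable fun p : Ω × X => (w p.1).1 p.2

lemma measurableFamily_diff {Ω : Type*} [MeasurableSpace Ω] {w : Ω → unitBall X}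
    (hw : MeasurableFamily w) :
    MeasurableFamily fun p : Ω × G => (koopmanAction G X).diff p.2 (w p.1) := by
  have h1 : Measurable fun q : (Ω × G) × X => (w q.1.1).1 q.2 :=
    hw.comp (measurable_fst.fst.prodMk measurable_snd)
  have h2 : Measurable fun q : (Ω × G) × X => (w q.1.1).1 (q.1.2 +ᵥ q.2) :=
    hw.comp (measurable_fst.fst.prodMk (measurable_fst.snd.vadd measurable_snd))
  exact h1.mul (Complex.continuous_conj.measurable.comp h2)

variable [MeasurableAdd G] {m : Measure G} [m.IsAddLeftInvariant] [SFinite m] {Φ : ℕ → Set G}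
  (hΦ : IsFolnerSeq m Φ) {M : (G → ℂ) → ℂ} (hM : IsInvMean M) [VAddInvariantMeasure G X μ]

include hΦ hM

/-- Means do not preserve measurability, but order `s + 1` is a pointwise limit of Følner averages
of order `s`. This needs order `s` to be measurable in the derivative variable too, so the parameter
space grows to `Ω × G`; this is why `Ω` varies and lies in the universe of `G`. -/
lemma measurable_gowers (s : ℕ) {Ω : Type u} [MeasurableSpace Ω] {w : Ω → unitBall X}
    (hw : MeasurableFamily w) :
    Measurable fun ω => (koopmanAction G X).gowers M (integralState μ) s (w ω) := by
  induction s generalizing Ω with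
  | zero => exact (hw.stronglyMeasurable.integral_prod_right (ν := μ)).measurable
  | succ s ih =>
    have hst := (isState_integralState (G := G) μ).gowers hM.toIsMean s
    have h1 : ∀ ω, Tendsto (fun N => ⨍ n in Φ N, (koopmanAction G X).gowers M (integralState μ) s
        ((koopmanAction G X).diff n (w ω)) ∂m) atTop
        (𝓝 ((koopmanAction G X).gowers M (integralState μ) (s + 1) (w ω))) := fun ω => by
      refine hst.tendsto_average_diff hΦ hM (w ω) (ih ?_)
      have h2 : Measurable fun q : G × X => ((ω, q.1), q.2) := by fun_prop
      exact (measurableFamily_diff hw).comp h2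
    refine measurable_of_tendsto_metrizable (fun N => ?_) (tendsto_pi_nhds.2 h1)
    simp only [setAverage_eq]
    exact ((ih (measurableFamily_diff hw)).stronglyMeasurable.integral_prod_right
      (ν := m.restrict (Φ N))).measurable.const_smul _

lemma tendsto_average_gowers (s : ℕ) (f : unitBall X) :
    Tendsto (fun N => ⨍ n in Φ N, (koopmanAction G X).gowers M (integralState μ) s
        ((koopmanAction G X).diff n f) ∂m) atTop
        (𝓝 ((koopmanAction G X).gowers M (integralState μ) (s + 1) f)) := by
  have hst := (isState_integralState (G := G) μ).gowers hM.toIsMean s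
  refine hst.tendsto_average_diff hΦ hM f ?_
  let e : G → PUnit.{u + 1} × G := fun n => (PUnit.unit, n)
  have he : Measurable e := measurable_const.prodMk measurable_id
  have hw : MeasurableFamily fun _ : PUnit.{u + 1} => f := f.2.1.comp measurable_snd
  have h := measurable_gowers μ hΦ hM s (measurableFamily_diff (G := G) hw)
  exact h.comp he

lemma ghkSeminorm_succ (s : ℕ) (h : ∀ f : unitBall X, ghkSeminorm m Φ μ s f.1 ^ 2 ^ s
      = (koopmanAction G X).gowers M (integralState μ) s f) (f : unitBall X) :
    ghkSeminorm m Φ μ (s + 1) f.1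
      = (koopmanAction G X).gowers M (integralState μ) (s + 1) f ^ ((1 : ℂ) / 2 ^ (s + 1)) := by
  have h1 : ∀ N, (⨍ n in Φ N, ghkSeminorm m Φ μ s (multDeriv n f.1) ^ 2 ^ s ∂m)
      = ⨍ n in Φ N, (koopmanAction G X).gowers M (integralState μ) s
        ((koopmanAction G X).diff n f) ∂m := fun N => by
    congr 1
    funext n
    exact h ((koopmanAction G X).diff n f)
  rw [ghkSeminorm]
  simp only [h1]
  rw [(tendsto_average_gowers μ hΦ hM s f).limUnder_eq]

/-- The seminorms, defined by limits along the Følner sequence, are given by iterated means. -/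
theorem ghkSeminorm_pow (s : ℕ) (f : unitBall X) :
    ghkSeminorm m Φ μ s f.1 ^ 2 ^ s = (koopmanAction G X).gowers M (integralState μ) s f := by
  induction s generalizing f with
  | zero =>
    rw [pow_zero, pow_one]
    rfl
  | succ s ih =>
    rw [ghkSeminorm_succ μ hΦ hM s ih f]
    generalize (koopmanAction G X).gowers M (integralState μ) (s + 1) f = z
    generalize s + 1 = k
    have h2 : ((1 : ℂ) / 2 ^ k) = ((2 ^ k : ℕ) : ℂ)⁻¹ := by push_cast; rw [one_div]
    -- The power undoes the principal root at every complex number, so the sign of the limit does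
    -- not matter.
    rw [h2, Complex.cpow_nat_inv_pow _ (pow_ne_zero _ two_ne_zero)]

lemma ghkSeminorm_eq_zero {s : ℕ} {f : unitBall X}
    (h : (koopmanAction G X).gowers M (integralState μ) s f = 0) :
    ghkSeminorm m Φ μ s f.1 = 0 := by
  have := ghkSeminorm_pow μ hΦ hM s f
  rw [h] at this
  exact eq_zero_of_pow_eq_zero this

end Dynamics

/-! ### Ergodicity and eigenfunctions -/

section Ergodic

variable {G X : Type*} [AddCommGroup G] [MeasurableSpace X] {μ : Measure X}

omit [AddCommGroup G] in
/-- For an ergodic action, invariant functions are constant. -/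
lemma ae_eq_const_of_invariant [VAdd G X] [ErgodicVAdd G X μ] {f : X → ℂ} (hf : Measurable f)
    (h : ∀ g : G, (fun x => f (g +ᵥ x)) =ᵐ[μ] f) : ∃ c, f =ᵐ[μ] fun _ => c := by
  refine exists_eventuallyEq_const_of_forall_separating MeasurableSet fun U hU => ?_
  have h1 : EventuallyConst (f ⁻¹' U) (ae μ) :=
    aeconst_of_forall_preimage_vadd_ae_eq G (hf hU).nullMeasurableSet fun g =>
      ((h g).mono fun x hx => by
        change f (g +ᵥ x) ∈ U ↔ f x ∈ U
        rw [show f (g +ᵥ x) = f x from hx]).set_eq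
  exact eventuallyConst_set.1 h1

/-- Invariance of the measure gives `(e(α g) - 1) ∫ f = 0` for every `g`. -/
lemma HasEigenvalue.integral_eq_zero [MeasurableSpace G] [AddAction G X] [MeasurableVAdd G X]
    [VAddInvariantMeasure G X μ]
    {α : G →+ UnitAddCircle} {f : X → ℂ} (h : HasEigenvalue μ α f) (hα : α ≠ 0) :
    ∫ x, f x ∂μ = 0 := by
  obtain ⟨g, hg⟩ : ∃ g, α g ≠ 0 := by
    by_contra! hcon
    exact hα (AddMonoidHom.ext hcon)
  have h1 : ∫ x, f (g +ᵥ x) ∂μ = ∫ x, f x ∂μ :=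
    (measurePreserving_vadd g μ).integral_comp (measurableEmbedding_const_vadd g) f
  have h0 : ∫ x, f (g +ᵥ x) ∂μ = _ := integral_congr_ae (h g)
  rw [h0, integral_const_mul] at h1
  have h2 : (expCircle (α g) - 1) * ∫ x, f x ∂μ = 0 := by rw [sub_mul, one_mul, h1, sub_self]
  refine (mul_eq_zero.1 h2).resolve_left fun h3 => hg (expCircle_injective ?_)
  rw [expCircle_zero, sub_eq_zero.1 h3]

end Ergodic

/-! ### Weak means of functions -/

section L2

variable {X : Type*} [MeasurableSpace X] (μ : Measure X)

lemma inner_toLp {f g : X → ℂ} (hf : MemLp f 2 μ) (hg : MemLp g 2 μ) :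
    inner ℂ (hf.toLp f) (hg.toLp g) = ∫ x, conj (f x) * g x ∂μ := by
  rw [L2.inner_def]
  refine integral_congr_ae ?_
  filter_upwards [hf.coeFn_toLp, hg.coeFn_toLp] with x hx hy
  rw [hx, hy, RCLike.inner_apply, mul_comm]

variable [IsProbabilityMeasure μ]

/-- The class in `L²` of an element of the unit ball. -/
def toL2 (f : unitBall X) : Lp ℂ 2 μ := (unitBall.memLp f 2 μ).toLp f.1

lemma coeFn_toL2 (f : unitBall X) : toL2 μ f =ᵐ[μ] f.1 := MemLp.coeFn_toLp _

lemma inner_toL2 (f g : unitBall X) :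
    inner ℂ (toL2 μ f) (toL2 μ g) = ∫ x, conj (f.1 x) * g.1 x ∂μ := inner_toLp μ _ _

lemma inner_toL2_left (f : unitBall X) (V : Lp ℂ 2 μ) :
    inner ℂ (toL2 μ f) V = ∫ x, conj (f.1 x) * V x ∂μ := by
  rw [L2.inner_def]
  refine integral_congr_ae ?_
  filter_upwards [coeFn_toL2 μ f] with x hx
  rw [hx, RCLike.inner_apply, mul_comm]

lemma norm_toL2_le (f : unitBall X) : ‖toL2 μ f‖ ≤ 1 := by
  have h : ‖(inner ℂ (toL2 μ f) (toL2 μ f) : ℂ)‖ ≤ 1 := by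
    rw [inner_toL2]
    refine (norm_integral_le_of_norm_le_const (C := 1) (Eventually.of_forall fun x => ?_)).trans
      (by simp)
    rw [norm_mul, RCLike.norm_conj]
    exact mul_le_one₀ (f.2.2 x) (norm_nonneg _) (f.2.2 x)
  rw [inner_self_eq_norm_sq_to_K, norm_pow, RCLike.norm_ofReal, abs_norm] at h
  exact (sq_le_one_iff₀ (norm_nonneg _)).1 h

/-- Weak means of functions in the unit ball. -/
theorem exists_weak_mean {α : Type*} {M : (α → ℂ) → ℂ} (hM : IsMean M) (F : α → unitBall X) :
    ∃ F₀ : unitBall X, ∀ w : unitBall X,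
      ∫ x, w.1 x * F₀.1 x ∂μ = M fun n => ∫ x, w.1 x * (F n).1 x ∂μ := by
  obtain ⟨V, -, hV⟩ := exists_mean_vector hM (v := fun n => toL2 μ (F n)) fun n => norm_toL2_le μ _
  have hVm : Measurable V := (Lp.stronglyMeasurable V).measurable
  have hVi : Integrable V μ := (Lp.memLp V).integrable one_le_two
  have hV' : ∀ w : unitBall X, ∫ x, w.1 x * V x ∂μ = M fun n => ∫ x, w.1 x * (F n).1 x ∂μ := by
    intro w
    have := hV (toL2 μ (star w))
    simp only [inner_toL2] at this
    rw [inner_toL2_left] at this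
    simp only [unitBall.star_apply, Complex.conj_conj] at this
    exact this
  have hA : MeasurableSet {x | 1 < ‖V x‖} := measurableSet_lt measurable_const hVm.norm
  -- The `L²` weak mean `V` must be shown to be bounded by one almost everywhere. Tested against its
  -- conjugate phase on `{|V| > 1}`, it satisfies `∫_{|V| > 1} |V| ≤ μ {|V| > 1}`, since every `F n`
  -- is bounded by one; so that set is null.
  let w : unitBall X := ⟨Set.indicator {x | 1 < ‖V x‖} fun x => conj (V x) / ‖V x‖,
    Measurable.indicator ((Complex.continuous_conj.measurable.comp hVm).div
      (Complex.measurable_ofReal.comp hVm.norm)) hA, fun x => by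
      by_cases hx : x ∈ {x | 1 < ‖V x‖}
      · rw [Set.indicator_of_mem hx, norm_div, RCLike.norm_conj, Complex.norm_real, norm_norm]
        exact div_self_le_one _
      · simp [Set.indicator_of_notMem hx]⟩
  have hw1 : ∀ x, w.1 x * V x = ((Set.indicator {x | 1 < ‖V x‖} (fun x => ‖V x‖) x : ℝ) : ℂ) := by
    intro x
    change Set.indicator {x | 1 < ‖V x‖} (fun x => conj (V x) / ‖V x‖) x * V x = _
    by_cases hx : x ∈ {x | 1 < ‖V x‖}
    · have h0 : (‖V x‖ : ℂ) ≠ 0 := by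
        have : (1 : ℝ) < ‖V x‖ := hx
        exact_mod_cast (zero_lt_one.trans this).ne'
      rw [Set.indicator_of_mem hx, Set.indicator_of_mem hx, div_mul_eq_mul_div,
        Complex.conj_mul', pow_two, mul_div_assoc, div_self h0, mul_one]
    · rw [Set.indicator_of_notMem hx, Set.indicator_of_notMem hx, zero_mul, Complex.ofReal_zero]
  have hw2 : ∀ x, ‖w.1 x‖ ≤ Set.indicator {x | 1 < ‖V x‖} (fun _ => (1 : ℝ)) x := by
    intro x
    by_cases hx : x ∈ {x | 1 < ‖V x‖}
    · rw [Set.indicator_of_mem hx]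
      exact w.2.2 x
    · rw [Set.indicator_of_notMem hx]
      change ‖Set.indicator {x | 1 < ‖V x‖} (fun x => conj (V x) / ‖V x‖) x‖ ≤ _
      rw [Set.indicator_of_notMem hx, norm_zero]
  have hi1 : Integrable (Set.indicator {x | 1 < ‖V x‖} (fun _ => (1 : ℝ))) μ :=
    (integrable_const _).indicator hA
  have hi2 : Integrable (Set.indicator {x | 1 < ‖V x‖} (fun x => ‖V x‖)) μ := hVi.norm.indicator hA
  have hle : ‖∫ x, w.1 x * V x ∂μ‖ ≤ ∫ x, Set.indicator {x | 1 < ‖V x‖} (fun _ => (1 : ℝ)) x ∂μ := by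
    rw [hV']
    refine hM.norm_le fun n => norm_integral_le_of_norm_le hi1 (Eventually.of_forall fun x => ?_)
    rw [norm_mul]
    exact (mul_le_of_le_one_right (norm_nonneg _) ((F n).2.2 x)).trans (hw2 x)
  have hle2 : ∫ x, Set.indicator {x | 1 < ‖V x‖} (fun x => ‖V x‖) x ∂μ
      ≤ ∫ x, Set.indicator {x | 1 < ‖V x‖} (fun _ => (1 : ℝ)) x ∂μ := by
    refine le_trans ?_ hle
    simp only [hw1]
    rw [integral_complex_ofReal, Complex.norm_real]
    exact le_abs_self _
  have hnn : 0 ≤ᵐ[μ] fun x => Set.indicator {x | 1 < ‖V x‖} (fun x => ‖V x‖) x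
      - Set.indicator {x | 1 < ‖V x‖} (fun _ => (1 : ℝ)) x := Eventually.of_forall fun x => by
    by_cases hx : x ∈ {x | 1 < ‖V x‖}
    · simp only [Pi.zero_apply, Set.indicator_of_mem hx]
      exact sub_nonneg.2 (le_of_lt hx)
    · simp only [Pi.zero_apply, Set.indicator_of_notMem hx, sub_zero, le_refl]
  have hae : ∀ᵐ x ∂μ, ‖V x‖ ≤ 1 := by
    have h0 := (integral_eq_zero_iff_of_nonneg_ae hnn (hi2.sub hi1)).1
      (le_antisymm (by rw [integral_sub hi2 hi1]; linarith) (integral_nonneg_of_ae hnn))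
    filter_upwards [h0] with x hx
    by_contra! hcon
    have hx' : x ∈ {x | 1 < ‖V x‖} := hcon
    simp only [Pi.zero_apply, Set.indicator_of_mem hx'] at hx
    linarith
  refine ⟨⟨fun x => if ‖V x‖ ≤ 1 then V x else 0,
    Measurable.ite (measurableSet_le hVm.norm measurable_const) hVm measurable_const, fun x => ?_⟩,
    fun w => ?_⟩
  · by_cases hx : ‖V x‖ ≤ 1
    · simpa only [if_pos hx] using hx
    · simp only [if_neg hx, norm_zero, zero_le_one]
  · rw [← hV']
    refine integral_congr_ae ?_
    filter_upwards [hae] with x hx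
    simp only [if_pos hx]

end L2

/-! ### The inverse theorem for the second seminorm -/

section Koopman

variable {G X : Type*} [AddCommGroup G] [MeasurableSpace G] [MeasurableSpace X]
  [AddAction G X] [MeasurableVAdd₂ G X] (μ : Measure X) [IsProbabilityMeasure μ]

/-- The Koopman representation on `L²`. -/
def koopmanLp [VAddInvariantMeasure G X μ] (g : G) : Lp ℂ 2 μ →ₗᵢ[ℂ] Lp ℂ 2 μ :=
  Lp.compMeasurePreservingₗᵢ ℂ (fun x => g +ᵥ x) (measurePreserving_vadd g μ)

section

variable [VAddInvariantMeasure G X μ]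

omit [IsProbabilityMeasure μ] in
lemma coeFn_koopmanLp (g : G) (e : Lp ℂ 2 μ) : koopmanLp μ g e =ᵐ[μ] fun x => e (g +ᵥ x) :=
  Lp.coeFn_compMeasurePreserving e (measurePreserving_vadd g μ)

omit [IsProbabilityMeasure μ] in
lemma koopmanLp_zero (e : Lp ℂ 2 μ) : koopmanLp μ (0 : G) e = e := by
  refine Lp.ext ?_
  filter_upwards [coeFn_koopmanLp μ (0 : G) e] with x hx
  rw [hx, zero_vadd]

omit [IsProbabilityMeasure μ] in
lemma koopmanLp_add (g h : G) (e : Lp ℂ 2 μ) :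
    koopmanLp μ (g + h) e = koopmanLp μ g (koopmanLp μ h e) := by
  refine Lp.ext ?_
  have h1 := (measurePreserving_vadd g μ).quasiMeasurePreserving.ae (coeFn_koopmanLp μ h e)
  filter_upwards [coeFn_koopmanLp μ (g + h) e, coeFn_koopmanLp μ g (koopmanLp μ h e), h1]
    with x h1 h2 h3
  rw [h1, h2, h3, add_comm, add_vadd]

lemma koopmanLp_toL2 (g : G) (f : unitBall X) :
    koopmanLp μ g (toL2 μ f) = toL2 μ ((koopmanAction G X).T g f) := rfl

omit [IsProbabilityMeasure μ] in
lemma inner_koopmanLp_right (g : G) (x y : Lp ℂ 2 μ) :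
    inner ℂ x (koopmanLp μ g y) = inner ℂ (koopmanLp μ (-g) x) y := by
  rw [← (koopmanLp μ g).inner_map_map (koopmanLp μ (-g) x) y, ← koopmanLp_add, add_neg_cancel,
    koopmanLp_zero]

lemma inner_toL2_koopman (n : G) (f : unitBall X) :
    inner ℂ (toL2 μ (star f)) (koopmanLp μ n (toL2 μ (star f)))
      = integralState μ ((koopmanAction G X).diff n f) := by
  rw [koopmanLp_toL2, inner_toL2]
  simp only [unitBall.star_apply, Complex.conj_conj]
  rfl

end

variable [ErgodicVAdd G X μ] {M : (G → ℂ) → ℂ} (hM : IsInvMean M)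

include hM

/-- The weak mean of the translates of `conj f` is invariant, hence constant by ergodicity, and the
constant is `conj (∫ f)`. -/
lemma gowers_one (f : unitBall X) :
    (koopmanAction G X).gowers M (integralState μ) 1 f
      = ((‖integralState μ f‖ ^ 2 : ℝ) : ℂ) := by
  obtain ⟨V, -, hV⟩ := exists_mean_vector hM.toIsMean
    (v := fun n : G => koopmanLp μ n (toL2 μ (star f))) (C := 1) fun n => by
      rw [(koopmanLp μ n).norm_map]
      exact norm_toL2_le μ _
  have hinv : ∀ g : G, koopmanLp μ g V = V := fun g => by
    refine ext_inner_left ℂ fun y => ?_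
    rw [inner_koopmanLp_right, hV, hV]
    simp only [← inner_koopmanLp_right, ← koopmanLp_add]
    have hb : Bdd fun n : G => inner ℂ y (koopmanLp μ n (toL2 μ (star f))) :=
      bdd_inner (C := ‖y‖) (D := 1) (v := fun _ => y) (fun _ => le_rfl) fun n => by
        rw [(koopmanLp μ n).norm_map]
        exact norm_toL2_le μ _
    simpa only [add_comm] using hM.shift g hb
  obtain ⟨c, hc⟩ := ae_eq_const_of_invariant (G := G) (μ := μ)
    (Lp.stronglyMeasurable V).measurable fun g => by
      have := coeFn_koopmanLp μ g V
      rw [hinv] at this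
      exact this.symm
  have hleft : ∀ w : unitBall X, inner ℂ (toL2 μ (star w)) V = integralState μ w * c := fun w => by
    rw [inner_toL2_left, integralState, ← integral_mul_const]
    refine integral_congr_ae ?_
    filter_upwards [hc] with x hx
    rw [hx, unitBall.star_apply, Complex.conj_conj]
  have h1 : c = conj (integralState μ f) := by
    have h2 := hleft 1
    have h3 : integralState μ (1 : unitBall X) = 1 := by simp [integralState]
    rw [h3, one_mul, hV, star_one] at h2
    rw [← h2, ← (isState_integralState (G := G) μ).apply_star]
    have h4 : ∀ n : G, inner ℂ (toL2 μ 1) (koopmanLp μ n (toL2 μ (star f)))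
        = integralState μ (star f) := fun n => by
      rw [koopmanLp_toL2, inner_toL2, ← (isState_integralState (G := G) μ).inv n (star f)]
      simp [integralState]
    simp only [h4]
    exact hM.const _
  have h2 := hleft f
  rw [hV] at h2
  simp only [inner_toL2_koopman] at h2
  rw [h1, Complex.mul_conj'] at h2
  rw [StarAction.gowers]
  simp only [StarAction.gowers]
  rw [h2]
  push_cast
  rfl

lemma gowers_two (f : unitBall X) :
    ((koopmanAction G X).gowers M (integralState μ) 2 f).re
      = rmean M fun n => ‖integralState μ ((koopmanAction G X).diff n f)‖ ^ 2 := by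
  rw [StarAction.gowers]
  simp only [gowers_one μ hM]
  rfl

-- Where `e` does not vanish, comparing `T_{k+g} e` with the successive action of `g` and `k` shows
-- that `c` is multiplicative.
omit [IsProbabilityMeasure μ] hM in
lemma exists_eigenvalue {c : G → ℂ} {e : X → ℂ} (hc : ∀ g, ‖c g‖ = 1) (he : ¬ e =ᵐ[μ] 0)
    (h : ∀ g, koopman g e =ᵐ[μ] fun x => c g * e x) : ∃ α : G →+ UnitAddCircle,
      ∀ g, expCircle (α g) = c g := by
  have h1 : ∀ g, ∃ t : UnitAddCircle, expCircle t = c g := fun g => by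
    obtain ⟨t, ht⟩ := (AddCircle.homeomorphCircle (T := 1) one_ne_zero).surjective
      ⟨c g, mem_sphere_zero_iff_norm.2 (hc g)⟩
    rw [AddCircle.homeomorphCircle_apply] at ht
    exact ⟨t, congrArg Subtype.val ht⟩
  choose t ht using h1
  refine ⟨AddMonoidHom.mk' t fun g k => expCircle_injective ?_, ht⟩
  rw [add_comm g k]
  rw [expCircle_add, ht, ht, ht]
  by_contra hne
  refine he ?_
  have h2 := (measurePreserving_vadd g μ).quasiMeasurePreserving.ae (h k)
  filter_upwards [h (k + g), h g, h2] with x h3 h4 h5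
  simp only [koopman] at h3 h4 h5
  rw [add_vadd, h5, h4, ← mul_assoc, mul_comm (c k)] at h3
  by_contra h0
  exact hne (mul_right_cancel₀ h0 h3).symm

/-- The inverse theorem for the second seminorm. -/
theorem exists_eigenfunction_of_gowers_two (f : unitBall X) :
    ∃ (χ : unitBall X) (α : G →+ UnitAddCircle), (∀ x, ‖χ.1 x‖ = 1) ∧ HasEigenvalue μ α χ.1 ∧
      ((koopmanAction G X).gowers M (integralState μ) 2 f).re
        ≤ ‖∫ x, f.1 x * conj (χ.1 x) ∂μ‖ ^ 2 := by
  by_cases hpos : 0 < ((koopmanAction G X).gowers M (integralState μ) 2 f).re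
  swap
  · refine ⟨1, 0, fun x => by simp, fun g => ?_, (not_lt.1 hpos).trans (by positivity)⟩
    exact Eventually.of_forall fun x => by simp [koopman, expCircle_zero]
  rw [gowers_two μ hM] at hpos ⊢
  simp only [← inner_toL2_koopman] at hpos ⊢
  obtain ⟨e, he1, ⟨c, hc⟩, hle⟩ := exists_eigenvector_of_correlation hM (koopmanLp μ)
    (koopmanLp_zero μ) (koopmanLp_add μ) (norm_toL2_le μ (star f)) hpos
  have hem : Measurable e := (Lp.stronglyMeasurable e).measurable
  have hc1 : ∀ g, ‖c g‖ = 1 := fun g => by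
    have := congrArg norm (hc g)
    rw [(koopmanLp μ g).norm_map, norm_smul, he1, mul_one] at this
    exact this.symm
  have heig : ∀ g, koopman g e =ᵐ[μ] fun x => c g * e x := fun g => by
    have h1 := coeFn_koopmanLp μ g e
    rw [hc] at h1
    exact h1.symm.trans (Lp.coeFn_smul _ _)
  -- The function `|e|` is invariant, hence constant, and the normalization in `L²` makes it one.
  obtain ⟨r, hr⟩ := ae_eq_const_of_invariant (G := G) (μ := μ) (f := fun x => (‖e x‖ : ℂ))
    (Complex.measurable_ofReal.comp hem.norm) fun g => by
      filter_upwards [heig g] with x hx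
      simp only [koopman] at hx
      rw [hx, norm_mul, hc1, one_mul]
  have hunim : ∀ᵐ x ∂μ, ‖e x‖ = 1 := by
    have h1 : (inner ℂ e e : ℂ) = r ^ 2 := by
      rw [L2.inner_def]
      have h2 : ∀ᵐ x ∂μ, inner ℂ (e x) (e x) = r ^ 2 := by
        filter_upwards [hr] with x hx
        rw [inner_self_eq_norm_sq_to_K, ← hx]
        rfl
      rw [integral_congr_ae h2]
      simp
    rw [inner_self_eq_norm_sq_to_K, he1] at h1
    filter_upwards [hr] with x hx
    rw [← hx] at h1
    have h2 : (1 : ℝ) ^ 2 = ‖e x‖ ^ 2 := by exact_mod_cast h1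
    exact ((sq_eq_sq₀ zero_le_one (norm_nonneg _)).1 h2).symm
  have hne : ¬ e =ᵐ[μ] 0 := fun h0 => by
    have h1 : ∀ᵐ _ ∂μ, False := by
      filter_upwards [h0, hunim] with x h1 h2
      rw [h1] at h2
      simp at h2
    rw [ae_iff] at h1
    simp at h1
  obtain ⟨α, hα⟩ := exists_eigenvalue μ hc1 hne heig
  -- The vector `e` correlates with `conj f`, so `f` correlates with `conj e`, whose eigenvalue is
  -- `-α`. The value `1` on a null set makes `χ` unimodular everywhere.
  let χ : unitBall X := ⟨fun x => if ‖e x‖ = 1 then conj (e x) else 1,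
    Measurable.ite (measurableSet_eq_fun hem.norm measurable_const)
      (Complex.continuous_conj.measurable.comp hem) measurable_const, fun x => by
      by_cases hx : ‖e x‖ = 1
      · beta_reduce
        rw [if_pos hx, RCLike.norm_conj, hx]
      · beta_reduce
        rw [if_neg hx, norm_one]⟩
  have hχ : ∀ᵐ x ∂μ, χ.1 x = conj (e x) := hunim.mono fun x hx => if_pos hx
  refine ⟨χ, -α, fun x => ?_, fun g => ?_, ?_⟩
  · change ‖(if ‖e x‖ = 1 then conj (e x) else 1 : ℂ)‖ = 1
    by_cases hx : ‖e x‖ = 1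
    · rw [if_pos hx, RCLike.norm_conj, hx]
    · rw [if_neg hx, norm_one]
  · filter_upwards [hχ, (measurePreserving_vadd g μ).quasiMeasurePreserving.ae hχ, heig g]
      with x h1 h2 h3
    simp only [koopman] at h3 ⊢
    rw [h2, h1, h3, map_mul, ← hα, AddMonoidHom.neg_apply, expCircle_neg]
  · refine hle.trans (le_of_eq ?_)
    rw [← inner_conj_symm, inner_toL2_left, RCLike.norm_conj]
    congr 2
    refine integral_congr_ae ?_
    filter_upwards [hχ] with x hx
    rw [hx, unitBall.star_apply, Complex.conj_conj, Complex.conj_conj]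

end Koopman

/-- A `t`-fold iterated mean evaluates its argument on lists of length `t` only. -/
lemma iter_congr {G : Type*} (M : (G → ℂ) → ℂ) (t : ℕ) {u v : List G → ℂ}
    (h : ∀ l : List G, l.length = t → u l = v l) : iter M t u = iter M t v := by
  induction t generalizing u v with
  | zero => exact h [] rfl
  | succ t ih =>
    rw [iter, iter]
    exact congrArg M (funext fun p => ih fun l hl => h (p :: l) (by simp [hl]))

namespace StarAction

variable {G B D : Type*} [AddCommGroup G] [CommMonoid B] [StarMul B] [CommMonoid D] [StarMul D]
  {A : StarAction G B} {A' : StarAction G D}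

lemma LowMul.map {ι : B →* D} (hιT : ∀ g b, ι (A.T g b) = A'.T g (ι b)) (t : ℕ) {y : List G → B}
    (hy : A.LowMul t y) : A'.LowMul t fun l => ι (y l) := by
  induction t generalizing y with
  | zero =>
    have : y [] = 1 := hy
    change ι (y []) = 1
    rw [this, map_one]
  | succ t ih =>
    obtain ⟨b, y', hy', e⟩ := hy
    refine ⟨fun l => ι (b l), fun p l => ι (y' p l), fun p => ih (hy' p), fun p l => ?_⟩
    beta_reduce
    rw [e, map_mul, hιT]

/-- Averages of derivatives twisted by a character are nonnegative. -/
lemma IsState.mean_phase_nonneg {J : B → ℂ} (hJ : A.IsState J) {M : (G → ℂ) → ℂ}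
    (hM : IsInvMean M) (β : G →+ UnitAddCircle) (a : B) :
    0 ≤ (M fun k => expCircle (-β k) * J (A.diff k a)).re := by
  -- Since `β` is a homomorphism, the twisted kernel depends on `q - p` only, and its nonnegative
  -- double mean reduces to the single mean.
  have h1 := (hJ.psd.comp fun p : G => A.T p (star a)).mul_conj fun p => expCircle (-β p)
  have h2 := (h1.mean_mean_nonneg hM.toIsMean (C := 1) (fun i => by
    simp only [norm_mul, RCLike.norm_conj, norm_expCircle, one_mul]
    exact hJ.norm_le _) id).1
  have h3 : ∀ p q : G, conj (expCircle (-β p)) * expCircle (-β q)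
      * J (star (A.T p (star a)) * A.T q (star a))
      = expCircle (-β (q + -p)) * J (A.diff (q + -p) a) := fun p q => by
    rw [← A.map_star, star_star, hJ.apply_T_mul_T, ← expCircle_neg, ← expCircle_add, diff,
      sub_eq_add_neg q p]
    congr 2
    rw [AddMonoidHom.map_add, AddMonoidHom.map_neg]
    abel
  simp only [id, h3] at h2
  have h4 : ∀ p : G, (M fun q => expCircle (-β (q + -p)) * J (A.diff (q + -p) a))
      = M fun k => expCircle (-β k) * J (A.diff k a) := fun p =>
    hM.shift (-p) (bdd_phase hJ β fun k => A.diff k a)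
  simp only [h4] at h2
  rwa [hM.const] at h2

end StarAction

/-! ### Lowering the order of the seminorm -/

section Descent

variable {G X : Type*} [AddCommGroup G] [MeasurableSpace G] [MeasurableSpace X]
  [AddAction G X] [MeasurableVAdd₂ G X] (μ : Measure X) [IsProbabilityMeasure μ]
  [ErgodicVAdd G X μ] {M : (G → ℂ) → ℂ} (hM : IsInvMean M)

include hM

/-- Apply `gowers_one` to `h · conj χ`: the derivative of `conj χ` in direction `k` is the constant
`e(α k)`. -/
lemma sq_norm_integral_eq_mean (h χ : unitBall X) {α : G →+ UnitAddCircle}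
    (hχ : ∀ x, ‖χ.1 x‖ = 1) (hα : HasEigenvalue μ α χ.1) :
    ((‖∫ x, h.1 x * conj (χ.1 x) ∂μ‖ ^ 2 : ℝ) : ℂ)
      = M fun k => expCircle (α k) * integralState μ ((koopmanAction G X).diff k h) := by
  have h1 := gowers_one μ hM (h * star χ)
  refine h1.symm.trans (congrArg M (funext fun k => ?_))
  change ∫ x, _ ∂μ = _ * ∫ x, _ ∂μ
  rw [← integral_const_mul]
  refine integral_congr_ae ?_
  filter_upwards [hα k] with x hx
  simp only [coe_diff, multDeriv, koopman, unitBall.mul_apply, unitBall.star_apply, map_mul,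
    Complex.conj_conj] at hx ⊢
  rw [hx]
  have h2 : conj (χ.1 x) * χ.1 x = 1 := by rw [Complex.conj_mul', hχ]; simp
  linear_combination (h.1 x * conj (h.1 (k +ᵥ x)) * expCircle (α k)) * h2

/-- If the integrals against `F` are given by a state on a larger monoid which only detects trivial
eigenvalues, then the seminorm of `F` of some order controls the seminorm of the next order. -/
theorem gowers_descent {D : Type*} [CommMonoid D] [StarMul D] {A : StarAction G D} {J : D → ℂ}
    (hJ : A.IsState J) {ι : unitBall X →* D}
    (hιT : ∀ g b, ι ((koopmanAction G X).T g b) = A.T g (ι b)) {P : D} {F : unitBall X}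
    (hF : ∀ w : unitBall X, ∫ x, w.1 x * F.1 x ∂μ = J (P * ι w))
    {R : D → ℝ → (G →+ UnitAddCircle) → Prop}
    (hR : ∀ d r α, R d r α → ‖J d‖ ≤ r ∧ (α ≠ 0 → J d = 0))
    (hRT : ∀ g d r α, R d r α → R (A.T g d) r α)
    (hRm : ∀ d r α d' r' α', R d r α → R d' r' α' → R (star d * d') (r * r') (α' - α))
    (hRP : ∀ (c : ℂ) (hc : ‖c‖ ≤ 1) (χ : unitBall X) α, (∀ x, ‖χ.1 x‖ = 1) →
      HasEigenvalue μ α χ.1 → R (P * ι (unitBall.const c hc * χ)) ‖c‖ α)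
    (t : ℕ) (h : 0 < ((koopmanAction G X).gowers M (integralState μ) (t + 2) F).re) :
    0 < ((koopmanAction G X).gowers M (integralState μ) (t + 1) F).re := by
  classical
  have hS := isState_integralState (G := G) μ
  choose χ α hχ hα hle using fun l : List G =>
    exists_eigenfunction_of_gowers_two μ hM ((koopmanAction G X).diffs l F)
  let I : List G → ℂ := fun l => ∫ x, ((koopmanAction G X).diffs l F).1 x * conj ((χ l).1 x) ∂μ
  have hI : ∀ l, ‖I l‖ ≤ 1 := fun l => hS.norm_le ((koopmanAction G X).diffs l F * star (χ l))
  have hc : ∀ l, ‖conj (I l)‖ ≤ 1 := fun l => by rw [RCLike.norm_conj]; exact hI l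
  have hII : ∀ l, |‖I l‖ ^ 2| ≤ 1 := fun l => by
    rw [abs_pow, abs_norm]
    exact pow_le_one₀ (norm_nonneg _) (hI l)
  obtain ⟨y, hy, hyd⟩ := (koopmanAction G X).exists_lowMul_diffs t F
  -- The weight `conj (I l)` makes the pairing equal to `|I l|²`, so nothing cancels in the mean.
  let x : List G → D := fun l => P * ι (unitBall.const (conj (I l)) (hc l) * star (χ l))
  have hb2 : ∀ a : unitBall X, ‖(koopmanAction G X).gowers M (integralState μ) 2 a‖ ≤ 1 :=
    (hS.gowers hM.toIsMean 2).norm_le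
  have h1 : 0 < riter M t fun l => ‖I l‖ ^ 2 := by
    rw [StarAction.gowers_succ_eq, StarAction.gowers_succ_eq, StarAction.gowers_eq_iter] at h
    have h0 := hM.re_iter_eq t (C := 1) fun l => hb2 ((koopmanAction G X).diffs l F)
    exact (h.trans_eq h0).trans_le (hM.riter_mono t (C := 1) (D := 1)
      (fun l => (Complex.abs_re_le_norm _).trans (hb2 _)) hII hle)
  -- Since `diffs l F = F * y l`, the correlation with `χ l` is an integral against `F`, which `hF`
  -- converts into a value of the state.
  have h2 : (iter M t fun l => J (ι (y l) * x l)) = iter M t fun l => ((‖I l‖ ^ 2 : ℝ) : ℂ) := by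
    refine iter_congr M t fun l hl => ?_
    have h3 : ι (y l) * x l
        = P * ι (y l * (unitBall.const (conj (I l)) (hc l) * star (χ l))) := by
      rw [map_mul, mul_left_comm]
    have h4 : ((‖I l‖ ^ 2 : ℝ) : ℂ) = conj (I l) * I l := by rw [Complex.conj_mul']; push_cast; rfl
    rw [h3, ← hF, h4, ← integral_const_mul]
    refine integral_congr_ae (Eventually.of_forall fun z => ?_)
    simp only [hyd l hl, unitBall.mul_apply, unitBall.star_apply, unitBall.const]
    ring
  have h3 : 0 < A.doubled M J t x := by
    refine lt_of_lt_of_le (pow_pos ?_ (2 ^ t)) (hJ.norm_iter_pow_le_doubled hM.toIsMean t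
      (hy.map hιT t))
    rw [h2]
    refine h1.trans_le ((le_of_eq ?_).trans (Complex.re_le_norm _))
    rw [hM.re_iter_eq t (C := 1) fun l => by simpa using hII l]
    simp only [Complex.ofReal_re]
  -- The state annihilates non-trivial phases, so a positive doubled quantity forces `-α` to agree
  -- with a low-rank `β` on a set of positive weight. The error is half of that quantity.
  obtain ⟨β, hβ, hd⟩ := hJ.exists_lowRank_of_doubled hM.toIsMean (R := R)
    (fun d r α hd => by
      split_ifs with h0
      · exact (hR d r α hd).1
      · rw [(hR d r α hd).2 h0, norm_zero]) hRT hRm t (x := x) (θ := fun l => ‖I l‖)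
    (α := fun l => -α l)
    (fun l => ⟨norm_nonneg _, hI l⟩) (fun l _ => by
      have h4 := hRP (conj (I l)) (hc l) (star (χ l)) (-α l)
        (fun z => by rw [unitBall.star_apply, RCLike.norm_conj, hχ]) fun g => by
          filter_upwards [hα l g] with z hz
          simp only [koopman, unitBall.star_apply] at hz ⊢
          rw [hz, map_mul, AddMonoidHom.neg_apply, expCircle_neg]
      rwa [RCLike.norm_conj] at h4) (half_pos h3)
  have h5 : 0 < riter M t fun l => if -α l = β l then ‖I l‖ else 0 := by linarith
  have hite : ∀ l, |if -α l = β l then ‖I l‖ else 0| ≤ 1 := fun l => by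
    split_ifs
    · rw [abs_norm]
      exact hI l
    · simp
  have h6 := (pow_pos h5 2).trans_le (hM.sq_riter_le t hite)
  have hph : ∀ l, ‖M fun k => expCircle (-β l k) * integralState μ
      ((koopmanAction G X).diff k ((koopmanAction G X).diffs l F))‖ ≤ 1 := fun l =>
    StarAction.norm_mean_phase_le hS hM.toIsMean (β l) _
  -- Where `-α l = β l`, `|I l|²` is exactly the mean twisted by `β l`. Elsewhere that mean is
  -- nonnegative, so the indicator can be dropped.
  have h7 : (riter M t fun l => (if -α l = β l then ‖I l‖ else 0) ^ 2) ≤ riter M t fun l =>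
      (M fun k => expCircle (-β l k) * integralState μ
        ((koopmanAction G X).diff k ((koopmanAction G X).diffs l F))).re := by
    refine hM.riter_mono t (C := 1) (D := 1) (fun l => ?_)
      (fun l => (Complex.abs_re_le_norm _).trans (hph l)) fun l => ?_
    · rw [abs_pow]
      exact pow_le_one₀ (abs_nonneg _) (hite l)
    · split_ifs with hab
      · have h8 := sq_norm_integral_eq_mean μ hM ((koopmanAction G X).diffs l F) (χ l) (hχ l) (hα l)
        simp only [← hab, AddMonoidHom.neg_apply, neg_neg]
        rw [← h8, Complex.ofReal_re]
      · rw [zero_pow two_ne_zero]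
        exact hS.mean_phase_nonneg hM (β l) _
  rw [← hM.re_iter_eq t hph] at h7
  have h8 := h6.trans_le (h7.trans (Complex.re_le_norm _))
  exact (pow_pos h8 (2 ^ t)).trans_le (hS.norm_iter_phase_pow_le hM t hβ F)

end Descent

lemma norm_integral_le_one {Ω : Type*} [MeasurableSpace Ω] {ν : Measure Ω} [IsProbabilityMeasure ν]
    {u : Ω → ℂ} (h : ∀ ω, ‖u ω‖ ≤ 1) : ‖∫ ω, u ω ∂ν‖ ≤ 1 :=
  (norm_integral_le_of_norm_le_const (Eventually.of_forall h)).trans (by simp)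

/-- The exceptional null set may depend on `n`, whereas an average is evaluated at a fixed `x`;
Fubini exchanges the quantifiers. -/
lemma ae_ae_swap {G X : Type*} [MeasurableSpace G] [MeasurableSpace X] {μ : Measure X} [SFinite μ]
    {ρ : Measure G} [SFinite ρ] {p : G → X → Prop} (hp : MeasurableSet {q : G × X | p q.1 q.2})
    (h : ∀ n, ∀ᵐ x ∂μ, p n x) : ∀ᵐ x ∂μ, ∀ᵐ n ∂ρ, p n x :=
  (Measure.ae_ae_comm hp).1 (Eventually.of_forall h)

/-! ### Multiple averages and dual functions -/

section Averages

variable {G X : Type*} [AddCommGroup G] [MeasurableSpace G] [MeasurableSpace X]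

/-- The measure `m` restricted to `A` and normalized. -/
def normalized (m : Measure G) (A : Set G) : Measure G := (m.restrict A Set.univ)⁻¹ • m.restrict A

lemma IsFolnerSeq.isProbabilityMeasure_normalized {m : Measure G} {Φ : ℕ → Set G}
    (hΦ : IsFolnerSeq m Φ) (N : ℕ) : IsProbabilityMeasure (normalized m (Φ N)) := by
  refine ⟨?_⟩
  rw [normalized, Measure.smul_apply, Measure.restrict_apply_univ, smul_eq_mul]
  exact ENNReal.inv_mul_cancel (hΦ.measure_pos N).ne' (hΦ.measure_lt_top N).ne

omit [AddCommGroup G] in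
lemma ae_normalized {m : Measure G} {A : Set G} {p : G → Prop} (h : ∀ᵐ n ∂m, p n) :
    ∀ᵐ n ∂normalized m A, p n := Measure.ae_smul_measure (ae_restrict_of_ae h) _

omit [AddCommGroup G] [MeasurableSpace X] in
lemma multipleAverage_apply [VAdd G X] {ℓ : ℕ} (m : Measure G) (A : Set G)
    (a : Fin ℓ → G → G) (f : Fin ℓ → X → ℂ)
    (x : X) : multipleAverage m A a f x = ∫ n, ∏ j, f j (a j n +ᵥ x) ∂normalized m A := rfl

variable [AddAction G X] [MeasurableVAdd₂ G X] {ℓ : ℕ} {a : Fin ℓ → G → G}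
  (ha : ∀ j, Measurable (a j))

include ha in
lemma measurable_factor (j : Fin ℓ) {f : X → ℂ} (hf : Measurable f) :
    Measurable fun p : X × G => f (a j p.2 +ᵥ p.1) :=
  hf.comp (((ha j).comp measurable_snd).vadd measurable_fst)

include ha in
lemma measurable_prod_factor (s : Finset (Fin ℓ)) (f : Fin ℓ → unitBall X) :
    Measurable fun p : X × G => ∏ j ∈ s, (f j).1 (a j p.2 +ᵥ p.1) :=
  Finset.measurable_prod s fun j _ => measurable_factor ha j (f j).2.1

lemma norm_prod_le (s : Finset (Fin ℓ)) (f : Fin ℓ → unitBall X) (y : Fin ℓ → X) :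
    ‖∏ j ∈ s, (f j).1 (y j)‖ ≤ 1 := by
  rw [norm_prod]
  exact Finset.prod_le_one (fun _ _ => norm_nonneg _) fun j _ => (f j).2.2 _

variable (m : Measure G) (A : Set G) [IsProbabilityMeasure (normalized m A)]

include ha in
lemma integrable_prod_factor (f : Fin ℓ → unitBall X) (x : X) :
    Integrable (fun n => ∏ j, (f j).1 (a j n +ᵥ x)) (normalized m A) :=
  Integrable.of_bound ((measurable_prod_factor ha Finset.univ f).comp
    measurable_prodMk_left).aestronglyMeasurable 1
    (Eventually.of_forall fun n => norm_prod_le _ f fun j => a j n +ᵥ x)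

/-- Multiple averages of functions in the unit ball. -/
def averageBall (f : Fin ℓ → unitBall X) : unitBall X :=
  ⟨multipleAverage m A a fun j => (f j).1,
    (((measurable_prod_factor ha Finset.univ f).stronglyMeasurable).integral_prod_right
      (ν := normalized m A)).measurable, fun x =>
    norm_integral_le_one (ν := normalized m A) fun n => norm_prod_le _ f fun j => a j n +ᵥ x⟩

lemma averageBall_apply (f : Fin ℓ → unitBall X) (x : X) :
    (averageBall ha m A f).1 x = ∫ n, ∏ j, (f j).1 (a j n +ᵥ x) ∂normalized m A := rfl

omit [MeasurableSpace G] [AddAction G X] [AddCommGroup G] [MeasurableVAdd₂ G X] in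
lemma prod_update (f : Fin ℓ → unitBall X) (l : Fin ℓ) (u : unitBall X) (y : Fin ℓ → X) :
    ∏ j, (Function.update f l u j).1 (y j)
      = u.1 (y l) * ∏ j ∈ Finset.univ.erase l, (f j).1 (y j) := by
  rw [← Finset.mul_prod_erase _ _ (Finset.mem_univ l), Function.update_self]
  congr 1
  exact Finset.prod_congr rfl fun j hj => by rw [Function.update_of_ne (Finset.ne_of_mem_erase hj)]

/-- Multiple averages are linear in each function. -/
lemma averageBall_update_add (f : Fin ℓ → unitBall X) (l : Fin ℓ) {u v w : unitBall X} {c d : ℂ}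
    (h : ∀ x, w.1 x = c * u.1 x + d * v.1 x) (x : X) :
    (averageBall ha m A (Function.update f l w)).1 x
      = c * (averageBall ha m A (Function.update f l u)).1 x
        + d * (averageBall ha m A (Function.update f l v)).1 x := by
  simp only [averageBall_apply]
  rw [← integral_const_mul, ← integral_const_mul, ← integral_add
    ((integrable_prod_factor ha m A _ x).const_mul _)
    ((integrable_prod_factor ha m A _ x).const_mul _)]
  refine integral_congr_ae (Eventually.of_forall fun n => ?_)
  have h1 := fun u => prod_update f l u fun j => a j n +ᵥ x
  simp only [h1, h]
  ring

variable (μ : Measure X) [IsProbabilityMeasure μ]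

include ha in
lemma multipleAverage_congr_ae [VAddInvariantMeasure G X μ] {f f' : Fin ℓ → X → ℂ}
    (h : ∀ j, f j =ᵐ[μ] f' j) : multipleAverage m A a f =ᵐ[μ] multipleAverage m A a f' := by
  have h1 : ∀ j, ∀ᵐ x ∂μ, ∀ᵐ n ∂normalized m A,
      a j n +ᵥ x ∉ toMeasurable μ {x | f j x ≠ f' j x} := fun j => by
    refine ae_ae_swap (p := fun n x => a j n +ᵥ x ∉ toMeasurable μ {x | f j x ≠ f' j x})
      ?_ fun n => ?_
    · exact (((ha j).comp measurable_fst).vadd measurable_snd)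
        (measurableSet_toMeasurable μ _).compl
    · refine (measurePreserving_vadd (a j n) μ).quasiMeasurePreserving.ae
        (p := fun x => x ∉ toMeasurable μ {x | f j x ≠ f' j x}) ?_
      refine measure_eq_zero_iff_ae_notMem.1 ?_
      rw [measure_toMeasurable]
      exact h j
  filter_upwards [eventually_all.2 h1] with x hx
  simp only [multipleAverage_apply]
  refine integral_congr_ae ?_
  filter_upwards [eventually_all.2 hx] with n hn
  refine Finset.prod_congr rfl fun j _ => ?_
  by_contra hne
  exact hn j (subset_toMeasurable μ _ hne)

lemma integral_mul_averageBall (g : unitBall X) (f : Fin ℓ → unitBall X) :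
    ∫ x, g.1 x * (averageBall ha m A f).1 x ∂μ
      = ∫ p, g.1 p.1 * ∏ j, (f j).1 (a j p.2 +ᵥ p.1) ∂μ.prod (normalized m A) := by
  rw [integral_prod]
  · refine integral_congr_ae (Eventually.of_forall fun x => ?_)
    simp only [averageBall_apply]
    rw [integral_const_mul]
  · refine Integrable.of_bound ((g.2.1.comp measurable_fst).mul
      (measurable_prod_factor ha Finset.univ f)).aestronglyMeasurable 1
      (Eventually.of_forall fun p => ?_)
    rw [norm_mul]
    exact mul_le_one₀ (g.2.2 _) (norm_nonneg _) (norm_prod_le _ f fun j => a j p.2 +ᵥ p.1)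

/-- Integrals of one function of a multiple average are correlations with a dual function. -/
lemma exists_dual_function [MeasurableNeg G] [VAddInvariantMeasure G X μ] (g : unitBall X)
    (f : Fin ℓ → unitBall X) (l : Fin ℓ) : ∃ F : unitBall X, ∀ w : unitBall X, ∫ x, w.1 x * F.1 x ∂μ
      = ∫ x, g.1 x * (averageBall ha m A (Function.update f l w)).1 x ∂μ := by
  -- `Q` collects all factors except the one of index `l`. Translating `x` by `-a_l(n)` frees `w` of
  -- the dependence on `n`, and averaging the translated `Q` gives the dual function.
  let Q : X × G → ℂ := fun p => g.1 p.1 * ∏ j ∈ Finset.univ.erase l, (f j).1 (a j p.2 +ᵥ p.1)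
  have hQ : Measurable Q := (g.2.1.comp measurable_fst).mul (measurable_prod_factor ha _ f)
  have hQb : ∀ p, ‖Q p‖ ≤ 1 := fun p => by
    rw [norm_mul]
    exact mul_le_one₀ (g.2.2 _) (norm_nonneg _) (norm_prod_le _ f fun j => a j p.2 +ᵥ p.1)
  have hs : Measurable fun p : X × G => (-a l p.2 +ᵥ p.1, p.2) :=
    ((((ha l).comp measurable_snd).neg).vadd measurable_fst).prodMk measurable_snd
  have hs' : Measurable fun p : X × G => (a l p.2 +ᵥ p.1, p.2) :=
    (((ha l).comp measurable_snd).vadd measurable_fst).prodMk measurable_snd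
  refine ⟨⟨fun x => ∫ n, Q (-a l n +ᵥ x, n) ∂normalized m A,
    ((hQ.comp hs).stronglyMeasurable.integral_prod_right
      (f := fun x n => Q (-a l n +ᵥ x, n)) (ν := normalized m A)).measurable,
    fun x => norm_integral_le_one fun n => hQb _⟩, fun w => ?_⟩
  have hi1 : Integrable (fun p : X × G => w.1 p.1 * Q (-a l p.2 +ᵥ p.1, p.2))
      (μ.prod (normalized m A)) :=
    Integrable.of_bound ((w.2.1.comp measurable_fst).mul (hQ.comp hs)).aestronglyMeasurable 1
      (Eventually.of_forall fun p => by
        rw [norm_mul]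
        exact mul_le_one₀ (w.2.2 _) (norm_nonneg _) (hQb _))
  have hi2 : Integrable (fun p : X × G => w.1 (a l p.2 +ᵥ p.1) * Q p) (μ.prod (normalized m A)) :=
    Integrable.of_bound ((measurable_factor ha l w.2.1).mul hQ).aestronglyMeasurable 1
      (Eventually.of_forall fun p => by
        rw [norm_mul]
        exact mul_le_one₀ (w.2.2 _) (norm_nonneg _) (hQb _))
  calc ∫ x, w.1 x * ∫ n, Q (-a l n +ᵥ x, n) ∂normalized m A ∂μ
      = ∫ x, ∫ n, w.1 x * Q (-a l n +ᵥ x, n) ∂normalized m A ∂μ := by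
        simp only [integral_const_mul]
    _ = ∫ n, ∫ x, w.1 x * Q (-a l n +ᵥ x, n) ∂μ ∂normalized m A := integral_integral_swap hi1
    _ = ∫ n, ∫ x, w.1 (a l n +ᵥ x) * Q (x, n) ∂μ ∂normalized m A := by
        congr 1
        funext n
        rw [← (measurePreserving_vadd (a l n) μ).integral_comp
          (measurableEmbedding_const_vadd (a l n))]
        simp only [neg_vadd_vadd]
    _ = ∫ x, ∫ n, w.1 (a l n +ᵥ x) * Q (x, n) ∂normalized m A ∂μ :=
        (integral_integral_swap hi2).symm
    _ = _ := by
        refine integral_congr_ae (Eventually.of_forall fun x => ?_)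
        simp only [averageBall_apply]
        rw [← integral_const_mul]
        refine integral_congr_ae (Eventually.of_forall fun n => ?_)
        simp only [Q]
        rw [prod_update]
        ring

end Averages

/-! ### Stability of eigenfunctions -/

section Eigenfunctions

variable {G X : Type*} [AddCommGroup G] [MeasurableSpace X] {μ : Measure X} [AddAction G X]

lemma HasEigenvalue.conj_mul {α β : G →+ UnitAddCircle} {f h : X → ℂ} (hf : HasEigenvalue μ α f)
    (hh : HasEigenvalue μ β h) : HasEigenvalue μ (β - α) fun x => conj (f x) * h x := fun g => by
  filter_upwards [hf g, hh g] with x h1 h2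
  simp only [koopman] at h1 h2 ⊢
  rw [h1, h2, sub_eq_neg_add, AddMonoidHom.add_apply, AddMonoidHom.neg_apply, expCircle_add,
    expCircle_neg, map_mul]
  ring

variable [MeasurableSpace G] [MeasurableVAdd G X] [VAddInvariantMeasure G X μ]

lemma HasEigenvalue.vadd {α : G →+ UnitAddCircle} {f : X → ℂ} (hf : HasEigenvalue μ α f) (k : G) :
    HasEigenvalue μ α fun x => f (k +ᵥ x) := fun g => by
  filter_upwards [(measurePreserving_vadd k μ).quasiMeasurePreserving.ae (hf g)] with x hx
  simp only [koopman] at hx ⊢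
  rw [← hx, vadd_comm]

lemma koopmanAction_mem_unimodular [MeasurableVAdd₂ G X] {f : unitBall X}
    (hf : f.1 ∈ unimodularEigenfunctions G μ) (g : G) :
    ((koopmanAction G X).T g f).1 ∈ unimodularEigenfunctions G μ := by
  obtain ⟨h1, h2, α, hα⟩ := hf
  exact ⟨h1.comp_measurePreserving (measurePreserving_vadd g μ),
    (measurePreserving_vadd g μ).quasiMeasurePreserving.ae h2, α, hα.vadd g⟩

omit [MeasurableSpace G] [MeasurableVAdd G X] [VAddInvariantMeasure G X μ] in
lemma star_mul_mem_unimodular [IsFiniteMeasure μ] {f h : unitBall X}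
    (hf : f.1 ∈ unimodularEigenfunctions G μ) (hh : h.1 ∈ unimodularEigenfunctions G μ) :
    (star f * h).1 ∈ unimodularEigenfunctions G μ := by
  obtain ⟨-, h2, α, hα⟩ := hf
  obtain ⟨-, h2', α', hα'⟩ := hh
  refine ⟨unitBall.memLp _ _ _, ?_, α' - α, hα.conj_mul hα'⟩
  filter_upwards [h2, h2'] with x hx hx'
  rw [unitBall.mul_apply, unitBall.star_apply, norm_mul, RCLike.norm_conj, hx, hx', one_mul]

omit [MeasurableSpace G] [MeasurableVAdd G X] [VAddInvariantMeasure G X μ] in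
lemma one_mem_unimodular [IsFiniteMeasure μ] :
    (1 : unitBall X).1 ∈ unimodularEigenfunctions G μ :=
  ⟨unitBall.memLp _ _ _, Eventually.of_forall fun x => by simp, 0, fun g =>
    Eventually.of_forall fun x => by simp [koopman, expCircle_zero]⟩

end Eigenfunctions

/-- The `L²` norm dominates the `L¹` norm, and the bound is uniform over the unit ball; so the test
function may vary with `N`. -/
lemma tendsto_integral_mul_sub {X : Type*} [MeasurableSpace X] {μ : Measure X}
    [IsProbabilityMeasure μ] {u : ℕ → unitBall X} {c : ℂ}
    (h : TendstoInL2 μ (fun N => (u N).1) fun _ => c) (g : ℕ → unitBall X) :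
    Tendsto (fun N => ∫ x, (g N).1 x * (u N).1 x ∂μ - (∫ x, (g N).1 x ∂μ) * c) atTop (𝓝 0) := by
  have hm : ∀ N, MemLp (fun x => (u N).1 x - c) 2 μ := fun N =>
    (unitBall.memLp (u N) 2 μ).sub (memLp_const c)
  have h1 := (ENNReal.tendsto_toReal (a := 0) (by simp)).comp h
  refine squeeze_zero_norm (fun N => ?_) h1
  have h2 : ∫ x, (g N).1 x * (u N).1 x ∂μ - (∫ x, (g N).1 x ∂μ) * c
      = ∫ x, (g N).1 x * ((u N).1 x - c) ∂μ := by
    have h3 : Integrable (fun x => (g N).1 x * (u N).1 x) μ := unitBall.integrable (g N * u N) μ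
    rw [← integral_mul_const, ← integral_sub h3 ((unitBall.integrable (g N) μ).mul_const c)]
    simp only [mul_sub]
  have hi : Integrable (fun x => (u N).1 x - c) μ := (hm N).integrable one_le_two
  rw [h2, Function.comp_apply]
  calc ‖∫ x, (g N).1 x * ((u N).1 x - c) ∂μ‖ ≤ ∫ x, ‖(u N).1 x - c‖ ∂μ := by
        refine norm_integral_le_of_norm_le hi.norm (Eventually.of_forall fun x => ?_)
        rw [norm_mul]
        exact mul_le_of_le_one_left (norm_nonneg _) ((g N).2.2 x)
    _ = (eLpNorm (fun x => (u N).1 x - c) 1 μ).toReal := by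
        rw [eLpNorm_one_eq_lintegral_enorm, integral_norm_eq_lintegral_enorm hi.1]
    _ ≤ _ := ENNReal.toReal_mono (hm N).2.ne
        (eLpNorm_le_eLpNorm_of_exponent_le one_le_two hi.1)

/-! ### Limiting correlations as a state -/

section JointState

variable {G X : Type*} [AddCommGroup G] [MeasurableSpace G] [MeasurableSpace X]
  [AddAction G X] [MeasurableVAdd₂ G X] {ℓ : ℕ}

variable (G X ℓ) in
/-- The componentwise action on sequences and tuples of functions in the unit ball. -/
def jointAction : StarAction G ((ℕ → unitBall X) × (Fin ℓ → unitBall X)) where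
  T g :=
    { toFun := fun d => (fun N => (koopmanAction G X).T g (d.1 N),
        fun j => (koopmanAction G X).T g (d.2 j))
      map_one' := rfl
      map_mul' := fun _ _ => rfl }
  map_zero _ := Prod.ext (funext fun _ => (koopmanAction G X).map_zero _)
    (funext fun _ => (koopmanAction G X).map_zero _)
  map_add _ _ _ := Prod.ext (funext fun _ => (koopmanAction G X).map_add _ _ _)
    (funext fun _ => (koopmanAction G X).map_add _ _ _)
  map_star _ _ := rfl

variable {a : Fin ℓ → G → G} (ha : ∀ j, Measurable (a j)) (m : Measure G) (Φ : ℕ → Set G)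
  [∀ N, IsProbabilityMeasure (normalized m (Φ N))] (μ : Measure X) [IsProbabilityMeasure μ]
  (U : Ultrafilter ℕ)

/-- The limiting correlation of a sequence of functions with the multiple averages. -/
def jointState (d : (ℕ → unitBall X) × (Fin ℓ → unitBall X)) : ℂ :=
  ulim U fun N => ∫ x, (d.1 N).1 x * (averageBall ha m (Φ N) d.2).1 x ∂μ

lemma bdd_integral_mul (g h : ℕ → unitBall X) :
    Bdd fun N => ∫ x, (g N).1 x * (h N).1 x ∂μ :=
  ⟨1, fun N => norm_integral_le_one fun x => (g N * h N).2.2 x⟩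

-- On `X × G` with the product of `μ` and the normalized measure, the integrand is multiplicative in
-- `d`, so this is a kernel as in `isPSD_integral`.
omit U in
lemma isPSD_integral_mul_averageBall (N : ℕ) :
    IsPSD fun d d' : (ℕ → unitBall X) × (Fin ℓ → unitBall X) =>
      ∫ x, ((star d * d').1 N).1 x * (averageBall ha m (Φ N) (star d * d').2).1 x ∂μ := by
  have h := isPSD_integral (μ.prod (normalized m (Φ N)))
    (e := fun (d : (ℕ → unitBall X) × (Fin ℓ → unitBall X)) (p : X × G) =>
      (d.1 N).1 p.1 * ∏ j, (d.2 j).1 (a j p.2 +ᵥ p.1))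
    (fun d => ((d.1 N).2.1.comp measurable_fst).mul
      (measurable_prod_factor ha Finset.univ d.2)) fun d p => by
      rw [norm_mul]
      exact mul_le_one₀ ((d.1 N).2.2 _) (norm_nonneg _)
        (norm_prod_le _ d.2 fun j => a j p.2 +ᵥ p.1)
  have e1 : ∀ (d d' : (ℕ → unitBall X) × (Fin ℓ → unitBall X)) (p : X × G),
      ((star d * d').1 N).1 p.1 * ∏ j, ((star d * d').2 j).1 (a j p.2 +ᵥ p.1)
        = conj ((d.1 N).1 p.1 * ∏ j, (d.2 j).1 (a j p.2 +ᵥ p.1))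
          * ((d'.1 N).1 p.1 * ∏ j, (d'.2 j).1 (a j p.2 +ᵥ p.1)) := fun d d' p => by
    rw [map_mul, map_prod, mul_mul_mul_comm, ← Finset.prod_mul_distrib]
    rfl
  simp only [integral_mul_averageBall, e1]
  exact h

lemma isState_jointState [VAddInvariantMeasure G X μ] :
    (jointAction G X ℓ).IsState (jointState ha m Φ μ U) where
  psd := IsPSD.mean (isMean_ulim U) (fun N => isPSD_integral_mul_averageBall ha m Φ μ N)
    fun d d' => bdd_integral_mul μ (star d * d').1 fun N => averageBall ha m (Φ N) (star d * d').2
  inv g d := by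
    refine congrArg (ulim U) (funext fun N => ?_)
    rw [← (measurePreserving_vadd g μ).integral_comp (measurableEmbedding_const_vadd g)
      (fun x => (d.1 N).1 x * (averageBall ha m (Φ N) d.2).1 x)]
    refine integral_congr_ae (Eventually.of_forall fun x => ?_)
    simp only [averageBall_apply, vadd_comm _ g x]
    rfl
  norm_le d := (isMean_ulim U).norm_le fun N =>
    norm_integral_le_one fun x => (d.1 N * averageBall ha m (Φ N) d.2).2.2 x

lemma jointState_update_smul (g : ℕ → unitBall X) (f : Fin ℓ → unitBall X) (l : Fin ℓ)
    {w u : unitBall X} {c : ℂ} (h : ∀ x, w.1 x = c * u.1 x) :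
    jointState ha m Φ μ U (g, Function.update f l w)
      = c * jointState ha m Φ μ U (g, Function.update f l u) := by
  simp only [jointState]
  rw [← (isMean_ulim U).smul c (bdd_integral_mul μ _ _)]
  refine congrArg (ulim U) (funext fun N => ?_)
  rw [← integral_const_mul]
  refine integral_congr_ae (Eventually.of_forall fun x => ?_)
  beta_reduce
  rw [averageBall_update_add ha m (Φ N) f l (u := u) (v := u) (c := c) (d := 0)
    fun x => by rw [h, zero_mul, add_zero]]
  ring

variable {U}

lemma jointState_eq (hU : (U : Filter ℕ) ≤ atTop) {f : Fin ℓ → unitBall X} {c : ℂ}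
    (h : TendstoInL2 μ (fun N => (averageBall ha m (Φ N) f).1) fun _ => c) (g : ℕ → unitBall X) :
    jointState ha m Φ μ U (g, f) = (ulim U fun N => ∫ x, (g N).1 x ∂μ) * c := by
  have hb : Bdd fun N => ∫ x, (g N).1 x ∂μ := ⟨1, fun N => norm_integral_le_one (g N).2.2⟩
  have h1 := ((tendsto_integral_mul_sub h g).mono_left hU).add ((tendsto_ulim U hb).mul_const c)
  simp only [sub_add_cancel, zero_add] at h1
  exact ulim_eq U h1

/-- Convergence of the multiple averages of functions whose components of index at least `l` are
unimodular eigenfunctions. -/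
def ErgodicFrom (l : ℕ) : Prop :=
  ∀ f : Fin ℓ → unitBall X, (∀ j : Fin ℓ, l ≤ j → (f j).1 ∈ unimodularEigenfunctions G μ) →
    TendstoInL2 μ (fun N => (averageBall ha m (Φ N) f).1) fun _ => ∏ j, ∫ x, (f j).1 x ∂μ

/-- The elements on which the joint state only detects trivial eigenvalues. -/
def EigenAt (l : Fin ℓ) (d : (ℕ → unitBall X) × (Fin ℓ → unitBall X)) (r : ℝ)
    (α : G →+ UnitAddCircle) : Prop :=
  (∀ j, l < j → (d.2 j).1 ∈ unimodularEigenfunctions G μ) ∧ ∃ (c : ℂ) (χ : unitBall X), ‖c‖ = r ∧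
    (∀ x, ‖χ.1 x‖ = 1) ∧ HasEigenvalue μ α χ.1 ∧ ∀ x, (d.2 l).1 x = c * χ.1 x

omit [MeasurableSpace G] [MeasurableVAdd₂ G X] in
lemma EigenAt.star_mul {l : Fin ℓ} {d d' : (ℕ → unitBall X) × (Fin ℓ → unitBall X)} {r r' : ℝ}
    {α α' : G →+ UnitAddCircle} (h : EigenAt μ l d r α) (h' : EigenAt μ l d' r' α') :
    EigenAt μ l (star d * d') (r * r') (α' - α) := by
  obtain ⟨h1, c, χ, hc, hχ, hα, e⟩ := h
  obtain ⟨h1', c', χ', hc', hχ', hα', e'⟩ := h'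
  refine ⟨fun j hj => star_mul_mem_unimodular (h1 j hj) (h1' j hj), conj c * c', star χ * χ', ?_,
    fun x => ?_, hα.conj_mul hα', fun x => ?_⟩
  · rw [norm_mul, RCLike.norm_conj, hc, hc']
  · rw [unitBall.mul_apply, unitBall.star_apply, norm_mul, RCLike.norm_conj, hχ, hχ', one_mul]
  · change conj ((d.2 l).1 x) * (d'.2 l).1 x = _ * (conj (χ.1 x) * χ'.1 x)
    rw [e, e', map_mul]
    ring

omit [IsProbabilityMeasure μ] in
lemma EigenAt.translate [VAddInvariantMeasure G X μ] {l : Fin ℓ}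
    {d : (ℕ → unitBall X) × (Fin ℓ → unitBall X)} {r : ℝ}
    {α : G →+ UnitAddCircle} (h : EigenAt μ l d r α) (g : G) :
    EigenAt μ l ((jointAction G X ℓ).T g d) r α := by
  obtain ⟨h1, c, χ, hc, hχ, hα, e⟩ := h
  exact ⟨fun j hj => koopmanAction_mem_unimodular (h1 j hj) g, c, (koopmanAction G X).T g χ, hc,
    fun x => hχ _, hα.vadd g, fun x => e _⟩

variable {μ}

/-- After the constant is pulled out, all components of index at least `l` are eigenfunctions, so
`ErgodicFrom` evaluates the state as a product containing `∫ χ`, which vanishes for a non-trivial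
eigenvalue. -/
lemma EigenAt.jointState_le [VAddInvariantMeasure G X μ] (hU : (U : Filter ℕ) ≤ atTop)
    {l : Fin ℓ} (hC : ErgodicFrom ha m Φ μ l)
    {d : (ℕ → unitBall X) × (Fin ℓ → unitBall X)} {r : ℝ} {α : G →+ UnitAddCircle}
    (h : EigenAt μ l d r α) :
    ‖jointState ha m Φ μ U d‖ ≤ r ∧ (α ≠ 0 → jointState ha m Φ μ U d = 0) := by
  obtain ⟨h1, c, χ, hc, hχ, hα, e⟩ := h
  have h2 := jointState_update_smul ha m Φ μ U d.1 d.2 l e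
  rw [Function.update_eq_self] at h2
  have h3 : jointState ha m Φ μ U d = c * jointState ha m Φ μ U (d.1, Function.update d.2 l χ) := h2
  rw [h3, norm_mul, hc]
  refine ⟨mul_le_of_le_one_right (hc ▸ norm_nonneg c)
    ((isState_jointState ha m Φ μ U).norm_le _), fun h0 => ?_⟩
  have h4 : ∀ j : Fin ℓ, (l : ℕ) ≤ j → (Function.update d.2 l χ j).1 ∈
      unimodularEigenfunctions G μ := fun j hj => by
    rcases eq_or_ne j l with rfl | hjl
    · rw [Function.update_self]
      exact ⟨unitBall.memLp _ _ _, Eventually.of_forall hχ, α, hα⟩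
    · rw [Function.update_of_ne hjl]
      exact h1 j (lt_of_le_of_ne hj hjl.symm)
  rw [jointState_eq ha m Φ μ hU (hC _ h4), Finset.prod_eq_zero (Finset.mem_univ l), mul_zero,
    mul_zero]
  rw [Function.update_self]
  exact hα.integral_eq_zero h0

end JointState

/-! ### Convergence in L² -/

section Convergence

variable {X : Type*} [MeasurableSpace X] {μ : Measure X} [IsProbabilityMeasure μ]

omit [IsProbabilityMeasure μ] in
lemma TendstoInL2.add_smul {u v : ℕ → unitBall X} {W : ℕ → X → ℂ} {p q c d : ℂ}
    (hu : TendstoInL2 μ (fun N => (u N).1) fun _ => p)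
    (hv : TendstoInL2 μ (fun N => (v N).1) fun _ => q)
    (hW : ∀ N, W N =ᵐ[μ] fun x => c * (u N).1 x + d * (v N).1 x) :
    TendstoInL2 μ W fun _ => c * p + d * q := by
  have hum : ∀ N, AEStronglyMeasurable (fun x => (u N).1 x - p) μ := fun N =>
    ((u N).2.1.sub measurable_const).aestronglyMeasurable
  have hvm : ∀ N, AEStronglyMeasurable (fun x => (v N).1 x - q) μ := fun N =>
    ((v N).2.1.sub measurable_const).aestronglyMeasurable
  have h1 : Tendsto (fun N => ‖c‖ₑ * eLpNorm (fun x => (u N).1 x - p) 2 μ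
      + ‖d‖ₑ * eLpNorm (fun x => (v N).1 x - q) 2 μ) atTop (𝓝 0) := by
    have h2 := (ENNReal.Tendsto.const_mul (a := ‖c‖ₑ) hu (Or.inr enorm_ne_top)).add
      (ENNReal.Tendsto.const_mul (a := ‖d‖ₑ) hv (Or.inr enorm_ne_top))
    simpa using h2
  refine tendsto_of_tendsto_of_tendsto_of_le_of_le tendsto_const_nhds h1 (fun _ => zero_le)
    fun N => ?_
  have h3 : (fun x => W N x - (c * p + d * q))
      =ᵐ[μ] (c • fun x => (u N).1 x - p) + (d • fun x => (v N).1 x - q) := by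
    filter_upwards [hW N] with x hx
    rw [hx]
    simp only [Pi.add_apply, Pi.smul_apply, smul_eq_mul]
    ring
  simp only
  rw [eLpNorm_congr_ae h3, ← eLpNorm_const_smul, ← eLpNorm_const_smul]
  exact eLpNorm_add_le ((hum N).const_smul c) ((hvm N).const_smul d) one_le_two

omit [IsProbabilityMeasure μ] in
lemma TendstoInL2.smul {u : ℕ → unitBall X} {W : ℕ → X → ℂ} {p c : ℂ}
    (hu : TendstoInL2 μ (fun N => (u N).1) fun _ => p)
    (hW : ∀ N, W N =ᵐ[μ] fun x => c * (u N).1 x) : TendstoInL2 μ W fun _ => c * p := by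
  have h := hu.add_smul (c := c) (d := 0) hu (W := W) fun N => by simpa using hW N
  simpa using h

/-- Convergence can be tested along ultrafilters, and `∫ conj u · u` is the squared norm. -/
lemma exists_ultrafilter_of_not_tendsto {u : ℕ → unitBall X}
    (h : ¬ TendstoInL2 μ (fun N => (u N).1) fun _ => 0) : ∃ U : Ultrafilter ℕ,
      (U : Filter ℕ) ≤ atTop ∧ (ulim U fun N => ∫ x, (star (u N)).1 x * (u N).1 x ∂μ) ≠ 0 := by
  rw [TendstoInL2, tendsto_iff_ultrafilter] at h
  push Not at h
  obtain ⟨U, hU, hnot⟩ := h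
  refine ⟨U, hU, fun h0 => hnot ?_⟩
  have h1 := tendsto_ulim U (bdd_integral_mul μ (fun N => star (u N)) u)
  rw [h0] at h1
  have h2 : ∀ N, ∫ x, (star (u N)).1 x * (u N).1 x ∂μ = ((‖toL2 μ (u N)‖ ^ 2 : ℝ) : ℂ) := fun N => by
    have := inner_toL2 μ (u N) (u N)
    rw [inner_self_eq_norm_sq_to_K] at this
    push_cast
    exact this.symm
  simp only [h2] at h1
  have h3 : Tendsto (fun N => ‖toL2 μ (u N)‖ ^ 2) U (𝓝 0) := by
    have := (Complex.continuous_re.tendsto 0).comp h1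
    simpa only [Function.comp_def, Complex.ofReal_re, Complex.zero_re] using this
  have h4 : Tendsto (fun N => ‖toL2 μ (u N)‖) U (𝓝 0) := by
    have := h3.sqrt
    simpa only [Real.sqrt_zero, Real.sqrt_sq (norm_nonneg _)] using this
  have h5 := ENNReal.tendsto_ofReal h4
  rw [ENNReal.ofReal_zero] at h5
  refine h5.congr fun N => ?_
  rw [toL2, Lp.norm_toLp, ENNReal.ofReal_toReal (unitBall.memLp (u N) 2 μ).2.ne]
  simp only [sub_zero]

/-- The factor `2` keeps the mean-zero part in the unit ball. -/
lemma exists_mean_decomposition (μ : Measure X) [IsProbabilityMeasure μ] (f : unitBall X) :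
    ∃ v : unitBall X, ∫ x, v.1 x ∂μ = 0 ∧
      ∀ x, f.1 x = (∫ x, f.1 x ∂μ) * (1 : unitBall X).1 x + 2 * v.1 x := by
  have hc : ‖∫ x, f.1 x ∂μ‖ ≤ 1 := norm_integral_le_one f.2.2
  refine ⟨⟨fun x => (f.1 x - ∫ x, f.1 x ∂μ) / 2, (f.2.1.sub measurable_const).div_const 2,
    fun x => ?_⟩, ?_, fun x => ?_⟩
  · rw [norm_div, Complex.norm_ofNat, div_le_one two_pos]
    exact (norm_sub_le _ _).trans (by linarith [f.2.2 x])
  · rw [integral_div, integral_sub (unitBall.integrable f μ) (integrable_const _)]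
    simp
  · change f.1 x = (∫ x, f.1 x ∂μ) * 1 + 2 * ((f.1 x - ∫ x, f.1 x ∂μ) / 2)
    ring

end Convergence

/-! ### The inductive step -/

section Induction

variable {G X : Type*} [AddCommGroup G] [MeasurableSpace G] [MeasurableSpace X]
  [AddAction G X] [MeasurableVAdd₂ G X] {ℓ : ℕ}
  {a : Fin ℓ → G → G} (ha : ∀ j, Measurable (a j)) (m : Measure G) (Φ : ℕ → Set G)
  [∀ N, IsProbabilityMeasure (normalized m (Φ N))] {μ : Measure X} [IsProbabilityMeasure μ]
  [ErgodicVAdd G X μ]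

omit [MeasurableSpace G] [MeasurableVAdd₂ G X] [IsProbabilityMeasure μ] [ErgodicVAdd G X μ] in
lemma mem_unimodular_update {l : Fin ℓ} {f : Fin ℓ → unitBall X}
    (hf : ∀ j, l < j → (f j).1 ∈ unimodularEigenfunctions G μ) {w : unitBall X}
    (hw : w.1 ∈ unimodularEigenfunctions G μ) (j : Fin ℓ) (hj : (l : ℕ) ≤ j) :
    (Function.update f l w j).1 ∈ unimodularEigenfunctions G μ := by
  rcases eq_or_ne j l with rfl | hjl
  · rwa [Function.update_self]
  · rw [Function.update_of_ne hjl]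
    exact hf j (lt_of_le_of_ne hj hjl.symm)

variable [MeasurableAdd G] [SFinite m] [m.IsAddLeftInvariant] (hΦ : IsFolnerSeq m Φ) {s : ℕ}
  (hs : 1 ≤ s) {l : Fin ℓ} (hsem : ∀ f : Fin ℓ → unitBall X, ghkSeminorm m Φ μ s (f l).1 = 0 →
    (∀ j, l < j → (f j).1 ∈ unimodularEigenfunctions G μ) →
    TendstoInL2 μ (fun N => (averageBall ha m (Φ N) f).1) fun _ => 0)
  (hC : ErgodicFrom ha m Φ μ l)

include hΦ hs hsem hC

/-- The dual functions of the multiple averages vanish as soon as they have mean zero. -/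
theorem integral_dual_ne_zero {U : Ultrafilter ℕ} (hU : (U : Filter ℕ) ≤ atTop)
    {f : Fin ℓ → unitBall X} (hf : ∀ j, l < j → (f j).1 ∈ unimodularEigenfunctions G μ)
    (g : ℕ → unitBall X) {F : unitBall X} (hF : ∀ w : unitBall X, ∫ x, w.1 x * F.1 x ∂μ
      = jointState ha m Φ μ U (g, Function.update f l w)) {w : unitBall X}
    (hw : ∫ x, w.1 x * F.1 x ∂μ ≠ 0) : ∫ x, F.1 x ∂μ ≠ 0 := by
  obtain ⟨M, hM⟩ := exists_isInvMean G
  have hS := isState_integralState (G := G) μ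
  have hFF : ∫ x, (star F).1 x * F.1 x ∂μ ≠ 0 := fun h0 => hw <| by
    have h1 : toL2 μ F = 0 := by
      rw [← inner_self_eq_zero (𝕜 := ℂ), inner_toL2]
      exact h0
    have h2 := inner_toL2 μ (star w) F
    rw [h1, inner_zero_right] at h2
    simpa only [unitBall.star_apply, Complex.conj_conj] using h2.symm
  -- If the seminorm of `F` vanished, so would that of `conj F`. The seminorm estimate with `conj F`
  -- in position `l` would then make `∫ conj F · F` zero.
  have hg : (koopmanAction G X).gowers M (integralState μ) s F ≠ 0 := fun h0 => hFF <| by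
    have h1 : (koopmanAction G X).gowers M (integralState μ) s (star F) = 0 := by
      rw [StarAction.gowers_star hS hM.toIsMean, h0, map_zero]
    have h2 := hsem (Function.update f l (star F))
      (by rw [Function.update_self]; exact ghkSeminorm_eq_zero μ hΦ hM h1)
      fun j hj => by rw [Function.update_of_ne hj.ne']; exact hf j hj
    rw [hF, jointState_eq ha m Φ μ hU h2, mul_zero]
  obtain ⟨k, rfl⟩ : ∃ k, s = k + 1 := ⟨s - 1, by omega⟩
  have hpos : 0 < ((koopmanAction G X).gowers M (integralState μ) (k + 1) F).re := by
    obtain ⟨h1, h2⟩ := hS.gowers_succ_nonneg hM k F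
    exact lt_of_le_of_ne h1 fun h3 => hg (Complex.ext h3.symm h2)
  -- `ι` puts a function in position `l` and `1` everywhere else; the fixed data `g` and `f` are
  -- carried by `P`.
  let ι : unitBall X →* (ℕ → unitBall X) × (Fin ℓ → unitBall X) :=
    (MonoidHom.inr _ _).comp (MonoidHom.mulSingle (fun _ => unitBall X) l)
  have hP : ∀ w : unitBall X, (g, Function.update f l 1) * ι w = (g, Function.update f l w) := by
    intro w
    refine Prod.ext (mul_one _) (funext fun j => ?_)
    change Function.update f l 1 j * Pi.mulSingle (M := fun _ => unitBall X) l w j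
      = Function.update f l w j
    rcases eq_or_ne j l with rfl | hjl
    · rw [Function.update_self, Function.update_self, Pi.mulSingle_eq_same, one_mul]
    · rw [Function.update_of_ne hjl, Function.update_of_ne hjl, Pi.mulSingle_eq_of_ne hjl, mul_one]
  have hιT : ∀ (k : G) (b : unitBall X), ι ((koopmanAction G X).T k b)
      = (jointAction G X ℓ).T k (ι b) := by
    intro k b
    refine Prod.ext (funext fun N => (map_one _).symm) (funext fun j => ?_)
    change Pi.mulSingle (M := fun _ => unitBall X) l ((koopmanAction G X).T k b) j
      = (koopmanAction G X).T k (Pi.mulSingle (M := fun _ => unitBall X) l b j)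
    rcases eq_or_ne j l with rfl | hjl
    · rw [Pi.mulSingle_eq_same, Pi.mulSingle_eq_same]
    · rw [Pi.mulSingle_eq_of_ne hjl, Pi.mulSingle_eq_of_ne hjl, map_one]
  have hdesc : ∀ t, 0 < ((koopmanAction G X).gowers M (integralState μ) (t + 1) F).re →
      0 < ((koopmanAction G X).gowers M (integralState μ) 1 F).re := by
    intro t
    induction t with
    | zero => exact id
    | succ t ih =>
      refine fun h => ih (gowers_descent μ hM (isState_jointState ha m Φ μ U) hιT
        (P := (g, Function.update f l 1)) (R := EigenAt μ l) (fun w => by rw [hP, hF])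
        (fun d r α hd => EigenAt.jointState_le (l := l) ha m Φ hU hC hd)
        (fun k d r α hd => EigenAt.translate μ hd k)
        (fun d r α d' r' α' h h' => EigenAt.star_mul μ h h') ?_ t h)
      intro c hc χ α hχ hα
      rw [hP]
      refine ⟨fun j hj => ?_, c, χ, rfl, hχ, hα, fun x => ?_⟩
      · change (Function.update f l _ j).1 ∈ _
        rw [Function.update_of_ne hj.ne']
        exact hf j hj
      · change (Function.update f l _ l).1 x = _
        rw [Function.update_self]
        rfl
  have h1 := hdesc k hpos
  rw [gowers_one μ hM, Complex.ofReal_re] at h1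
  intro h2
  rw [integralState, h2] at h1
  simp at h1

variable [MeasurableNeg G]

/-- The product in the hypothesis is the integral of the dual function obtained by pairing the
averages with themselves. If they did not tend to zero, that integral would be nonzero by
`integral_dual_ne_zero`. -/
lemma tendsto_zero_of_ulim {f : Fin ℓ → unitBall X}
    (hf : ∀ j, l < j → (f j).1 ∈ unimodularEigenfunctions G μ)
    (h : ∀ U : Ultrafilter ℕ, (ulim U fun N => ∫ x, (star (averageBall ha m (Φ N) f)).1 x ∂μ)
      * ∏ j, ∫ x, (Function.update f l 1 j).1 x ∂μ = 0) :
    TendstoInL2 μ (fun N => (averageBall ha m (Φ N) f).1) fun _ => 0 := by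
  by_contra hcon
  obtain ⟨U, hU, hne⟩ := exists_ultrafilter_of_not_tendsto hcon
  let g : ℕ → unitBall X := fun N => star (averageBall ha m (Φ N) f)
  choose F₀ hF₀ using fun N => exists_dual_function ha m (Φ N) μ (g N) f l
  obtain ⟨F, hF⟩ := exists_weak_mean μ (isMean_ulim U) F₀
  have hF' : ∀ w : unitBall X, ∫ x, w.1 x * F.1 x ∂μ
      = jointState ha m Φ μ U (g, Function.update f l w) := fun w => by
    rw [hF]
    simp only [hF₀]
    rfl
  have h1 : ∫ x, (f l).1 x * F.1 x ∂μ ≠ 0 := by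
    rw [hF', Function.update_eq_self]
    exact hne
  refine integral_dual_ne_zero ha m Φ hΦ hs hsem hC hU hf g hF' h1 ?_
  have h2 := hF' 1
  rw [jointState_eq ha m Φ μ hU (hC _ (mem_unimodular_update hf one_mem_unimodular)), h U] at h2
  simpa using h2

lemma tendsto_zero_of_integral_eq_zero {f : Fin ℓ → unitBall X}
    (hf : ∀ j, l < j → (f j).1 ∈ unimodularEigenfunctions G μ) {j : Fin ℓ} (hj : j ≠ l)
    (h0 : ∫ x, (f j).1 x ∂μ = 0) :
    TendstoInL2 μ (fun N => (averageBall ha m (Φ N) f).1) fun _ => 0 := by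
  refine tendsto_zero_of_ulim ha m Φ hΦ hs hsem hC hf fun U => ?_
  rw [Finset.prod_eq_zero (Finset.mem_univ j) (by rwa [Function.update_of_ne hj]), mul_zero]

/-- Outside `S` and `l` all functions are `1`. One index of `S` at a time is removed: a function of
mean zero there finishes the proof at once, and any other one is replaced by a constant. -/
lemma tendsto_zero_of_mean_zero (S : Finset (Fin ℓ)) {f : Fin ℓ → unitBall X}
    (hf : ∀ j, l < j → (f j).1 ∈ unimodularEigenfunctions G μ) (h0 : ∫ x, (f l).1 x ∂μ = 0)
    (hlS : l ∉ S) (hS : ∀ j, j ∉ S → j ≠ l → f j = 1) :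
    TendstoInL2 μ (fun N => (averageBall ha m (Φ N) f).1) fun _ => 0 := by
  induction S using Finset.induction_on generalizing f with
  | empty =>
    -- Only the factor `f l` is left, so the averages have integral `∫ f l = 0`, and the ultralimit
    -- in the hypothesis vanishes.
    refine tendsto_zero_of_ulim ha m Φ hΦ hs hsem hC hf fun U => ?_
    have h1 : ∀ N, ∫ x, (averageBall ha m (Φ N) f).1 x ∂μ = 0 := fun N => by
      have h2 := integral_mul_averageBall ha m (Φ N) μ 1 f
      have h3 : ∀ p : X × G, (1 : unitBall X).1 p.1 * ∏ j, (f j).1 (a j p.2 +ᵥ p.1)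
          = (f l).1 (a l p.2 +ᵥ p.1) := fun p => by
        rw [Finset.prod_eq_single l (fun j _ hj => by rw [hS j (Finset.notMem_empty j) hj]; rfl)
          fun h => absurd (Finset.mem_univ l) h]
        exact one_mul _
      simp only [h3] at h2
      rw [integral_prod_symm _ (Integrable.of_bound
        (measurable_factor ha l (f l).2.1).aestronglyMeasurable 1
        (Eventually.of_forall fun p => (f l).2.2 _))] at h2
      have h4 : ∀ n, ∫ x, (f l).1 (a l n +ᵥ x) ∂μ = 0 := fun n => by
        rw [← h0]
        exact (measurePreserving_vadd (a l n) μ).integral_comp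
          (measurableEmbedding_const_vadd (a l n)) (f l).1
      simp only [h4, integral_zero] at h2
      rw [← h2]
      simp
    have h5 : ∀ N, ∫ x, (star (averageBall ha m (Φ N) f)).1 x ∂μ = 0 := fun N => by
      have := (isState_integralState (G := G) μ).apply_star (averageBall ha m (Φ N) f)
      rw [integralState, integralState, h1, map_zero] at this
      exact this
    simp only [h5]
    rw [(isMean_ulim U).const, zero_mul]
  | insert j S hjS ih =>
    have hjl : j ≠ l := fun h => hlS (by rw [← h]; exact Finset.mem_insert_self j S)
    by_cases hj0 : ∫ x, (f j).1 x ∂μ = 0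
    · exact tendsto_zero_of_integral_eq_zero ha m Φ hΦ hs hsem hC hf hjl hj0
    have hupd : ∀ w : unitBall X, (l < j → w.1 ∈ unimodularEigenfunctions G μ) → ∀ i, l < i →
        (Function.update f j w i).1 ∈ unimodularEigenfunctions G μ := fun w hw i hi => by
      rcases eq_or_ne i j with rfl | hij
      · rw [Function.update_self]
        exact hw hi
      · rw [Function.update_of_ne hij]
        exact hf i hi
    have h1 : TendstoInL2 μ (fun N => (averageBall ha m (Φ N) (Function.update f j 1)).1)
        fun _ => 0 := by
      refine ih (hupd 1 fun _ => one_mem_unimodular) (by rwa [Function.update_of_ne hjl.symm])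
        (fun h => hlS (Finset.mem_insert_of_mem h)) fun i hi hil => ?_
      rcases eq_or_ne i j with rfl | hij
      · exact Function.update_self ..
      · rw [Function.update_of_ne hij]
        exact hS i (by simp [hij, hi]) hil
    -- For `l < j` subtracting the mean could leave the class of eigenfunctions. But an
    -- eigenfunction of nonzero mean has trivial eigenvalue, so it is already constant.
    by_cases hlj : l < j
    · obtain ⟨-, -, α, hα⟩ := hf j hlj
      have hα0 : α = 0 := by
        by_contra hne
        exact hj0 (hα.integral_eq_zero hne)
      obtain ⟨c, hc⟩ := ae_eq_const_of_invariant (G := G) (μ := μ) (f j).2.1 fun g => by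
        filter_upwards [hα g] with x hx
        simpa [koopman, hα0, expCircle_zero] using hx
      have h2 := h1.smul (c := c) (W := fun N => (averageBall ha m (Φ N) f).1) fun N => ?_
      · simpa using h2
      have h3 : ∀ i, (f i).1 =ᵐ[μ] Function.update (fun i => (f i).1) j (fun _ => c) i := fun i => by
        rcases eq_or_ne i j with rfl | hij
        · rw [Function.update_self]
          exact hc
        · rw [Function.update_of_ne hij]
      refine (multipleAverage_congr_ae ha m (Φ N) μ h3).trans (Eventually.of_forall fun x => ?_)
      beta_reduce
      rw [averageBall_apply, multipleAverage_apply, ← integral_const_mul]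
      refine integral_congr_ae (Eventually.of_forall fun n => ?_)
      beta_reduce
      rw [prod_update, ← Finset.mul_prod_erase _ _ (Finset.mem_univ j), Function.update_self]
      have h4 : ∏ i ∈ Finset.univ.erase j, Function.update (fun i => (f i).1) j (fun _ => c) i
          (a i n +ᵥ x) = ∏ i ∈ Finset.univ.erase j, (f i).1 (a i n +ᵥ x) :=
        Finset.prod_congr rfl fun i hi => by rw [Function.update_of_ne (Finset.ne_of_mem_erase hi)]
      rw [h4]
      change _ = c * (1 * _)
      rw [one_mul]
    · obtain ⟨v, hv0, hv⟩ := exists_mean_decomposition μ (f j)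
      have h2 := tendsto_zero_of_integral_eq_zero ha m Φ hΦ hs hsem hC
        (hupd v fun h => absurd h hlj) hjl (by rwa [Function.update_self])
      have h3 := h1.add_smul h2 (c := ∫ x, (f j).1 x ∂μ) (d := 2)
        (W := fun N => (averageBall ha m (Φ N) f).1) fun N => Eventually.of_forall fun x => by
          have := averageBall_update_add ha m (Φ N) f j hv x
          rwa [Function.update_eq_self] at this
      simpa using h3

/-- The inductive step: an eigenfunction is replaced by an arbitrary function. -/
theorem ErgodicFrom.succ : ErgodicFrom ha m Φ μ (l + 1) := by
  intro f hf
  have hf' : ∀ j, l < j → (f j).1 ∈ unimodularEigenfunctions G μ := fun j hj => hf j hj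
  obtain ⟨v, hv0, hv⟩ := exists_mean_decomposition μ (f l)
  have h1 := hC _ (mem_unimodular_update hf' one_mem_unimodular)
  have h2 := tendsto_zero_of_mean_zero ha m Φ hΦ hs hsem hC (Finset.univ.erase l)
    (f := Function.update f l v) (fun j hj => by
      rw [Function.update_of_ne hj.ne']
      exact hf' j hj) (by rwa [Function.update_self]) (Finset.notMem_erase l _)
    fun j hj hjl => absurd (Finset.mem_erase.2 ⟨hjl, Finset.mem_univ j⟩) hj
  have h3 := h1.add_smul h2 (c := ∫ x, (f l).1 x ∂μ) (d := 2)
    (W := fun N => (averageBall ha m (Φ N) f).1) fun N => Eventually.of_forall fun x => by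
      have := averageBall_update_add ha m (Φ N) f l hv x
      rwa [Function.update_eq_self] at this
  have h4 : (∫ x, (f l).1 x ∂μ) * ∏ j, ∫ x, (Function.update f l 1 j).1 x ∂μ + 2 * 0
      = ∏ j, ∫ x, (f j).1 x ∂μ := by
    rw [← Finset.mul_prod_erase _ _ (Finset.mem_univ l),
      ← Finset.mul_prod_erase (a := l) _ (fun j => ∫ x, (f j).1 x ∂μ) (Finset.mem_univ l),
      Function.update_self, mul_zero, add_zero]
    have h5 : ∏ j ∈ Finset.univ.erase l, ∫ x, (Function.update f l 1 j).1 x ∂μ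
        = ∏ j ∈ Finset.univ.erase l, ∫ x, (f j).1 x ∂μ :=
      Finset.prod_congr rfl fun i hi => by rw [Function.update_of_ne (Finset.ne_of_mem_erase hi)]
    rw [h5]
    simp
  rwa [h4] at h3

end Induction

lemma expCircle_sum {ι : Type*} (s : Finset ι) (t : ι → UnitAddCircle) :
    expCircle (∑ i ∈ s, t i) = ∏ i ∈ s, expCircle (t i) := by
  classical
  induction s using Finset.induction_on with
  | empty => simp [expCircle_zero]
  | insert i s hi ih => rw [Finset.sum_insert hi, Finset.prod_insert hi, expCircle_add, ih]

/-! ### The base case and normalization -/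

section Base

variable {G X : Type*} [AddCommGroup G] [MeasurableSpace G] [MeasurableSpace X]
  [AddAction G X] [MeasurableVAdd₂ G X] {μ : Measure X} [IsProbabilityMeasure μ]

/-- The homomorphism `α` comes without any regularity, but `e(α g)` is the integral of `T_g f · conj
f`, which is measurable in `g` by Fubini. -/
lemma HasEigenvalue.measurable {α : G →+ UnitAddCircle} {f : unitBall X}
    (hα : HasEigenvalue μ α f.1) (hf : ∀ᵐ x ∂μ, ‖f.1 x‖ = 1) :
    Measurable fun g => expCircle (α g) := by
  have h1 : ∀ g, ∫ x, f.1 (g +ᵥ x) * conj (f.1 x) ∂μ = expCircle (α g) := fun g => by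
    have h2 : ∀ᵐ x ∂μ, f.1 (g +ᵥ x) * conj (f.1 x) = expCircle (α g) := by
      filter_upwards [hα g, hf] with x hx h1
      simp only [koopman] at hx
      rw [hx, mul_assoc, Complex.mul_conj', h1]
      simp
    rw [integral_congr_ae h2]
    simp
  simp only [← h1]
  have h3 : Measurable fun p : G × X => f.1 (p.1 +ᵥ p.2) * conj (f.1 p.2) :=
    (f.2.1.comp measurable_vadd).mul
      (Complex.continuous_conj.measurable.comp (f.2.1.comp measurable_snd))
  exact (h3.stronglyMeasurable.integral_prod_right
    (f := fun g x => f.1 (g +ᵥ x) * conj (f.1 x)) (ν := μ)).measurable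

variable {ℓ : ℕ} {a : Fin ℓ → G → G} (ha : ∀ j, Measurable (a j)) (m : Measure G) (Φ : ℕ → Set G)
  [∀ N, IsProbabilityMeasure (normalized m (Φ N))]

lemma averageBall_eigenfunctions {f : Fin ℓ → unitBall X} {α : Fin ℓ → G →+ UnitAddCircle}
    (hf : ∀ j, ∀ᵐ x ∂μ, ‖(f j).1 x‖ = 1) (hα : ∀ j, HasEigenvalue μ (α j) (f j).1) (N : ℕ) :
    (averageBall ha m (Φ N) f).1 =ᵐ[μ]
      fun x => (⨍ n in Φ N, expCircle (∑ j, α j (a j n)) ∂m) * ∏ j, (f j).1 x := by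
  have h1 : ∀ j, ∀ᵐ x ∂μ, ∀ᵐ n ∂normalized m (Φ N),
      (f j).1 (a j n +ᵥ x) = expCircle (α j (a j n)) * (f j).1 x := fun j => by
    refine ae_ae_swap (p := fun n x => (f j).1 (a j n +ᵥ x) = expCircle (α j (a j n)) * (f j).1 x)
      (measurableSet_eq_fun ?_ ?_) fun n => hα j (a j n)
    · exact (f j).2.1.comp (((ha j).comp measurable_fst).vadd measurable_snd)
    · exact (((hα j).measurable (hf j)).comp ((ha j).comp measurable_fst)).mul
        ((f j).2.1.comp measurable_snd)
  filter_upwards [eventually_all.2 h1] with x hx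
  rw [averageBall_apply]
  change _ = (∫ n, expCircle (∑ j, α j (a j n)) ∂normalized m (Φ N)) * _
  rw [← integral_mul_const]
  refine integral_congr_ae ?_
  filter_upwards [eventually_all.2 hx] with n hn
  rw [expCircle_sum, ← Finset.prod_mul_distrib]
  exact Finset.prod_congr rfl fun j _ => hn j

/-- Equidistribution is joint ergodicity for eigenfunctions. -/
theorem ergodicFrom_zero [ErgodicVAdd G X μ] (hequi : GoodForEquidistribution m Φ μ a) :
    ErgodicFrom ha m Φ μ 0 := by
  intro f hf
  have hf1 : ∀ j, ∀ᵐ x ∂μ, ‖(f j).1 x‖ = 1 := fun j => (hf j (Nat.zero_le _)).2.1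
  choose α hα using fun j => (hf j (Nat.zero_le _)).2.2
  by_cases h0 : ∃ j, α j ≠ 0
  · have hspec : ∀ j, α j ∈ spec G μ := fun j => by
      refine ⟨(f j).1, unitBall.memLp _ _ _, fun h => ?_, hα j⟩
      have h1 : ∀ᵐ _ ∂μ, False := by
        filter_upwards [h, hf1 j] with x h1 h2
        rw [h1] at h2
        simp at h2
      rw [ae_iff] at h1
      simp at h1
    have hlim := hequi α hspec h0
    obtain ⟨j, hj⟩ := h0
    rw [Finset.prod_eq_zero (Finset.mem_univ j) ((hα j).integral_eq_zero hj)]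
    have h1 := ENNReal.Tendsto.mul_const (b := eLpNorm (fun x => ∏ j, (f j).1 x) 2 μ)
      hlim.enorm (Or.inr ?_)
    · rw [enorm_zero, zero_mul] at h1
      refine h1.congr fun N => ?_
      rw [← eLpNorm_const_smul]
      refine (eLpNorm_congr_ae ?_).symm
      filter_upwards [averageBall_eigenfunctions ha m Φ hf1 hα N] with x hx
      rw [hx, sub_zero]
      rfl
    · exact (MemLp.of_bound (Finset.measurable_prod Finset.univ
        fun j _ => (f j).2.1).aestronglyMeasurable 1 (Eventually.of_forall fun x =>
          norm_prod_le _ f fun _ => x)).2.ne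
  · push Not at h0
    have hc : ∀ j, ∃ c, (f j).1 =ᵐ[μ] fun _ => c := fun j =>
      ae_eq_const_of_invariant (G := G) (f j).2.1 fun g => by
        filter_upwards [hα j g] with x hx
        simpa [koopman, h0 j, expCircle_zero] using hx
    choose c hc using hc
    have h1 : ∀ j, ∫ x, (f j).1 x ∂μ = c j := fun j => by
      rw [integral_congr_ae (hc j)]
      simp
    simp only [h1]
    refine tendsto_const_nhds.congr fun N => (eLpNorm_eq_zero_of_ae_zero ?_).symm
    filter_upwards [averageBall_eigenfunctions ha m Φ hf1 hα N, eventually_all.2 hc] with x hx h2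
    simp only [hx, h2, h0, AddMonoidHom.zero_apply, Finset.sum_const_zero, expCircle_zero]
    have h3 : (⨍ _ in Φ N, (1 : ℂ) ∂m) = 1 := by
      change ∫ _, (1 : ℂ) ∂normalized m (Φ N) = 1
      simp
    rw [h3, one_mul, sub_self, Pi.zero_apply]

omit [IsProbabilityMeasure μ] in
lemma exists_unitBall_of_memLp_top {f : X → ℂ} (hf : MemLp f ⊤ μ) :
    ∃ (K : ℂ) (h : unitBall X), f =ᵐ[μ] fun x => K * h.1 x := by
  obtain ⟨f', hf', hff'⟩ := hf.1
  have hm : Measurable f' := hf'.measurable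
  -- The added `1` makes `K` positive even if `f` vanishes almost everywhere.
  set K : ℝ := (eLpNormEssSup f μ).toReal + 1 with hK
  have hK0 : 0 < K := by positivity
  have hb : ∀ᵐ x ∂μ, ‖f x‖ ≤ K := by
    have h1 : eLpNormEssSup f μ ≠ ⊤ := by
      rw [← eLpNorm_exponent_top]
      exact hf.2.ne
    filter_upwards [ae_le_eLpNormEssSup (f := f) (μ := μ)] with x hx
    have h2 := ENNReal.toReal_mono h1 hx
    rw [toReal_enorm] at h2
    linarith
  refine ⟨K, ⟨fun x => if ‖f' x‖ ≤ K then f' x / K else 0,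
    Measurable.ite (measurableSet_le hm.norm measurable_const) (hm.div_const _) measurable_const,
    fun x => ?_⟩, ?_⟩
  · by_cases hx : ‖f' x‖ ≤ K
    · beta_reduce
      rw [if_pos hx, norm_div, Complex.norm_real, Real.norm_of_nonneg hK0.le]
      exact div_le_one_of_le₀ hx hK0.le
    · beta_reduce
      rw [if_neg hx, norm_zero]
      exact zero_le_one
  · filter_upwards [hff', hb] with x h1 h2
    rw [h1] at h2
    rw [if_pos h2, h1, mul_div_cancel₀]
    exact_mod_cast hK0.ne'

end Base

end LCAJoint

end

/-! ### Conclusion -/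

open LCAJoint

/-- Joint ergodicity criterion for actions of second-countable locally compact abelian groups. -/
theorem theorem1p1 {G : Type*} [AddCommGroup G] [TopologicalSpace G] [IsTopologicalAddGroup G]
    [LocallyCompactSpace G] [SecondCountableTopology G] [T2Space G]
    [MeasurableSpace G] [BorelSpace G]
    (m : Measure G) [m.IsAddHaarMeasure]
    (Φ : ℕ → Set G) (hΦ : LCAJoint.IsFolnerSeq m Φ)
    {X : Type*} [MeasurableSpace X] [StandardBorelSpace X]
    (μ : Measure X) [IsProbabilityMeasure μ]
    [AddAction G X] [MeasurableVAdd₂ G X] [ErgodicVAdd G X μ]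
    (ℓ : ℕ) (a : Fin ℓ → G → G) (ha : ∀ j, AEMeasurable (a j) m)
    (hsem : LCAJoint.GoodForSeminormEstimates m Φ μ a)
    (hequi : LCAJoint.GoodForEquidistribution m Φ μ a) :
    LCAJoint.JointlyErgodic m Φ μ a := by
  have hprob := hΦ.isProbabilityMeasure_normalized
  -- The averages ignore null sets of `G`, so the `a j` may be replaced by measurable
  -- representatives.
  let b : Fin ℓ → G → G := fun j => (ha j).mk (a j)
  have hb : ∀ j, Measurable (b j) := fun j => (ha j).measurable_mk
  have hab : ∀ N, ∀ᵐ n ∂normalized m (Φ N), ∀ j, a j n = b j n := fun N =>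
    ae_normalized (eventually_all.2 fun j => (ha j).ae_eq_mk)
  have havg : ∀ N (f : Fin ℓ → X → ℂ),
      multipleAverage m (Φ N) a f = multipleAverage m (Φ N) b f := fun N f => by
    funext x
    simp only [multipleAverage_apply]
    refine integral_congr_ae ?_
    filter_upwards [hab N] with n hn
    simp only [hn]
  have hequi' : GoodForEquidistribution m Φ μ b := fun α hα h0 => by
    refine (hequi α hα h0).congr fun N => ?_
    change ∫ n, _ ∂normalized m (Φ N) = ∫ n, _ ∂normalized m (Φ N)
    refine integral_congr_ae ?_
    filter_upwards [hab N] with n hn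
    simp only [hn]
  obtain ⟨s, hs, hsem⟩ := hsem
  have hC : ∀ l, l ≤ ℓ → ErgodicFrom hb m Φ μ l := by
    intro l
    induction l with
    | zero => exact fun _ => ergodicFrom_zero hb m Φ hequi'
    | succ l ih =>
      intro hl
      refine ErgodicFrom.succ hb m Φ hΦ hs (l := ⟨l, hl⟩) (fun f h0 hf => ?_) (ih (by omega))
      have h1 := hsem (fun j => (f j).1) (fun j => unitBall.memLp _ _ _) ⟨l, hl⟩ h0 hf
      simp only [havg] at h1
      exact h1
  intro f hf
  choose K h hK using fun j => exists_unitBall_of_memLp_top (hf j)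
  -- At level `ℓ` no function has to be an eigenfunction, and the scalars `K j` factor out by
  -- multilinearity.
  have h1 := (hC ℓ le_rfl h fun j hj => absurd j.2 (not_lt.2 hj)).smul (c := ∏ j, K j)
    (W := fun N => multipleAverage m (Φ N) a f) fun N => ?_
  · have h2 : ∏ j, ∫ y, f j y ∂μ = (∏ j, K j) * ∏ j, ∫ x, (h j).1 x ∂μ := by
      rw [← Finset.prod_mul_distrib]
      refine Finset.prod_congr rfl fun j _ => ?_
      rw [integral_congr_ae (hK j), integral_const_mul]
    rw [h2]
    exact h1
  · rw [havg]
    refine (multipleAverage_congr_ae hb m (Φ N) μ hK).trans (Eventually.of_forall fun x => ?_)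
    beta_reduce
    rw [averageBall_apply, multipleAverage_apply, ← integral_const_mul]
    simp only [Finset.prod_mul_distrib]
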